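/- Let $N>2$ be an integer, let $\Gamma(N)=\ker(\mathrm{SL}(2,\mathbb Z)\to S_N)$, where $S_N=\mathrm{SL}(2,\mathbb Z/N\mathbb Z)$, and for $k\ge 2$ let $V_k=\mathrm{Sym}^{k-2}\mathbb C^2$ be the symmetric power of the tautological representation of $\mathrm{SL}(2,\mathbb Z)$. Let $H^1_P(\Gamma(N),V_k)$ be the parabolic cohomology group, that is, the space of $1$-cocycles $u:\Gamma(N)\to V_k$ with $u(\pi)\in(\pi-1)V_k$ for every parabolic $\pi\in\Gamma(N)$, modulo $1$-coboundaries. It is a finite-dimensional representation of $S_N$ through $(gu)(\gamma)=g\,u(g^{-1}\gamma g)$, $g\in\mathrm{SL}(2,\mathbb Z)$. Let $Z=\{\pm1\}$ be the center of $\mathrm{SL}(2,\mathbb Z)$ and put $$\Gamma_\rho=\left\langle\begin{pmatrix}0&-1\\1&1\end{pmatrix}\right\rangle,\qquad \Gamma_i=\left\langle\begin{pmatrix}0&-1\\1&0\end{pmatrix}\right\rangle,\qquad \Gamma_\infty=\left\langle\pm\begin{pmatrix}1&1\\0&1\end{pmatrix}\right\rangle,$$ the stabilizers of $\rho=e^{2\pi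 i/3}$, $i$ and $\infty$. Let $\overline Z,\overline\Gamma_\rho,\overline\Gamma_i,\overline\Gamma_\infty$ be the images of these groups in $S_N$. Let $\mathrm{sgn}$ be the character of $\overline Z$ and of $\overline\Gamma_\infty$ sending (the image of) $\pm\begin{pmatrix}1&n\\0&1\end{pmatrix}$ to $\pm1$, let $\chi_\rho$ be the character of $\overline\Gamma_\rho\cong\Gamma_\rho$ with $\begin{pmatrix}0&-1\\1&1\end{pmatrix}\mapsto e^{2\pi i/6}$, and let $\chi_i$ be the character of $\overline\Gamma_i\cong\Gamma_i$ with $\begin{pmatrix}0&1\\-1&0\end{pmatrix}\mapsto i$. Define virtual representations $\varepsilon_\rho$ of $\overline\Gamma_\rho$ and $\varepsilon_i$ of $\overline\Gamma_i$ by $$\varepsilon_\rho=\begin{cases}-[1]&k\equiv0\\0&k\equiv1\\ [1]&k\equiv2\\-[\chi_\rho^3]&k\equiv3\\0&k\equiv4\\ [\chi_\rho^3]&k\equiv5\end{cases}\pmod 6,\qquad \varepsilon_i=\begin{cases}-[1]&k\equiv0\\0&k\equiv1\\-[\chi_i^2]&k\equiv2\\0&k\equiv3\end{cases}\pmod 4,$$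 and let $f(k)=(k-1)-\lfloor k/3\rfloor-\lfloor k/2\rfloor$. Then, in the Grothendieck group of finite-dimensional complex representations of $S_N$, $$[H^1_P(\Gamma(N),V_2)]-2[1]=\left[\mathrm{Ind}_{\overline Z}^{S_N}1\right]-\left[\mathrm{Ind}_{\overline\Gamma_\rho}^{S_N}1\right]-\left[\mathrm{Ind}_{\overline\Gamma_i}^{S_N}1\right]-\left[\mathrm{Ind}_{\overline\Gamma_\infty}^{S_N}1\right],$$ and for every $k>2$ $$[H^1_P(\Gamma(N),V_k)]=f(k)\left[\mathrm{Ind}_{\overline Z}^{S_N}\mathrm{sgn}^k\right]-\left[\mathrm{Ind}_{\overline\Gamma_\rho}^{S_N}\varepsilon_\rho\right]-\left[\mathrm{Ind}_{\overline\Gamma_i}^{S_N}\varepsilon_i\right]-\left[\mathrm{Ind}_{\overline\Gamma_\infty}^{S_N}\mathrm{sgn}^k\right].$$ -/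

import Mathlib

open scoped MatrixGroups

noncomputable section

namespace ParabolicCohomology

/-! ### The Grothendieck group of finite-dimensional complex representations -/

section Grothendieck

/-- The relations `[Y] - [X] - [Z]`, one for each short exact sequence `0 → X → Y → Z → 0` of
finite-dimensional complex representations of `G`. -/
def exactRelations (G : Type) [Group G] : Set (FreeAbelianGroup (FDRep ℂ G)) :=
  {r | ∃ (X Y Z : FDRep ℂ G) 
    (f : Representation.IntertwiningMap X.ρ Y.ρ) (g : Representation.IntertwiningMap Y.ρ Z.ρ),
    Function.Injective f ∧ Function.Exact f g ∧ Function.Surjective g ∧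
    r = FreeAbelianGroup.of Y - FreeAbelianGroup.of X - FreeAbelianGroup.of Z}

/-- The Grothendieck group of the finite-dimensional complex representations of `G`. -/
abbrev GrothendieckGroup (G : Type) [Group G] : Type 1 :=
  FreeAbelianGroup (FDRep ℂ G) ⧸ AddSubgroup.closure (exactRelations G)

/-- The class `[ρ]` of a finite-dimensional complex representation. -/
def repClass {G V : Type} [Group G] [AddCommGroup V] [Module ℂ V] [Module.Finite ℂ V]
    (ρ : Representation ℂ G V) : GrothendieckGroup G :=
  QuotientAddGroup.mk (FreeAbelianGroup.of (FDRep.of ρ))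

/-- The one-dimensional representation attached to a character with values in `ℂˣ`. -/
def charRep {G : Type} [Group G] (χ : G →* ℂˣ) : Representation ℂ G ℂ where
  toFun g := (χ g : ℂ) • LinearMap.id
  map_one' := by ext; simp
  map_mul' g h := by ext; simp [mul_comm]

/-- The class `[χ]` of a character. -/
def charClass {G : Type} [Group G] (χ : G →* ℂˣ) : GrothendieckGroup G :=
  repClass (charRep χ)

/-- The representation of `G` induced by a representation `ρ` of the subgroup `H` of the finite
group `G`: the space of functions `F : G → V` with `F (h * x) = ρ h (F x)` for `h ∈ H`, on which
`G` acts by right translation. -/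
def indRep {G V : Type} [Group G] (H : Subgroup G) [AddCommGroup V] [Module ℂ V]
    (ρ : Representation ℂ H V) : Representation ℂ G (Representation.coindV H.subtype ρ) :=
  Representation.coind H.subtype ρ

instance {G V : Type} [Group G] [Finite G] (H : Subgroup G) [AddCommGroup V] [Module ℂ V]
    [Module.Finite ℂ V] (ρ : Representation ℂ H V) :
    Module.Finite ℂ (Representation.coindV H.subtype ρ) :=
  inferInstance

/-- Induction from a subgroup of a finite group preserves surjections. -/
lemma indRep_surjective {G : Type} [Group G] [Finite G] (H : Subgroup G)
    {V W : Type} [AddCommGroup V] [Module ℂ V] [AddCommGroup W] [Module ℂ W]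
    {σ : Representation ℂ H V} {τ : Representation ℂ H W} (g : σ.IntertwiningMap τ)
    (hg : Function.Surjective g) :
    Function.Surjective (Representation.coindMap H.subtype g) := by
  classical
  have := Fintype.ofFinite H
  rintro ⟨F, hF⟩
  choose s hs using hg
  have hcard : (Fintype.card H : ℂ) ≠ 0 := Nat.cast_ne_zero.2 Fintype.card_ne_zero
  refine ⟨⟨fun x => (Fintype.card H : ℂ)⁻¹ • ∑ h : H, σ h⁻¹ (s (F (h * x))), ?_⟩, ?_⟩
  · intro a x
    simp only [map_smul, map_sum]
    congr 1
    refine Fintype.sum_equiv (Equiv.mulRight a) _ _ fun h => ?_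
    simp [← Module.End.mul_apply, ← map_mul, mul_assoc]
  · ext x
    have key : ∀ h : H, g (σ h⁻¹ (s (F (h * x)))) = F x := by
      intro h
      have h1 := LinearMap.congr_fun (g.isIntertwining' h⁻¹) (s (F (h * x)))
      have h2 := hF h x
      simp only [Subgroup.subtype_apply] at h2
      change g (σ h⁻¹ (s (F (h * x)))) = τ h⁻¹ (g (s (F (h * x)))) at h1
      rw [h1, hs, h2, ← Module.End.mul_apply, ← map_mul]
      simp
    change g ((Fintype.card H : ℂ)⁻¹ • ∑ h : H, σ h⁻¹ (s (F (h * x)))) = F x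
    rw [map_smul, map_sum]
    simp only [key]
    simp only [Finset.sum_const, Finset.card_univ]
    rw [← Nat.cast_smul_eq_nsmul ℂ, smul_smul, inv_mul_cancel₀ hcard, one_smul]

/-- The map `[V] ↦ [Ind_H^G V]` from the Grothendieck group of `H` to that of `G`. -/
def ind {G : Type} [Group G] [Finite G] (H : Subgroup G) :
    GrothendieckGroup H →+ GrothendieckGroup G :=
  QuotientAddGroup.lift _
    (FreeAbelianGroup.lift fun X : FDRep ℂ H => repClass (indRep H X.ρ)) <| by
    rw [AddSubgroup.closure_le]
    rintro _ ⟨X, Y, Z, f, g, hf, hfg, hg, rfl⟩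
    have hmem : FreeAbelianGroup.of (FDRep.of (indRep H Y.ρ)) -
        FreeAbelianGroup.of (FDRep.of (indRep H X.ρ)) -
        FreeAbelianGroup.of (FDRep.of (indRep H Z.ρ)) ∈
          AddSubgroup.closure (exactRelations G) := by
      refine AddSubgroup.subset_closure ⟨FDRep.of (indRep H X.ρ), FDRep.of (indRep H Y.ρ),
        FDRep.of (indRep H Z.ρ), Representation.coindMap H.subtype f,
        Representation.coindMap H.subtype g, ?_, ?_, indRep_surjective H g hg, rfl⟩
      · intro a b hab
        apply Subtype.ext
        funext x
        exact hf (congrFun (congrArg Subtype.val hab) x)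
      · intro b
        constructor
        · intro hb
          have hb' : ∀ x, g (b.1 x) = 0 := fun x => congrFun (congrArg Subtype.val hb) x
          choose a ha using fun x => (hfg (b.1 x)).1 (hb' x)
          refine ⟨⟨a, fun h x => hf ?_⟩, Subtype.ext (funext ha)⟩
          have h1 := LinearMap.congr_fun (f.isIntertwining' h) (a x)
          change f (X.ρ h (a x)) = Y.ρ h (f (a x)) at h1
          rw [ha, h1, ha]
          exact b.2 h x
        · rintro ⟨a, rfl⟩
          apply Subtype.ext
          funext x
          exact (hfg _).2 ⟨a.1 x, rfl⟩
    simp only [SetLike.mem_coe, AddMonoidHom.mem_ker, map_sub, FreeAbelianGroup.lift_apply_of]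
    exact (QuotientAddGroup.eq_zero_iff _).2 hmem

end Grothendieck

/-! ### The parabolic cohomology of `Γ(N)` -/

section Cohomology

/-- Reduction modulo `N`, from `SL(2, ℤ)` to `S_N = SL(2, ℤ/Nℤ)`. -/
abbrev reduction (N : ℕ) : SL(2, ℤ) →* SL(2, ZMod N) :=
  Matrix.SpecialLinearGroup.map (Int.castRingHom (ZMod N))

/-- The substitution `X_j ↦ ∑ i, g i j X_i`: the action of `g` on the symmetric algebra
`ℂ[X_0, X_1]` of the tautological representation `ℂ²`, whose standard basis is `X_0, X_1`. -/
def subst (g : SL(2, ℤ)) : MvPolynomial (Fin 2) ℂ →ₐ[ℂ] MvPolynomial (Fin 2) ℂ :=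
  MvPolynomial.aeval fun j => ∑ i, MvPolynomial.C ((g i j : ℤ) : ℂ) * MvPolynomial.X i

/-- The space of `Sym^n ℂ²`: homogeneous polynomials of degree `n` in the standard basis
`X_0, X_1` of `ℂ²`. -/
abbrev SymPow (n : ℕ) : Type := MvPolynomial.homogeneousSubmodule (Fin 2) ℂ n

instance (n : ℕ) : Module.Finite ℂ (SymPow n) :=
  Module.Finite.iff_fg.2 (MvPolynomial.homogeneousSubmodule_fg (Fin 2) ℂ n)

lemma subst_isHomogeneous (g : SL(2, ℤ)) {n : ℕ} {p : MvPolynomial (Fin 2) ℂ}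
    (hp : p.IsHomogeneous n) : (subst g p).IsHomogeneous n := by
  have h : ∀ j, (∑ i, MvPolynomial.C ((g i j : ℤ) : ℂ) * MvPolynomial.X i :
      MvPolynomial (Fin 2) ℂ).IsHomogeneous 1 := fun j =>
    MvPolynomial.IsHomogeneous.sum _ _ _ fun i _ =>
      MvPolynomial.isHomogeneous_C_mul_X _ i
  have h2 := hp.aeval _ h
  rwa [one_mul] at h2

/-- The `n`-th symmetric power of the tautological representation of `SL(2, ℤ)` on `ℂ²`. -/
def symRep (n : ℕ) : Representation ℂ SL(2, ℤ) (SymPow n) where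
  toFun g := (subst g).toLinearMap.restrict fun _ hp => subst_isHomogeneous g hp
  map_one' := by
    have h : subst 1 = AlgHom.id ℂ _ := by
      refine MvPolynomial.algHom_ext fun j => ?_
      fin_cases j <;> simp [subst, Fin.sum_univ_two]
    ext1 p
    apply Subtype.ext
    change subst 1 p.1 = p.1
    rw [h, AlgHom.id_apply]
  map_mul' g g' := by
    have h : subst (g * g') = (subst g).comp (subst g') := by
      refine MvPolynomial.algHom_ext fun j => ?_
      simp only [subst, MvPolynomial.aeval_X, AlgHom.comp_apply, map_mul,
        MvPolynomial.algHom_C, Fin.sum_univ_two, Matrix.SpecialLinearGroup.coe_mul,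
        Matrix.mul_apply, MvPolynomial.algebraMap_eq, Int.cast_add, Int.cast_mul, map_add]
      ring
    ext1 p
    apply Subtype.ext
    change subst (g * g') p.1 = subst g (subst g' p.1)
    rw [h, AlgHom.comp_apply]

variable (N : ℕ) {V : Type} [AddCommGroup V] [Module ℂ V] (ρ : Representation ℂ SL(2, ℤ) V)

/-- The restriction to `Γ(N)` of a representation of `SL(2, ℤ)`. -/
abbrev resGamma : Rep ℂ (CongruenceSubgroup.Gamma N) :=
  Rep.of (ρ.comp (CongruenceSubgroup.Gamma N).subtype)

/-- The parabolic cocycles of `Γ(N)`: the `1`-cocycles `u` with `u(π) ∈ (π - 1)V` for every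
parabolic element `π` of `Γ(N)`. -/
def parabolicCocycles : Submodule ℂ (CongruenceSubgroup.Gamma N → V) :=
  groupCohomology.cocycles₁ (resGamma N ρ) ⊓
    { carrier := {u | ∀ π : CongruenceSubgroup.Gamma N,
        (π : SL(2, ℤ)).val.IsParabolic → u π ∈ LinearMap.range (ρ π - 1)}
      add_mem' := fun ha hb π hπ => add_mem (ha π hπ) (hb π hπ)
      zero_mem' := fun _ _ => zero_mem _
      smul_mem' := fun c _ ha π hπ => Submodule.smul_mem _ c (ha π hπ) }

lemma mem_parabolicCocycles (u : CongruenceSubgroup.Gamma N → V) :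
    u ∈ parabolicCocycles N ρ ↔
      (∀ γ δ : CongruenceSubgroup.Gamma N, u (γ * δ) = ρ γ (u δ) + u γ) ∧
      ∀ π : CongruenceSubgroup.Gamma N,
        (π : SL(2, ℤ)).val.IsParabolic → ∃ v, ρ π v - v = u π := by
  have := groupCohomology.mem_cocycles₁_iff (A := resGamma N ρ) u
  rw [parabolicCocycles, Submodule.mem_inf, this]
  rfl

/-- The coboundaries `γ ↦ γ v - v`, as a subspace of the space of parabolic cocycles. -/
def parabolicCoboundaries : Submodule ℂ (parabolicCocycles N ρ) :=
  (groupCohomology.coboundaries₁ (resGamma N ρ)).submoduleOf (parabolicCocycles N ρ)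

lemma mem_parabolicCoboundaries (u : parabolicCocycles N ρ) :
    u ∈ parabolicCoboundaries N ρ ↔
      ∃ v, ∀ γ : CongruenceSubgroup.Gamma N, ρ γ v - v = u.1 γ := by
  have : u ∈ parabolicCoboundaries N ρ ↔ ∃ v, (fun γ : CongruenceSubgroup.Gamma N =>
    ρ γ v - v) = u.1 := Iff.rfl
  simp [this, funext_iff]

/-- The first parabolic cohomology group `H¹_P(Γ(N), V)`. -/
abbrev ParabolicH1 : Type := parabolicCocycles N ρ ⧸ parabolicCoboundaries N ρ

/-- The element `g⁻¹ γ g` of `Γ(N)`. -/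
def conjGamma (g : SL(2, ℤ)) (γ : CongruenceSubgroup.Gamma N) : CongruenceSubgroup.Gamma N :=
  ⟨g⁻¹ * γ * g, by
    simpa using (CongruenceSubgroup.Gamma_normal N).conj_mem γ γ.2 g⁻¹⟩

/-- The action `(g u)(γ) = g u(g⁻¹ γ g)` of `SL(2, ℤ)` on functions `Γ(N) → V`. -/
def actFun (g : SL(2, ℤ)) :
    (CongruenceSubgroup.Gamma N → V) →ₗ[ℂ] (CongruenceSubgroup.Gamma N → V) where
  toFun u γ := ρ g (u (conjGamma N g γ))
  map_add' _ _ := by ext; simp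
  map_smul' _ _ := by ext; simp

lemma rho_conj (g : SL(2, ℤ)) (γ : CongruenceSubgroup.Gamma N) (v : V) :
    ρ g (ρ (conjGamma N g γ) v) = ρ γ (ρ g v) := by
  simp only [conjGamma, ← Module.End.mul_apply, ← map_mul]
  congr 2
  group

lemma isParabolic_conjGamma (g : SL(2, ℤ)) (γ : CongruenceSubgroup.Gamma N)
    (h : (γ : SL(2, ℤ)).val.IsParabolic) :
    ((conjGamma N g γ : CongruenceSubgroup.Gamma N) : SL(2, ℤ)).val.IsParabolic := by
  have h2 := (Matrix.isParabolic_conj'_iff (m := (γ : SL(2, ℤ)).val)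
    (Matrix.SpecialLinearGroup.toGL g)).2 h
  convert h2 using 1
  rw [← Matrix.coe_units_inv, ← map_inv]
  rfl

lemma actFun_mem (g : SL(2, ℤ)) {u : CongruenceSubgroup.Gamma N → V}
    (hu : u ∈ parabolicCocycles N ρ) : actFun N ρ g u ∈ parabolicCocycles N ρ := by
  rw [mem_parabolicCocycles] at hu ⊢
  refine ⟨fun γ δ => ?_, fun π hπ => ?_⟩
  · have h : conjGamma N g (γ * δ) = conjGamma N g γ * conjGamma N g δ := by
      apply Subtype.ext
      simp only [conjGamma, Subgroup.coe_mul]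
      group
    change ρ g (u (conjGamma N g (γ * δ))) =
      ρ γ (ρ g (u (conjGamma N g δ))) + ρ g (u (conjGamma N g γ))
    rw [h, hu.1, map_add, rho_conj]
  · obtain ⟨v, hv⟩ := hu.2 _ (isParabolic_conjGamma N g π hπ)
    refine ⟨ρ g v, ?_⟩
    change _ = ρ g (u (conjGamma N g π))
    rw [← hv, map_sub, rho_conj]

/-- The action of `SL(2, ℤ)` on the parabolic cocycles of its normal subgroup `Γ(N)`. -/
def cocycleRep : Representation ℂ SL(2, ℤ) (parabolicCocycles N ρ) where
  toFun g := (actFun N ρ g).restrict fun _ hu => actFun_mem N ρ g hu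
  map_one' := by
    ext u γ
    simp [LinearMap.restrict_apply, actFun, conjGamma]
  map_mul' g h := by
    ext u γ
    simp [LinearMap.restrict_apply, actFun, conjGamma, mul_assoc]

lemma cocycleRep_coboundaries (g : SL(2, ℤ)) :
    parabolicCoboundaries N ρ ≤ (parabolicCoboundaries N ρ).comap (cocycleRep N ρ g) := by
  intro u hu
  rw [Submodule.mem_comap, mem_parabolicCoboundaries]
  obtain ⟨v, hv⟩ := (mem_parabolicCoboundaries N ρ u).1 hu
  refine ⟨ρ g v, fun γ => ?_⟩
  change _ = ρ g (u.1 (conjGamma N g γ))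
  rw [← hv, map_sub, rho_conj]

/-- The action of `SL(2, ℤ)` on `H¹_P(Γ(N), V)`. -/
def h1RepSL2Z : Representation ℂ SL(2, ℤ) (ParabolicH1 N ρ) where
  toFun g := Submodule.mapQ _ _ (cocycleRep N ρ g) (cocycleRep_coboundaries N ρ g)
  map_one' := by
    ext u
    simp
  map_mul' g h := by
    ext u
    simp

/-- `Γ(N)` acts trivially on its own parabolic cohomology. -/
instance h1RepSL2Z_trivial :
    Representation.IsTrivial ((h1RepSL2Z N ρ).comp (reduction N).ker.subtype) where
  out := by
    rintro ⟨δ, hδ⟩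
    refine LinearMap.ext fun x => ?_
    obtain ⟨u, rfl⟩ := Submodule.Quotient.mk_surjective _ x
    change Submodule.Quotient.mk (cocycleRep N ρ δ u) = Submodule.Quotient.mk u
    rw [Submodule.Quotient.eq, mem_parabolicCoboundaries]
    let d : CongruenceSubgroup.Gamma N := ⟨δ, hδ⟩
    have hu := ((mem_parabolicCocycles N ρ u.1).1 u.2).1
    refine ⟨u.1 d, fun γ => ?_⟩
    change _ = ρ δ (u.1 (conjGamma N δ γ)) - u.1 γ
    have h1 : d * conjGamma N δ γ = γ * d := by
      apply Subtype.ext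
      simp only [conjGamma, Subgroup.coe_mul, d]
      group
    have h2 := hu d (conjGamma N δ γ)
    rw [h1, hu] at h2
    have h3 : ρ δ (u.1 (conjGamma N δ γ)) = ρ γ (u.1 d) + u.1 γ - u.1 d := by
      rw [h2, add_sub_cancel_right]
    rw [h3]
    abel

/-- Reduction modulo `N ≠ 0` is surjective. -/
lemma reduction_surjective [NeZero N] : Function.Surjective (reduction N) := by
  intro A
  obtain ⟨a, ha⟩ := ZMod.intCast_surjective (A 0 0)
  obtain ⟨b, hb⟩ := ZMod.intCast_surjective (A 0 1)
  obtain ⟨c₀, hc₀⟩ := ZMod.intCast_surjective (A 1 0)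
  obtain ⟨d, hd⟩ := ZMod.intCast_surjective (A 1 1)
  obtain ⟨c, hc, hcpos⟩ : ∃ c : ℤ, (c : ZMod N) = A 1 0 ∧ c ≠ 0 := by
    by_cases h : c₀ = 0
    · refine ⟨N, ?_, by exact_mod_cast NeZero.ne N⟩
      rw [← hc₀, h]
      simp
    · exact ⟨c₀, hc₀, h⟩
  obtain ⟨m, hm⟩ : (N : ℤ) ∣ a * d - b * c - 1 := by
    rw [← ZMod.intCast_zmod_eq_zero_iff_dvd]
    have hdet := A.det_coe
    rw [Matrix.det_fin_two] at hdet
    push_cast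
    rw [ha, hb, hc, hd, hdet, sub_self]
  obtain ⟨t, ht⟩ : ∃ t : ℤ, IsCoprime c (d + t * N) := by
    obtain ⟨x, y, hxy⟩ : ∃ x y : ℤ, (Int.gcd N c : ℤ) = N * x + c * y :=
      ⟨_, _, Int.gcd_eq_gcd_ab N c⟩
    set e : ℕ := Int.gcd N c with he
    have heN : (e : ℤ) ∣ N := Int.gcd_dvd_left _ _
    have hec : (e : ℤ) ∣ c := Int.gcd_dvd_right _ _
    have hcop : IsCoprime d (e : ℤ) := by
      obtain ⟨p, hp⟩ := heN
      obtain ⟨q, hq⟩ := hec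
      refine ⟨a, -(b * q) - p * m, ?_⟩
      rw [hp, hq] at hm
      linarith
    have hec' : e ∣ c.natAbs := Int.natCast_dvd.1 hec
    have : NeZero c.natAbs := ⟨Int.natAbs_ne_zero.2 hcpos⟩
    obtain ⟨v, hv⟩ := ZMod.unitsMap_surjective hec' (ZMod.unitOfIsCoprime d hcop)
    obtain ⟨w, hw⟩ := ZMod.intCast_surjective (v : ZMod c.natAbs)
    have hwd : (e : ℤ) ∣ w - d := by
      rw [← ZMod.intCast_zmod_eq_zero_iff_dvd]
      have h1 := congrArg Units.val hv
      rw [ZMod.unitsMap_val, ZMod.coe_unitOfIsCoprime, ← hw] at h1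
      push_cast
      rw [← h1, ZMod.cast_intCast hec', sub_self]
    have hwc : IsCoprime w c := by
      have h2 : IsUnit (w : ZMod c.natAbs) := hw ▸ v.isUnit
      have h3 := (ZMod.coe_int_isUnit_iff_isCoprime w c.natAbs).1 h2
      rcases Int.natAbs_eq c with h5 | h5
      · rw [h5]
        exact h3.symm
      · rw [h5]
        exact h3.symm.neg_right
    obtain ⟨s, hs⟩ := hwd
    refine ⟨s * x, ?_⟩
    have h4 : d + s * x * N = w + c * (-(s * y)) := by
      have : w = d + e * s := by linarith
      rw [this, hxy]
      ring
    rw [h4]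
    exact (IsCoprime.add_mul_left_right hwc.symm _)
  obtain ⟨p, q, hpq⟩ := ht
  refine ⟨⟨!![a + (q * (-(m + a * t))) * N, b - (p * (-(m + a * t))) * N; c, d + t * N], ?_⟩, ?_⟩
  · rw [Matrix.det_fin_two_of]
    linear_combination hm + (-(m + a * t)) * N * hpq
  · ext i j
    change ((!![a + (q * (-(m + a * t))) * N, b - (p * (-(m + a * t))) * N; c, d + t * N] i j :
      ℤ) : ZMod N) = A i j
    fin_cases i <;> fin_cases j <;> simp [ha, hb, hc, hd]

/-- The representation of `S_N = SL(2, ℤ/Nℤ)` on `H¹_P(Γ(N), V)`: an element of `S_N` acts through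
any of its lifts to `SL(2, ℤ)`. -/
def h1Rep [NeZero N] : Representation ℂ SL(2, ZMod N) (ParabolicH1 N ρ) :=
  (Representation.ofQuotient (h1RepSL2Z N ρ) (reduction N).ker).comp
    (QuotientGroup.quotientKerEquivOfSurjective (reduction N)
      (reduction_surjective N)).symm.toMonoidHom

lemma h1Rep_reduction [NeZero N] (g : SL(2, ℤ)) :
    h1Rep N ρ (reduction N g) = h1RepSL2Z N ρ g := by
  have h : (QuotientGroup.quotientKerEquivOfSurjective (reduction N)
      (reduction_surjective N)).symm (reduction N g) = (g : SL(2, ℤ) ⧸ (reduction N).ker) := by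
    rw [MulEquiv.symm_apply_eq]
    rfl
  refine LinearMap.ext fun x => ?_
  change Representation.ofQuotient (h1RepSL2Z N ρ) (reduction N).ker
    ((QuotientGroup.quotientKerEquivOfSurjective (reduction N)
      (reduction_surjective N)).symm (reduction N g)) x = _
  rw [h]
  rfl

instance [NeZero N] [Module.Finite ℂ V] : Module.Finite ℂ (parabolicCocycles N ρ) := by
  have hfg : Group.FG SL(2, ℤ) := by
    rw [Group.fg_iff]
    exact ⟨_, _root_.SpecialLinearGroup.SL2Z_generators, Set.toFinite _⟩
  have hΓ : Group.FG (CongruenceSubgroup.Gamma N) := inferInstance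
  obtain ⟨S, hS, hfin⟩ := Group.fg_iff.1 hΓ
  have := hfin.to_subtype
  let r : parabolicCocycles N ρ →ₗ[ℂ] (S → V) :=
    { toFun := fun u s => u.1 s
      map_add' := fun _ _ => rfl
      map_smul' := fun _ _ => rfl }
  refine Module.Finite.of_injective r ?_
  rw [← LinearMap.ker_eq_bot, LinearMap.ker_eq_bot']
  intro u hu
  have hc := ((mem_parabolicCocycles N ρ u.1).1 u.2).1
  have h1 : u.1 1 = 0 := by simpa using hc 1 1
  apply Subtype.ext
  funext γ
  have hγ : γ ∈ Subgroup.closure S := hS ▸ Subgroup.mem_top γ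
  change u.1 γ = 0
  induction hγ using Subgroup.closure_induction with
  | mem x hx => exact congrFun hu ⟨x, hx⟩
  | one => exact h1
  | mul x y _ _ hx hy => rw [hc, hx, hy]; simp
  | inv x _ hx =>
    have h2 := hc x⁻¹ x
    rw [inv_mul_cancel, h1, hx] at h2
    simpa using h2.symm

/-- The class `[H¹_P(Γ(N), V_k)]` in the Grothendieck group of `S_N`, where
`V_k = Sym^{k-2} ℂ²` and `k ≥ 2`. -/
def h1Class (k : ℕ) [NeZero N] : GrothendieckGroup SL(2, ZMod N) :=
  repClass (h1Rep N (symRep (k - 2)))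

end Cohomology

/-! ### The stabilizers, their images in `S_N` and their characters -/

section Stabilizers

/-- The generator of the stabilizer of `ρ = e^{2πi/3}`. -/
def rhoGen : SL(2, ℤ) := ⟨!![0, -1; 1, 1], by simp [Matrix.det_fin_two]⟩

/-- The generator of the stabilizer of `i`. -/
def iGen : SL(2, ℤ) := ⟨!![0, -1; 1, 0], by simp [Matrix.det_fin_two]⟩

/-- The translation by one. -/
def transGen : SL(2, ℤ) := ⟨!![1, 1; 0, 1], by simp [Matrix.det_fin_two]⟩

/-- The center `Z = {±1}` of `SL(2, ℤ)`. -/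
abbrev Zcenter : Subgroup SL(2, ℤ) := Subgroup.center SL(2, ℤ)

/-- The stabilizer `Γ_ρ` of `ρ = e^{2πi/3}`. -/
abbrev GammaRho : Subgroup SL(2, ℤ) := Subgroup.zpowers rhoGen

/-- The stabilizer `Γ_i` of `i`. -/
abbrev GammaI : Subgroup SL(2, ℤ) := Subgroup.zpowers iGen

/-- The stabilizer `Γ_∞` of the cusp `∞`, generated by `±[1, 1; 0, 1]`. -/
abbrev GammaInf : Subgroup SL(2, ℤ) := Subgroup.closure {transGen, -transGen}

/-- The image in `S_N` of a subgroup of `SL(2, ℤ)`. -/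
abbrev image (N : ℕ) (H : Subgroup SL(2, ℤ)) : Subgroup SL(2, ZMod N) := H.map (reduction N)

lemma orderOf_rhoGen : orderOf rhoGen = 6 := by
  rw [orderOf_eq_iff (by norm_num)]
  refine ⟨by decide, fun m hm hm0 => ?_⟩
  interval_cases m <;> decide

lemma orderOf_iGen : orderOf iGen = 4 := by
  rw [orderOf_eq_iff (by norm_num)]
  refine ⟨by decide, fun m hm hm0 => ?_⟩
  interval_cases m <;> decide

/-- The character `χ_ρ` of `Γ_ρ` with `[0, -1; 1, 1] ↦ e^{2πi/6}`. -/
def chiRho : GammaRho →* ℂˣ :=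
  monoidHomOfForallMemZpowers (g := (⟨rhoGen, Subgroup.mem_zpowers rhoGen⟩ : GammaRho))
    (g' := Units.mk0 (Complex.exp (2 * Real.pi * Complex.I / 6)) (Complex.exp_ne_zero _))
    (by
      rintro ⟨_, n, rfl⟩
      exact ⟨n, Subtype.ext (by simp)⟩)
    (by
      rw [Subgroup.orderOf_mk, orderOf_rhoGen, orderOf_dvd_iff_pow_eq_one]
      ext
      rw [Units.val_pow_eq_pow_val, Units.val_mk0, ← Complex.exp_nat_mul, Units.val_one,
        Complex.exp_eq_one_iff]
      exact ⟨1, by push_cast; ring⟩)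

lemma chiRho_gen : (chiRho ⟨rhoGen, Subgroup.mem_zpowers rhoGen⟩ : ℂ) =
    Complex.exp (2 * Real.pi * Complex.I / 6) := by
  simp [chiRho]

/-- The character `χ_i` of `Γ_i` with `[0, 1; -1, 0] ↦ i`; here `[0, 1; -1, 0] = iGen⁻¹`. -/
def chiI : GammaI →* ℂˣ :=
  monoidHomOfForallMemZpowers (g := (⟨iGen⁻¹, inv_mem (Subgroup.mem_zpowers iGen)⟩ : GammaI))
    (g' := Units.mk0 Complex.I Complex.I_ne_zero)
    (by
      rintro ⟨_, n, rfl⟩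
      exact ⟨-n, Subtype.ext (by simp)⟩)
    (by
      rw [Subgroup.orderOf_mk, orderOf_inv, orderOf_iGen, orderOf_dvd_iff_pow_eq_one]
      ext
      simp)

lemma chiI_gen (h : (⟨!![0, 1; -1, 0], by simp [Matrix.det_fin_two]⟩ : SL(2, ℤ)) ∈ GammaI) :
    (chiI ⟨_, h⟩ : ℂ) = Complex.I := by
  have h2 : (⟨_, h⟩ : GammaI) = ⟨iGen⁻¹, inv_mem (Subgroup.mem_zpowers iGen)⟩ := by
    have e : (⟨!![0, 1; -1, 0], by simp [Matrix.det_fin_two]⟩ : SL(2, ℤ)) = iGen⁻¹ := by decide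
    exact Subtype.ext e
  rw [h2]
  simp [chiI]

lemma upper_diag (γ : SL(2, ℤ)) (h : γ 1 0 = 0) : γ 0 0 * γ 1 1 = 1 := by
  have := γ.det_coe
  rwa [Matrix.det_fin_two, h, mul_zero, sub_zero] at this

/-- For a subgroup of `SL(2, ℤ)` consisting of upper triangular matrices (which have the diagonal
entries `1, 1` or `-1, -1`), the character `sgn` that sends a matrix to its diagonal entry. -/
def sgnChar (H : Subgroup SL(2, ℤ)) (hH : ∀ γ ∈ H, γ 1 0 = 0) : H →* ℂˣ where
  toFun γ :=
    { val := ((γ.1 0 0 : ℤ) : ℂ)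
      inv := ((γ.1 1 1 : ℤ) : ℂ)
      val_inv := by exact_mod_cast upper_diag γ.1 (hH γ.1 γ.2)
      inv_val := by rw [mul_comm]; exact_mod_cast upper_diag γ.1 (hH γ.1 γ.2) }
  map_one' := by
    ext
    simp
  map_mul' γ δ := by
    ext
    simp [Matrix.mul_apply, Fin.sum_univ_two, hH δ.1 δ.2]

lemma Zcenter_upper : ∀ γ ∈ Zcenter, γ 1 0 = 0 := by
  intro γ hγ
  have h := congrArg (fun A : SL(2, ℤ) => A 0 0) (Subgroup.mem_center_iff.1 hγ transGen)
  change (transGen * γ) 0 0 = (γ * transGen) 0 0 at h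
  simp only [Matrix.SpecialLinearGroup.coe_mul, Matrix.mul_apply, Fin.sum_univ_two] at h
  simpa [transGen] using h

lemma GammaInf_upper : ∀ γ ∈ GammaInf, γ 1 0 = 0 := by
  intro γ hγ
  induction hγ using Subgroup.closure_induction with
  | mem x hx => rcases hx with rfl | rfl <;> decide
  | one => simp
  | mul x y _ _ hx hy => simp [Matrix.mul_apply, Fin.sum_univ_two, hx, hy]
  | inv x _ hx => simp [Matrix.adjugate_fin_two, hx]

/-- The obvious character `sgn` of `Z`. -/
def sgnZ : Zcenter →* ℂˣ := sgnChar Zcenter Zcenter_upper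

/-- The obvious character `sgn` of `Γ_∞`: `±[1, n; 0, 1] ↦ ±1`. -/
def sgnInf : GammaInf →* ℂˣ := sgnChar GammaInf GammaInf_upper

/-- The character of the image of `H` in `S_N` through which a character `χ` of `H` factors, when
`χ` is trivial on `H ∩ Γ(N)`. -/
def descend (N : ℕ) (H : Subgroup SL(2, ℤ)) (χ : H →* ℂˣ)
    (h : ∀ γ : H, reduction N γ = 1 → χ γ = 1) : image N H →* ℂˣ :=
  MonoidHom.liftOfSurjective ((reduction N).subgroupMap H)
    ((reduction N).subgroupMap_surjective H)
    ⟨χ, fun γ hγ => h γ (congrArg Subtype.val hγ)⟩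

lemma descend_apply (N : ℕ) (H : Subgroup SL(2, ℤ)) (χ : H →* ℂˣ)
    (h : ∀ γ : H, reduction N γ = 1 → χ γ = 1) (γ : H) :
    descend N H χ h ⟨reduction N γ, Subgroup.mem_map_of_mem _ γ.2⟩ = χ γ :=
  MonoidHom.liftOfRightInverse_comp_apply _ _ _ _ γ

lemma dvd_of_reduction_eq_one (N : ℕ) {γ : SL(2, ℤ)} (h : reduction N γ = 1) (i : Fin 2) :
    (N : ℤ) ∣ γ i i - 1 := by
  have h1 := congrArg (fun A : SL(2, ZMod N) => A i i) h
  rw [← ZMod.intCast_zmod_eq_zero_iff_dvd]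
  simp at h1
  simp [h1]

variable (N : ℕ) [hN : Fact (2 < N)]

instance neZero_of_two_lt : NeZero N := ⟨by have := hN.out; omega⟩

lemma eq_of_reduction_eq_one {γ : SL(2, ℤ)} (h : reduction N γ = 1) (i : Fin 2)
    (hγ : |γ i i - 1| ≤ 2) : γ i i = 1 := by
  have h2 := Int.eq_zero_of_abs_lt_dvd (dvd_of_reduction_eq_one N h i)
    (by have := hN.out; omega)
  omega

lemma chiRho_descends (γ : GammaRho) (h : reduction N γ = 1) : chiRho γ = 1 := by
  obtain ⟨γ, hγ⟩ := γ
  have hfin : IsOfFinOrder rhoGen := orderOf_pos_iff.1 (by rw [orderOf_rhoGen]; norm_num)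
  have hm := hfin.mem_zpowers_iff_mem_range_orderOf.1 hγ
  rw [orderOf_rhoGen, Finset.mem_image] at hm
  obtain ⟨n, hn, rfl⟩ := hm
  rw [Finset.mem_range] at hn
  suffices h0 : n = 0 by
    subst h0
    exact (congrArg chiRho (Subtype.ext (pow_zero _))).trans (map_one _)
  have h0 : |(rhoGen ^ n) 0 0 - 1| ≤ 2 → (rhoGen ^ n) 0 0 = 1 := eq_of_reduction_eq_one N h 0
  have h1 : |(rhoGen ^ n) 1 1 - 1| ≤ 2 → (rhoGen ^ n) 1 1 = 1 := eq_of_reduction_eq_one N h 1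
  clear h hγ hfin
  interval_cases n
  · rfl
  all_goals (exfalso; revert h0 h1; decide)

lemma chiI_descends (γ : GammaI) (h : reduction N γ = 1) : chiI γ = 1 := by
  obtain ⟨γ, hγ⟩ := γ
  have hfin : IsOfFinOrder iGen := orderOf_pos_iff.1 (by rw [orderOf_iGen]; norm_num)
  have hm := hfin.mem_zpowers_iff_mem_range_orderOf.1 hγ
  rw [orderOf_iGen, Finset.mem_image] at hm
  obtain ⟨n, hn, rfl⟩ := hm
  rw [Finset.mem_range] at hn
  suffices h0 : n = 0 by
    subst h0
    exact (congrArg chiI (Subtype.ext (pow_zero _))).trans (map_one _)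
  have h0 : |(iGen ^ n) 0 0 - 1| ≤ 2 → (iGen ^ n) 0 0 = 1 := eq_of_reduction_eq_one N h 0
  have h1 : |(iGen ^ n) 1 1 - 1| ≤ 2 → (iGen ^ n) 1 1 = 1 := eq_of_reduction_eq_one N h 1
  clear h hγ hfin
  interval_cases n
  · rfl
  all_goals (exfalso; revert h0 h1; decide)

lemma sgnChar_descends (H : Subgroup SL(2, ℤ)) (hH : ∀ γ ∈ H, γ 1 0 = 0) (γ : H)
    (h : reduction N γ = 1) : sgnChar H hH γ = 1 := by
  have h1 : γ.1 0 0 = 1 := by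
    rcases Int.mul_eq_one_iff_eq_one_or_neg_one.1 (upper_diag γ.1 (hH γ.1 γ.2)) with h2 | h2
    · exact h2.1
    · exact eq_of_reduction_eq_one N h 0 (by rw [h2.1]; decide)
  ext
  change ((γ.1 0 0 : ℤ) : ℂ) = 1
  rw [h1, Int.cast_one]

/-- `χ_ρ` as a character of the image of `Γ_ρ` in `S_N`. -/
def chiRhoBar : image N GammaRho →* ℂˣ := descend N GammaRho chiRho (chiRho_descends N)

/-- `χ_i` as a character of the image of `Γ_i` in `S_N`. -/
def chiIBar : image N GammaI →* ℂˣ := descend N GammaI chiI (chiI_descends N)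

/-- `sgn` as a character of the image of `Z` in `S_N`. -/
def sgnZBar : image N Zcenter →* ℂˣ :=
  descend N Zcenter sgnZ (sgnChar_descends N Zcenter Zcenter_upper)

/-- `sgn` as a character of the image of `Γ_∞` in `S_N`. -/
def sgnInfBar : image N GammaInf →* ℂˣ :=
  descend N GammaInf sgnInf (sgnChar_descends N GammaInf GammaInf_upper)

/-- The virtual representation `ε_ρ` of (the image in `S_N` of) `Γ_ρ`. -/
def epsRho (k : ℕ) : GrothendieckGroup (image N GammaRho) :=
  match k % 6 with
  | 0 => -charClass 1
  | 2 => charClass 1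
  | 3 => -charClass (chiRhoBar N ^ 3)
  | 5 => charClass (chiRhoBar N ^ 3)
  | _ => 0

/-- The virtual representation `ε_i` of (the image in `S_N` of) `Γ_i`. -/
def epsI (k : ℕ) : GrothendieckGroup (image N GammaI) :=
  match k % 4 with
  | 0 => -charClass 1
  | 2 => -charClass (chiIBar N ^ 2)
  | _ => 0

/-- The integer `f(k) = (k - 1) - ⌊k/3⌋ - ⌊k/2⌋`. -/
def weightCoeff (k : ℕ) : ℤ := ((k : ℤ) - 1) - ((k / 3 : ℕ) : ℤ) - ((k / 2 : ℕ) : ℤ)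

end Stabilizers

end ParabolicCohomology

end

/-!
Put `Γ = SL(2, ℤ)`, `G = SL(2, ℤ/Nℤ)` and let `W` be the space of functions `F : G → V`, on which
`Γ` acts by `(γ F)(x) = γ F(γ⁻¹ x)` (`leftRep`) and `G` by right translation (`rightRep`). The two
actions commute, and by Shapiro's lemma the cohomology of `Γ(N)` in `V` is that of `Γ` in `W`,
`G`-equivariantly. Write `S = iGen`, `R = rhoGen`, `T = transGen = S⁻¹ R` and let a superscript
denote fixed vectors.

The group `Γ` acts on a tree with vertex stabilizers `⟨S⟩`, `⟨R⟩` and edge stabilizers `{±1}`.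
Since a tree has no cycles, every function on edges is a difference of functions on vertices
(`exists_potential`). Over `ℂ` the cohomology of the finite stabilizers vanishes, so this gives
`H¹(Γ, W) = W^{±1} / (W^S + W^R)`. Concretely, a cocycle `u` of `Γ(N)` extends to functions
`H` on `Γ` with `H(gν) = H(g) + g u(ν)` (`IsExt`); averaging produces extensions `a` fixed by
`S` and `b` fixed by `R`, and `u` corresponds to `a - b`. The cocycle is parabolic if and only if it
has an extension fixed by `T` and `-1`, and because `(T - 1) b = -(S⁻¹ - 1)(a - b)` this means
`(S⁻¹ - 1)(a - b) ∈ (T - 1) W^{±1}`. Hence parabolic cohomology is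
`{w ∈ W^{±1} | (S⁻¹ - 1) w ∈ (T - 1) W^{±1}} / (W^S + W^R)` (`subClass_parabolicSub`).

Additivity of classes along exact sequences turns this into (`repClass_h1Rep_eq`)
`[H¹_P] = 2 [W^{±1}] - [(S⁻¹ - 1) W^{±1} + (T - 1) W^{±1}] - [W^R] - [W^S] - [W^{±1, T}] + [W^Γ]`.
For `k > 2` there are neither invariants nor coinvariants of `Γ(N)` on `V`, so `W^Γ = 0` and the
second term is `[W^{±1}]`; for `k = 2` both `W^Γ` and the space of coinvariants are trivial
one-dimensional, which produces `2 [1]`.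

It remains to identify the fixed spaces. An eigenbasis of a stabilizer's generator `g` on `V` splits
`W^g` into spaces `{F : G → ℂ | F(g x) = ζ F(x)}` (`eigSub`), each of which is induced from a
character. The eigenvalues of `R` and `S` on `Symⁿ` are `ζ ^ (2 j - n)`, `0 ≤ j ≤ n`; complete
rounds of three, respectively two, consecutive values add up to the representation induced from
the center (`subClass_eigSub_pow`), and the incomplete last round is `ε_ρ`, respectively `ε_i`. At
the cusp, `W^{±1, T}` consists of functions with values in the line fixed by `T ^ N`.
-/

noncomputable section

namespace ParabolicCohomology

/-! ### Calculus of classes in the Grothendieck group -/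

section Classes

variable {G : Type} [Group G]
  {X Y Z : Type} [AddCommGroup X] [Module ℂ X] [Module.Finite ℂ X]
  [AddCommGroup Y] [Module ℂ Y] [Module.Finite ℂ Y]
  [AddCommGroup Z] [Module ℂ Z] [Module.Finite ℂ Z]

lemma repClass_eq_add_of_exact (ρX : Representation ℂ G X) (ρY : Representation ℂ G Y)
    (ρZ : Representation ℂ G Z) (f : X →ₗ[ℂ] Y) (g : Y →ₗ[ℂ] Z)
    (hf : ∀ a x, f (ρX a x) = ρY a (f x)) (hg : ∀ a y, g (ρY a y) = ρZ a (g y))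
    (hinj : Function.Injective f) (hexact : Function.Exact f g)
    (hsurj : Function.Surjective g) :
    repClass ρY = repClass ρX + repClass ρZ := by
  have hmem : FreeAbelianGroup.of (FDRep.of ρY) - FreeAbelianGroup.of (FDRep.of ρX) -
      FreeAbelianGroup.of (FDRep.of ρZ) ∈ AddSubgroup.closure (exactRelations G) :=
    AddSubgroup.subset_closure ⟨FDRep.of ρX, FDRep.of ρY, FDRep.of ρZ,
      ⟨f, fun a => LinearMap.ext (hf a)⟩, ⟨g, fun a => LinearMap.ext (hg a)⟩,
      hinj, hexact, hsurj, rfl⟩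
  have h := (QuotientAddGroup.eq_zero_iff _).2 hmem
  rw [QuotientAddGroup.mk_sub, QuotientAddGroup.mk_sub, sub_sub, sub_eq_zero] at h
  exact h

lemma repClass_eq_zero_of_subsingleton [Subsingleton X] (ρX : Representation ℂ G X) :
    repClass ρX = 0 := by
  have h := repClass_eq_add_of_exact ρX ρX ρX 0 0 (by simp) (by simp)
    (Function.injective_of_subsingleton _) (fun x => ⟨fun _ => ⟨0, Subsingleton.elim _ _⟩,
      fun _ => Subsingleton.elim _ _⟩) (fun x => ⟨0, Subsingleton.elim _ _⟩)
  simpa using h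

lemma repClass_congr (ρX : Representation ℂ G X) (ρY : Representation ℂ G Y) (e : X ≃ₗ[ℂ] Y)
    (he : ∀ a x, e (ρX a x) = ρY a (e x)) : repClass ρX = repClass ρY := by
  have h := repClass_eq_add_of_exact (1 : Representation ℂ G PUnit) ρX ρY 0 e.toLinearMap
    (by simp) he (Function.injective_of_subsingleton _)
    (fun x => by
      rw [LinearEquiv.coe_coe, LinearEquiv.map_eq_zero_iff]
      simp [eq_comm]) e.surjective
  rw [h, repClass_eq_zero_of_subsingleton (1 : Representation ℂ G PUnit), zero_add]

/-- The diagonal action on a finite product `∀ i, X i`. -/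
def piRep {n : ℕ} {X : Fin n → Type} [∀ i, AddCommGroup (X i)] [∀ i, Module ℂ (X i)]
    (σ : ∀ i, Representation ℂ G (X i)) : Representation ℂ G (∀ i, X i) where
  toFun g := LinearMap.pi fun i => σ i g ∘ₗ LinearMap.proj i
  map_one' := by ext; simp
  map_mul' g h := by ext; simp

lemma repClass_piRep {n : ℕ} {X : Fin n → Type} [∀ i, AddCommGroup (X i)] [∀ i, Module ℂ (X i)]
    [∀ i, Module.Finite ℂ (X i)] (σ : ∀ i, Representation ℂ G (X i)) :
    repClass (piRep σ) = ∑ i, repClass (σ i) := by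
  induction n with
  | zero => simpa using repClass_eq_zero_of_subsingleton (piRep σ)
  | succ n ih =>
    rw [Fin.sum_univ_succ, ← ih fun i => σ i.succ]
    refine repClass_eq_add_of_exact (σ 0) (piRep σ) (piRep fun i => σ i.succ)
      (LinearMap.single ℂ X 0) (LinearMap.pi fun i => LinearMap.proj i.succ) ?_ ?_ ?_ ?_ ?_
    · intro a x
      funext i
      refine Fin.cases ?_ (fun j => ?_) i <;> simp [piRep]
    · intro a y
      rfl
    · exact Pi.single_injective 0
    · intro y
      constructor
      · intro hy
        refine ⟨y 0, funext fun i => ?_⟩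
        refine Fin.cases (by simp) (fun j => ?_) i
        simpa using (congrFun hy j).symm
      · rintro ⟨x, rfl⟩
        funext j
        simp
    · intro y
      exact ⟨Fin.cons 0 y, funext fun i => by simp⟩

variable {ρX : Representation ℂ G X} {ρY : Representation ℂ G Y}

/-- The class of a subrepresentation. -/
def subClass (P : Subrepresentation ρX) : GrothendieckGroup G := repClass P.toRepresentation

lemma subClass_eq_zero (P : Subrepresentation ρX) (h : P.toSubmodule = ⊥) : subClass P = 0 := by
  have : Subsingleton P.toSubmodule := by rw [h]; infer_instance
  exact repClass_eq_zero_of_subsingleton _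

/-- The kernel of an equivariant endomorphism, as a subrepresentation. -/
def kerSub (f : X →ₗ[ℂ] Y) (hf : ∀ a x, f (ρX a x) = ρY a (f x)) : Subrepresentation ρX where
  toSubmodule := f.ker
  apply_mem_toSubmodule g v hv := by
    rw [LinearMap.mem_ker] at hv ⊢
    rw [hf, hv, map_zero]

/-- The image of a subrepresentation under an equivariant map. -/
def mapSub (f : X →ₗ[ℂ] Y) (hf : ∀ a x, f (ρX a x) = ρY a (f x)) (P : Subrepresentation ρX) :
    Subrepresentation ρY where
  toSubmodule := P.toSubmodule.map f
  apply_mem_toSubmodule g v hv := by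
    obtain ⟨x, hx, rfl⟩ := hv
    exact ⟨ρX g x, P.apply_mem_toSubmodule g hx, hf g x⟩

/-- The preimage of a subrepresentation under an equivariant map. -/
def comapSub (f : X →ₗ[ℂ] Y) (hf : ∀ a x, f (ρX a x) = ρY a (f x)) (B : Subrepresentation ρY) :
    Subrepresentation ρX where
  toSubmodule := B.toSubmodule.comap f
  apply_mem_toSubmodule g v hv := by
    rw [Submodule.mem_comap, hf]
    exact B.apply_mem_toSubmodule g hv

lemma repClass_prod (ρX : Representation ℂ G X) (ρY : Representation ℂ G Y) :
    repClass (ρX.prod ρY) = repClass ρX + repClass ρY := by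
  refine repClass_eq_add_of_exact _ _ _ (LinearMap.inl ℂ X Y) (LinearMap.snd ℂ X Y) ?_ ?_
    LinearMap.inl_injective ?_ LinearMap.snd_surjective
  · intro a x; simp
  · intro a x; simp
  · exact Function.Exact.inl_snd

/-- The map `(x, b) ↦ f x - b` from `P × B` onto `f P + B` has kernel `P ∩ f⁻¹ B`. Both the
modular law for classes and the rank–nullity formula are special cases. -/
lemma subClass_add_subClass (f : X →ₗ[ℂ] Y) (hf : ∀ a x, f (ρX a x) = ρY a (f x))
    (P : Subrepresentation ρX) (B : Subrepresentation ρY) :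
    subClass P + subClass B = subClass (P ⊓ comapSub f hf B) + subClass (mapSub f hf P ⊔ B) := by
  rw [subClass, subClass, ← repClass_prod]
  let i : (P ⊓ comapSub f hf B).toSubmodule →ₗ[ℂ] P.toSubmodule × B.toSubmodule :=
    LinearMap.prod (Submodule.inclusion inf_le_left)
      ((f.domRestrict _).codRestrict _ fun x => x.2.2)
  let q : P.toSubmodule × B.toSubmodule →ₗ[ℂ] (mapSub f hf P ⊔ B).toSubmodule :=
    LinearMap.codRestrict _
      ((f ∘ₗ P.toSubmodule.subtype).coprod (-B.toSubmodule.subtype)) (by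
        rintro ⟨x, b⟩
        exact Submodule.add_mem_sup ⟨x.1, x.2, rfl⟩ (neg_mem b.2))
  have hq : ∀ x, (q x : Y) = f x.1 - x.2 := fun x => (sub_eq_add_neg _ _).symm
  refine repClass_eq_add_of_exact _ _ _ i q ?_ ?_ ?_ ?_ ?_
  · intro a x
    exact Prod.ext (Subtype.ext rfl) (Subtype.ext (hf a x))
  · intro a x
    apply Subtype.ext
    rw [hq]
    change f (ρX a x.1) - ρY a x.2 = ρY a (q x)
    rw [hq, map_sub, hf]
  · intro x y hxy
    exact Subtype.ext (congrArg (fun z => (z.1 : X)) hxy)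
  · rintro ⟨x, b⟩
    constructor
    · intro h
      have h1 : f x - b = 0 := (hq (x, b)).symm.trans (congrArg Subtype.val h)
      rw [sub_eq_zero] at h1
      refine ⟨⟨x.1, x.2, ?_⟩, Prod.ext (Subtype.ext rfl) (Subtype.ext h1)⟩
      change f x ∈ B.toSubmodule
      rw [h1]
      exact b.2
    · rintro ⟨y, hy⟩
      rw [← hy]
      apply Subtype.ext
      rw [hq]
      exact sub_self _
  · rintro ⟨y, hy⟩
    obtain ⟨_, ⟨x, hx, rfl⟩, b, hb, rfl⟩ := Submodule.mem_sup.1 hy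
    refine ⟨(⟨x, hx⟩, ⟨-b, neg_mem hb⟩), Subtype.ext ?_⟩
    rw [hq]
    exact sub_neg_eq_add _ _

lemma subClass_sup_add_inf (P Q : Subrepresentation ρX) :
    subClass P + subClass Q = subClass (P ⊓ Q) + subClass (P ⊔ Q) := by
  have h := subClass_add_subClass LinearMap.id (fun _ _ => rfl) P Q
  have h1 : comapSub LinearMap.id (fun _ _ => rfl) Q = Q := rfl
  have h2 : mapSub LinearMap.id (fun _ _ => rfl) P = P :=
    Subrepresentation.ext (Submodule.map_id _)
  rwa [h1, h2] at h

lemma subClass_eq_ker_add_map (f : X →ₗ[ℂ] Y) (hf : ∀ a x, f (ρX a x) = ρY a (f x))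
    (P : Subrepresentation ρX) :
    subClass P = subClass (P ⊓ kerSub f hf) + subClass (mapSub f hf P) := by
  have h := subClass_add_subClass f hf P ⊥
  rwa [subClass_eq_zero ⊥ rfl, add_zero, sup_bot_eq] at h

end Classes

/-- If a space surjects onto `X` and maps to `Y` so that the first kernel is contained in the
second, the map to `Y` factors through `X`. -/
lemma exists_factor_of_ker_le {M X Y : Type} [AddCommGroup M] [Module ℂ M] [AddCommGroup X]
    [Module ℂ X] [AddCommGroup Y] [Module ℂ Y] (f : M →ₗ[ℂ] X)
    (g : M →ₗ[ℂ] Y) (hf : Function.Surjective f) (h : f.ker ≤ g.ker) :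
    ∃ k : X →ₗ[ℂ] Y, ∀ m, k (f m) = g m := by
  refine ⟨f.ker.liftQ g h ∘ₗ (f.quotKerEquivOfSurjective hf).symm.toLinearMap, fun m => ?_⟩
  have : (f.quotKerEquivOfSurjective hf).symm (f m) = Submodule.Quotient.mk m := by
    rw [LinearEquiv.symm_apply_eq]
    rfl
  simp [this]

/-! ### The tree of `SL(2, ℤ)` -/

section Tree

/-- The inner product of the two rows of `g`. The edge of the Farey tree attached to `g` is
the root edge if it vanishes, and otherwise its sign tells on which side of that edge the root
lies. -/
def rowInner (g : SL(2, ℤ)) : ℤ := g 0 0 * g 1 0 + g 0 1 * g 1 1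

/-- The sum of the squares of the entries of `g`. -/
def sqNorm (g : SL(2, ℤ)) : ℕ := (g 0 0 ^ 2 + g 0 1 ^ 2 + g 1 0 ^ 2 + g 1 1 ^ 2).toNat

lemma sqNorm_cast (g : SL(2, ℤ)) :
    (sqNorm g : ℤ) = g 0 0 ^ 2 + g 0 1 ^ 2 + g 1 0 ^ 2 + g 1 1 ^ 2 :=
  Int.toNat_of_nonneg (by positivity)

lemma det_eq (g : SL(2, ℤ)) : g 0 0 * g 1 1 - g 0 1 * g 1 0 = 1 := by
  rw [← Matrix.det_fin_two]
  exact g.det_coe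

lemma rhoGen_mul_apply (g : SL(2, ℤ)) (j : Fin 2) :
    (rhoGen * g) 0 j = -g 1 j ∧ (rhoGen * g) 1 j = g 0 j + g 1 j := by
  simp only [Matrix.SpecialLinearGroup.coe_mul, Matrix.mul_apply, Fin.sum_univ_two]
  simp [rhoGen]

lemma iGen_mul_apply (g : SL(2, ℤ)) (j : Fin 2) :
    (iGen * g) 0 j = -g 1 j ∧ (iGen * g) 1 j = g 0 j := by
  simp only [Matrix.SpecialLinearGroup.coe_mul, Matrix.mul_apply, Fin.sum_univ_two]
  simp [iGen]

lemma iGen_mul_iGen_mul (g : SL(2, ℤ)) : iGen * (iGen * g) = -g := by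
  have : iGen * iGen = -1 := by decide
  rw [← mul_assoc, this, neg_one_mul]

lemma rhoGen_mul_rhoGen_mul_rhoGen_mul (g : SL(2, ℤ)) : rhoGen * (rhoGen * (rhoGen * g)) = -g := by
  have : rhoGen * rhoGen * rhoGen = -1 := by decide
  rw [← mul_assoc, ← mul_assoc, this, neg_one_mul]

lemma rowInner_neg (g : SL(2, ℤ)) : rowInner (-g) = rowInner g := by
  simp [rowInner]

lemma sqNorm_neg (g : SL(2, ℤ)) : sqNorm (-g) = sqNorm g := by
  simp [sqNorm]

lemma rowInner_iGen_mul (g : SL(2, ℤ)) : rowInner (iGen * g) = -rowInner g := by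
  simp only [rowInner, iGen_mul_apply]
  ring

lemma sqNorm_iGen_mul (g : SL(2, ℤ)) : sqNorm (iGen * g) = sqNorm g := by
  zify
  simp only [sqNorm_cast, iGen_mul_apply]
  ring

lemma rowInner_rhoGen_mul (g : SL(2, ℤ)) :
    rowInner (rhoGen * g) = -rowInner g - (g 1 0 ^ 2 + g 1 1 ^ 2) := by
  simp only [rowInner, rhoGen_mul_apply]
  ring

lemma rowInner_rhoGen_mul_rhoGen_mul (g : SL(2, ℤ)) :
    rowInner (rhoGen * (rhoGen * g)) = -rowInner g - (g 0 0 ^ 2 + g 0 1 ^ 2) := by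
  simp only [rowInner, rhoGen_mul_apply]
  ring

lemma row_pos (g : SL(2, ℤ)) (i : Fin 2) : 0 < g i 0 ^ 2 + g i 1 ^ 2 := by
  have h := det_eq g
  rcases eq_or_ne (g i 0) 0 with h0 | h0
  · have h1 : g i 1 ≠ 0 := by
      intro h1
      fin_cases i <;> simp_all
    positivity
  · positivity

lemma rowInner_rhoGen_mul_neg {g : SL(2, ℤ)} (h : 0 ≤ rowInner g) :
    rowInner (rhoGen * g) < 0 := by
  rw [rowInner_rhoGen_mul]
  have := row_pos g 1
  omega

lemma rowInner_rhoGen_mul_rhoGen_mul_neg {g : SL(2, ℤ)} (h : 0 ≤ rowInner g) :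
    rowInner (rhoGen * (rhoGen * g)) < 0 := by
  rw [rowInner_rhoGen_mul_rhoGen_mul]
  have := row_pos g 0
  omega

lemma sqNorm_lt_rhoGen_mul {g : SL(2, ℤ)} (h : 0 ≤ rowInner g) :
    sqNorm g < sqNorm (rhoGen * g) := by
  have := row_pos g 1
  zify
  simp only [sqNorm_cast, rhoGen_mul_apply]
  simp only [rowInner] at h
  nlinarith

lemma sqNorm_lt_rhoGen_mul_rhoGen_mul {g : SL(2, ℤ)} (h : 0 ≤ rowInner g) :
    sqNorm g < sqNorm (rhoGen * (rhoGen * g)) := by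
  have := row_pos g 0
  zify
  simp only [sqNorm_cast, rhoGen_mul_apply]
  simp only [rowInner] at h
  nlinarith

/-- Every triangle of the Farey tree has an edge facing the root. By the Lagrange identity
`|p|² |q|² = 1 + (p ⬝ q)²` for the rows `p, q`, the inner products of the three edges cannot all be
negative. -/
lemma exists_rowInner_nonneg (g : SL(2, ℤ)) (h0 : rowInner g < 0)
    (h1 : rowInner (rhoGen * g) < 0) : 0 ≤ rowInner (rhoGen * (rhoGen * g)) := by
  by_contra! h2
  rw [rowInner_rhoGen_mul] at h1
  rw [rowInner_rhoGen_mul_rhoGen_mul] at h2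
  have hl : (g 0 0 ^ 2 + g 0 1 ^ 2) * (g 1 0 ^ 2 + g 1 1 ^ 2) = 1 + rowInner g ^ 2 := by
    have := det_eq g
    simp only [rowInner]
    linear_combination (g 0 0 * g 1 1 - g 0 1 * g 1 0 + 1) * this
  generalize g 0 0 ^ 2 + g 0 1 ^ 2 = x at *
  generalize g 1 0 ^ 2 + g 1 1 ^ 2 = y at *
  generalize rowInner g = t at *
  nlinarith [mul_nonneg (show 0 ≤ x + t - 1 by omega) (show 0 ≤ y + t - 1 by omega)]

open Classical in
/-- For `g` with negative row inner product: the edge, in the triangle of `g`, facing the root. -/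
def towardsRoot (g : SL(2, ℤ)) : SL(2, ℤ) :=
  if 0 ≤ rowInner (rhoGen * g) then rhoGen * g else rhoGen * (rhoGen * g)

lemma towardsRoot_nonneg {g : SL(2, ℤ)} (h : rowInner g < 0) : 0 ≤ rowInner (towardsRoot g) := by
  unfold towardsRoot
  split_ifs with h1
  · exact h1
  · exact exists_rowInner_nonneg g h (not_le.1 h1)

lemma sqNorm_towardsRoot_lt {g : SL(2, ℤ)} (h : rowInner g < 0) :
    sqNorm (towardsRoot g) < sqNorm g := by
  have h0 := towardsRoot_nonneg h
  unfold towardsRoot at h0 ⊢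
  split_ifs at h0 ⊢
  · have := sqNorm_lt_rhoGen_mul_rhoGen_mul h0
    rwa [rhoGen_mul_rhoGen_mul_rhoGen_mul, sqNorm_neg] at this
  · have := sqNorm_lt_rhoGen_mul h0
    rwa [rhoGen_mul_rhoGen_mul_rhoGen_mul, sqNorm_neg] at this

lemma towardsRoot_neg (g : SL(2, ℤ)) : towardsRoot (-g) = -towardsRoot g := by
  unfold towardsRoot
  simp only [mul_neg, rowInner_neg]
  split_ifs <;> rfl

lemma towardsRoot_rhoGen_mul {g : SL(2, ℤ)} (h : 0 ≤ rowInner g) :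
    towardsRoot (rhoGen * g) = -g := by
  rw [towardsRoot, if_neg (not_le.2 (rowInner_rhoGen_mul_rhoGen_mul_neg h)),
    rhoGen_mul_rhoGen_mul_rhoGen_mul]

lemma towardsRoot_rhoGen_mul_rhoGen_mul {g : SL(2, ℤ)} (h : 0 ≤ rowInner g) :
    towardsRoot (rhoGen * (rhoGen * g)) = -g := by
  rw [towardsRoot, rhoGen_mul_rhoGen_mul_rhoGen_mul, rowInner_neg, if_pos h]

variable {V : Type} [AddCommGroup V]

open Classical in
/-- The value at the far end of the edge of `g` (with negative row inner product) of the potential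
of `w` that vanishes at the root edge: sum `w` with signs along the path from the root. -/
def rootPotential (w : SL(2, ℤ) → V) (g : SL(2, ℤ)) : V :=
  if _h : rowInner g < 0 then
    w g - w (towardsRoot g) + rootPotential w (iGen * towardsRoot g)
  else 0
termination_by sqNorm g
decreasing_by
  rw [sqNorm_iGen_mul]
  exact sqNorm_towardsRoot_lt _h

lemma rootPotential_of_neg (w : SL(2, ℤ) → V) {g : SL(2, ℤ)} (h : rowInner g < 0) :
    rootPotential w g = w g - w (towardsRoot g) + rootPotential w (iGen * towardsRoot g) := by
  rw [rootPotential, dif_pos h]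

lemma rootPotential_of_nonneg (w : SL(2, ℤ) → V) {g : SL(2, ℤ)} (h : 0 ≤ rowInner g) :
    rootPotential w g = 0 := by
  rw [rootPotential, dif_neg (not_lt.2 h)]

lemma rootPotential_neg (w : SL(2, ℤ) → V) (hw : ∀ g, w (-g) = w g) (g : SL(2, ℤ)) :
    rootPotential w (-g) = rootPotential w g := by
  induction hn : sqNorm g using Nat.strong_induction_on generalizing g with
  | _ n ih =>
    by_cases h : rowInner g < 0
    · rw [rootPotential_of_neg w h, rootPotential_of_neg w ((rowInner_neg g).symm ▸ h),
        towardsRoot_neg, hw, hw, mul_neg, ih _ _ _ rfl]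
      rw [sqNorm_iGen_mul, ← hn]
      exact sqNorm_towardsRoot_lt h
    · rw [rootPotential_of_nonneg w (not_lt.1 h),
        rootPotential_of_nonneg w ((rowInner_neg g).symm ▸ not_lt.1 h)]

/-- The graph with vertices the cosets of `⟨iGen⟩` and of `⟨rhoGen⟩` and edges the cosets of
`{±1}` is a tree, so every function on its edges is the difference of two functions on its
vertices. -/
lemma exists_potential (w : SL(2, ℤ) → V) (hw : ∀ g, w (-g) = w g) :
    ∃ a b : SL(2, ℤ) → V, (∀ g, a (iGen * g) = a g) ∧ (∀ g, b (rhoGen * g) = b g) ∧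
      ∀ g, a g - b g = w g := by
  let K := rootPotential w
  let a : SL(2, ℤ) → V := fun g => K g + K (iGen * g)
  have hneg : ∀ g, K (-g) = K g := rootPotential_neg w hw
  have ha_neg : ∀ g, a (-g) = a g := fun g => by simp only [a, mul_neg, hneg]
  -- On a triangle, `a - w` takes the value it has at the edge facing the root.
  have key : ∀ g, rowInner g < 0 → a g - w g = a (towardsRoot g) - w (towardsRoot g) := by
    intro g h
    have h1 : K (iGen * g) = 0 :=
      rootPotential_of_nonneg w (by rw [rowInner_iGen_mul]; omega)
    have h2 : K (towardsRoot g) = 0 := rootPotential_of_nonneg w (towardsRoot_nonneg h)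
    simp only [a, h1, h2]
    rw [show K g = _ from rootPotential_of_neg w h]
    abel
  have key' : ∀ g, 0 ≤ rowInner g → a (rhoGen * g) - w (rhoGen * g) = a g - w g ∧
      a (rhoGen * (rhoGen * g)) - w (rhoGen * (rhoGen * g)) = a g - w g := by
    intro g h
    rw [key _ (rowInner_rhoGen_mul_neg h), key _ (rowInner_rhoGen_mul_rhoGen_mul_neg h),
      towardsRoot_rhoGen_mul h, towardsRoot_rhoGen_mul_rhoGen_mul h, ha_neg, hw]
    exact ⟨rfl, rfl⟩
  refine ⟨a, fun g => a g - w g, fun g => ?_, fun g => ?_, fun g => sub_sub_cancel _ _⟩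
  · simp only [a, iGen_mul_iGen_mul, hneg, add_comm]
  · rcases le_or_gt 0 (rowInner g) with h | h
    · exact (key' g h).1
    · rcases le_or_gt 0 (rowInner (rhoGen * g)) with h1 | h1
      · have := (key' _ h1).2
        rw [rhoGen_mul_rhoGen_mul_rhoGen_mul, ha_neg, hw] at this
        exact this.symm
      · have := key' _ (exists_rowInner_nonneg g h h1)
        rw [rhoGen_mul_rhoGen_mul_rhoGen_mul, mul_neg, ha_neg, ha_neg, hw, hw] at this
        exact this.2.trans this.1.symm

lemma closure_iGen_rhoGen : Subgroup.closure {iGen, rhoGen} = ⊤ := by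
  rw [eq_top_iff, ← _root_.SpecialLinearGroup.SL2Z_generators, Subgroup.closure_le]
  have hi : iGen ∈ Subgroup.closure {iGen, rhoGen} := Subgroup.subset_closure (by simp)
  have hr : rhoGen ∈ Subgroup.closure {iGen, rhoGen} := Subgroup.subset_closure (by simp)
  rintro x (rfl | rfl)
  · have : ModularGroup.S = iGen := by decide
    rwa [this]
  · have : ModularGroup.T = iGen⁻¹ * rhoGen := by decide
    rw [this]
    exact mul_mem (inv_mem hi) hr

end Tree

/-! ### Functions on a quotient of `SL(2, ℤ)` and their two commuting actions -/

section Actions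

variable {Q : Type} [Group Q] (φ : SL(2, ℤ) →* Q) {V : Type} [AddCommGroup V] [Module ℂ V]
  (ρ : Representation ℂ SL(2, ℤ) V)

/-- The action `(γ F)(x) = γ F(γ⁻¹ x)` of `SL(2, ℤ)` on the functions from a group under
`SL(2, ℤ)` to `V`. -/
def leftRep : Representation ℂ SL(2, ℤ) (Q → V) where
  toFun γ := LinearMap.pi fun x => ρ γ ∘ₗ LinearMap.proj ((φ γ)⁻¹ * x)
  map_one' := by
    ext; simp
  map_mul' γ δ := by
    refine LinearMap.ext fun F => funext fun x => ?_
    simp [mul_assoc]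

lemma leftRep_apply (γ : SL(2, ℤ)) (F : Q → V) (x : Q) :
    leftRep φ ρ γ F x = ρ γ (F ((φ γ)⁻¹ * x)) := rfl

lemma leftRep_eq_self_iff (γ : SL(2, ℤ)) (F : Q → V) :
    leftRep φ ρ γ F = F ↔ ∀ x, F (φ γ * x) = ρ γ (F x) := by
  rw [funext_iff]
  constructor
  · intro h x
    rw [← h, leftRep_apply, inv_mul_cancel_left]
  · intro h x
    rw [leftRep_apply, ← h, mul_inv_cancel_left]

variable (Q V) in
/-- The action of a group on functions by right translation. -/
def rightRep : Representation ℂ Q (Q → V) where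
  toFun g := LinearMap.pi fun x => LinearMap.proj (x * g)
  map_one' := by
    ext; simp
  map_mul' g h := by
    refine LinearMap.ext fun F => funext fun x => ?_
    simp [mul_assoc]

lemma rightRep_apply (g : Q) (F : Q → V) (x : Q) : rightRep Q V g F x = F (x * g) := rfl

lemma leftRep_rightRep (γ : SL(2, ℤ)) (g : Q) (F : Q → V) :
    leftRep φ ρ γ (rightRep Q V g F) = rightRep Q V g (leftRep φ ρ γ F) := by
  funext x
  simp only [leftRep_apply, rightRep_apply, mul_assoc]

lemma leftRep_comp (γ : SL(2, ℤ)) (F : Q → V) :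
    leftRep (MonoidHom.id _) ρ γ (F ∘ φ) = leftRep φ ρ γ F ∘ φ := by
  funext g
  simp [leftRep_apply]

lemma leftRep_sub_one_rightRep (γ : SL(2, ℤ)) (g : Q) (F : Q → V) :
    (leftRep φ ρ γ - 1) (rightRep Q V g F) = rightRep Q V g ((leftRep φ ρ γ - 1) F) := by
  simp [leftRep_rightRep]

lemma neg_one_mul_self : (-1 : SL(2, ℤ)) * -1 = 1 := by decide

/-- The functions fixed by `γ` under the left action. -/
def fixSub (γ : SL(2, ℤ)) : Subrepresentation (rightRep Q V) :=
  kerSub (leftRep φ ρ γ - 1) (leftRep_sub_one_rightRep φ ρ γ)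

lemma mem_fixSub {γ : SL(2, ℤ)} {F : Q → V} :
    F ∈ (fixSub φ ρ γ).toSubmodule ↔ leftRep φ ρ γ F = F := by
  change (leftRep φ ρ γ - 1) F = 0 ↔ _
  simp [sub_eq_zero]

/-- The coboundaries for the stabilizer of `∞`: the image of `transGen - 1` on the functions
fixed by `-1`. -/
def cuspSub : Subrepresentation (rightRep Q V) :=
  mapSub (leftRep φ ρ transGen - 1) (leftRep_sub_one_rightRep φ ρ _) (fixSub φ ρ (-1))

/-- The functions `w` on edges for which `(iGen⁻¹ - 1) w` is a coboundary at the cusp. -/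
def parabolicSub : Subrepresentation (rightRep Q V) :=
  fixSub φ ρ (-1) ⊓ comapSub (leftRep φ ρ iGen⁻¹ - 1) (leftRep_sub_one_rightRep φ ρ _)
    (cuspSub φ ρ)

lemma mem_parabolicSub {F : Q → V} :
    F ∈ (parabolicSub φ ρ).toSubmodule ↔ leftRep φ ρ (-1) F = F ∧
      ∃ y, leftRep φ ρ (-1) y = y ∧ leftRep φ ρ transGen y - y = leftRep φ ρ iGen⁻¹ F - F := by
  rw [← mem_fixSub]
  refine and_congr_right fun _ => exists_congr fun y => and_congr_left fun _ => ?_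
  exact mem_fixSub φ ρ

end Actions

/-! ### Extending cocycles of `Γ(N)` to `SL(2, ℤ)` -/

section Extension

variable (N : ℕ) {V : Type} [AddCommGroup V] [Module ℂ V] (ρ : Representation ℂ SL(2, ℤ) V)

/-- The left action on functions on `SL(2, ℤ)` itself. -/
abbrev leftSL : Representation ℂ SL(2, ℤ) (SL(2, ℤ) → V) := leftRep (MonoidHom.id _) ρ

/-- The function `H` on `SL(2, ℤ)` extends `u` in the sense that `H(gν) = H(g) + g u(ν)` for
`ν ∈ Γ(N)`. -/
def IsExt (u : CongruenceSubgroup.Gamma N → V) (H : SL(2, ℤ) → V) : Prop :=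
  ∀ (g : SL(2, ℤ)) (ν : CongruenceSubgroup.Gamma N), H (g * ν) = H g + ρ g (u ν)

variable {N ρ} {u : CongruenceSubgroup.Gamma N → V} {H : SL(2, ℤ) → V}

lemma IsExt.cocycle (h : IsExt N ρ u H) (ν μ : CongruenceSubgroup.Gamma N) :
    u (ν * μ) = ρ ν (u μ) + u ν := by
  have h1 := h 1 (ν * μ)
  have h2 := h ν μ
  have h3 := h 1 ν
  simp only [one_mul, map_one, Subgroup.coe_mul, Module.End.one_apply] at h1 h2 h3
  rw [h2, h3, add_assoc] at h1
  rw [← add_left_cancel h1, add_comm]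

lemma exists_isExt [NeZero N] (hu : ∀ γ δ : CongruenceSubgroup.Gamma N, u (γ * δ) = ρ γ (u δ) + u γ) :
    ∃ H, IsExt N ρ u H := by
  let s : SL(2, ℤ) → SL(2, ℤ) := fun g => Function.surjInv (reduction_surjective N) (reduction N g)
  have hs : ∀ g, reduction N (s g) = reduction N g :=
    fun g => Function.surjInv_eq (reduction_surjective N) _
  have hmem : ∀ g, (s g)⁻¹ * g ∈ CongruenceSubgroup.Gamma N := by
    intro g
    change reduction N _ = 1
    rw [map_mul, map_inv, hs, inv_mul_cancel]
  refine ⟨fun g => ρ (s g) (u ⟨_, hmem g⟩), fun g ν => ?_⟩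
  have h1 : s (g * ν) = s g := by
    have : reduction N ν = 1 := ν.2
    simp only [s, map_mul, this, mul_one]
  have h3 : ∀ (k : SL(2, ℤ)) (e : k = s g) (hk : k⁻¹ * (g * ν) ∈ CongruenceSubgroup.Gamma N),
      ρ k (u ⟨_, hk⟩) = ρ (s g) (u ⟨_, hmem g⟩) + ρ g (u ν) := by
    rintro _ rfl hk
    have h4 : (⟨_, hk⟩ : CongruenceSubgroup.Gamma N) = ⟨_, hmem g⟩ * ν :=
      Subtype.ext (mul_assoc _ _ _).symm
    rw [h4, hu, map_add, ← Module.End.mul_apply, ← map_mul, mul_inv_cancel_left, add_comm]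
  exact h3 _ h1 _

lemma IsExt.add {u' : CongruenceSubgroup.Gamma N → V} {H' : SL(2, ℤ) → V} (h : IsExt N ρ u H)
    (h' : IsExt N ρ u' H') : IsExt N ρ (u + u') (H + H') := by
  intro g ν
  simp only [Pi.add_apply, h g ν, h' g ν, map_add]
  exact add_add_add_comm _ _ _ _

lemma IsExt.smul (c : ℂ) (h : IsExt N ρ u H) : IsExt N ρ (c • u) (c • H) := by
  intro g ν
  simp only [Pi.smul_apply, h g ν, map_smul, smul_add]

lemma IsExt.left (h : IsExt N ρ u H) (γ : SL(2, ℤ)) : IsExt N ρ u (leftSL ρ γ H) := by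
  intro g ν
  simp only [leftRep_apply, MonoidHom.id_apply]
  rw [← mul_assoc, h, map_add, ← Module.End.mul_apply, ← map_mul, mul_inv_cancel_left]

lemma IsExt.add_comp (h : IsExt N ρ u H) (F : SL(2, ZMod N) → V) :
    IsExt N ρ u (H + F ∘ reduction N) := by
  intro g ν
  have : reduction N ν = 1 := ν.2
  simp only [Pi.add_apply, Function.comp_apply, h g ν, map_mul, this, mul_one]
  exact add_right_comm _ _ _

lemma IsExt.sub_comp (h : IsExt N ρ u H) (F : SL(2, ZMod N) → V) :
    IsExt N ρ u (H - F ∘ reduction N) := by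
  rw [sub_eq_add_neg]
  exact h.add_comp (-F)

lemma IsExt.sub_eq_comp [NeZero N] {H' : SL(2, ℤ) → V} (h : IsExt N ρ u H) (h' : IsExt N ρ u H') :
    ∃ F : SL(2, ZMod N) → V, H - H' = F ∘ reduction N := by
  refine ⟨fun x => (H - H') (Function.surjInv (reduction_surjective N) x), funext fun g => ?_⟩
  set s := Function.surjInv (reduction_surjective N) (reduction N g) with hs
  have hsg : s⁻¹ * g ∈ CongruenceSubgroup.Gamma N := by
    change reduction N _ = 1
    rw [map_mul, map_inv, hs, Function.surjInv_eq (reduction_surjective N), inv_mul_cancel]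
  have h1 := h s ⟨_, hsg⟩
  have h2 := h' s ⟨_, hsg⟩
  simp only [mul_inv_cancel_left] at h1 h2
  simp only [Function.comp_apply, ← hs, Pi.sub_apply, h1, h2]
  abel

/-- Averaging over the cyclic group generated by `γ` makes an extension of `u` invariant. -/
lemma IsExt.exists_fixed (h : IsExt N ρ u H) (γ : SL(2, ℤ)) (n : ℕ) (hn : n ≠ 0)
    (hH : leftSL ρ (γ ^ n) H = H) :
    ∃ H', IsExt N ρ u H' ∧ leftSL ρ γ H' = H' ∧
      ∀ δ, Commute δ γ → leftSL ρ δ H = H → leftSL ρ δ H' = H' := by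
  have hn' : (n : ℂ) ≠ 0 := Nat.cast_ne_zero.2 hn
  refine ⟨(n : ℂ)⁻¹ • ∑ j ∈ Finset.range n, leftSL ρ (γ ^ j) H, fun g ν => ?_, ?_, ?_⟩
  · simp only [Pi.smul_apply, Finset.sum_apply, h.left _ g ν, Finset.sum_add_distrib, smul_add,
      Finset.sum_const, Finset.card_range]
    rw [← Nat.cast_smul_eq_nsmul ℂ, smul_smul, inv_mul_cancel₀ hn', one_smul]
  · have h1 : ∀ j, leftSL ρ γ (leftSL ρ (γ ^ j) H) = leftSL ρ (γ ^ (j + 1)) H := fun j => by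
      rw [pow_succ', map_mul, Module.End.mul_apply]
    simp only [map_smul, map_sum, h1]
    congr 1
    have := Finset.sum_range_succ' (fun j => leftSL ρ (γ ^ j) H) n
    rw [Finset.sum_range_succ, hH, pow_zero, map_one, Module.End.one_apply] at this
    exact (add_right_cancel this).symm
  · intro δ hδ hH'
    simp only [map_smul, map_sum]
    congr 1
    refine Finset.sum_congr rfl fun j _ => ?_
    rw [← Module.End.mul_apply, ← map_mul, (hδ.pow_right j).eq, map_mul,
      Module.End.mul_apply, hH']

lemma leftSL_fixed_iff {γ : SL(2, ℤ)} :
    leftSL ρ γ H = H ↔ ∀ g, H (γ * g) = ρ γ (H g) :=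
  leftRep_eq_self_iff _ _ _ _

/-- The matrices fixing `H` form a subgroup. -/
lemma leftSL_fixed_of_mem_closure {s : Set SL(2, ℤ)} (h : ∀ γ ∈ s, leftSL ρ γ H = H)
    {γ : SL(2, ℤ)} (hγ : γ ∈ Subgroup.closure s) : leftSL ρ γ H = H := by
  induction hγ using Subgroup.closure_induction with
  | mem x hx => exact h x hx
  | one => simp
  | mul x y _ _ hx hy => rw [map_mul, Module.End.mul_apply, hy, hx]
  | inv x _ hx =>
    conv_lhs => rw [← hx]
    rw [← Module.End.mul_apply, ← map_mul, inv_mul_cancel, map_one, Module.End.one_apply]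

lemma eq_apply_one_of_fixed (hi : leftSL ρ iGen H = H) (hr : leftSL ρ rhoGen H = H)
    (g : SL(2, ℤ)) : H g = ρ g (H 1) := by
  have h : leftSL ρ g H = H := leftSL_fixed_of_mem_closure (s := {iGen, rhoGen})
    (by rintro _ (rfl | rfl) <;> assumption) (closure_iGen_rhoGen ▸ Subgroup.mem_top g)
  simpa using leftSL_fixed_iff.1 h 1

/-- Two functions with the invariance of the two kinds of vertices, which differ by a function on
`SL(2, ℤ/Nℤ)`, extend the same cocycle of `Γ(N)`. -/
lemma exists_isExt_of_sub_eq_comp {a b : SL(2, ℤ) → V} (ha : leftSL ρ iGen a = a)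
    (hb : leftSL ρ rhoGen b = b) {F : SL(2, ZMod N) → V} (h : a - b = F ∘ reduction N) :
    ∃ u, IsExt N ρ u a ∧ IsExt N ρ u b := by
  have hab : ∀ g (ν : CongruenceSubgroup.Gamma N), a (g * ν) - a g = b (g * ν) - b g := by
    intro g ν
    have h1 : (a - b) (g * ν) = (a - b) g := by
      have : reduction N ν = 1 := ν.2
      simp only [h, Function.comp_apply, map_mul, this, mul_one]
    rw [Pi.sub_apply, Pi.sub_apply] at h1
    rw [sub_eq_sub_iff_add_eq_add] at h1 ⊢
    rw [h1]
    abel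
  have key : ∀ g (ν : CongruenceSubgroup.Gamma N), a (g * ν) - a g = ρ g (a ν - a 1) := by
    intro g ν
    rw [leftSL_fixed_iff] at ha hb
    have h1 := eq_apply_one_of_fixed (ρ := ρ) (H := fun g => a (g * ν) - a g) ?_ ?_ g
    · simpa using h1
    · rw [leftSL_fixed_iff]
      intro g
      simp only [mul_assoc, ha, map_sub]
    · rw [leftSL_fixed_iff]
      intro g
      rw [hab, hab, mul_assoc, hb, hb, map_sub]
  refine ⟨fun ν => a ν - a 1, fun g ν => ?_, fun g ν => ?_⟩ <;> rw [← sub_eq_iff_eq_add']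
  · exact key g ν
  · rw [← hab, key]

/-- Every function on the edges of the tree is a difference of functions on the two kinds of
vertices, in a form equivariant under the left action. -/
lemma exists_equivariant_potential (w : SL(2, ℤ) → V) (hw : leftSL ρ (-1) w = w) :
    ∃ a b : SL(2, ℤ) → V, leftSL ρ iGen a = a ∧ leftSL ρ rhoGen b = b ∧ a - b = w := by
  rw [leftSL_fixed_iff] at hw
  obtain ⟨a, b, ha, hb, hab⟩ := exists_potential (fun g => ρ g⁻¹ (w g)) (by
    intro g
    rw [← neg_one_mul g, hw, ← Module.End.mul_apply, ← map_mul]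
    congr 2
    rw [mul_inv_rev, mul_assoc, inv_mul_cancel, mul_one])
  refine ⟨fun g => ρ g (a g), fun g => ρ g (b g), ?_, ?_, funext fun g => ?_⟩
  · rw [leftSL_fixed_iff]
    intro g
    rw [ha, map_mul, Module.End.mul_apply]
  · rw [leftSL_fixed_iff]
    intro g
    rw [hb, map_mul, Module.End.mul_apply]
  · rw [Pi.sub_apply, ← map_sub, hab, ← Module.End.mul_apply, ← map_mul, mul_inv_cancel,
      map_one, Module.End.one_apply]

end Extension

/-! ### Parabolic elements and parabolic cocycles -/

section Parabolic

lemma transGen_eq : transGen = iGen⁻¹ * rhoGen := by decide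

lemma transGen_eq_T : transGen = ModularGroup.T := by decide

lemma transGen_pow_val (n : ℕ) : (transGen ^ n).val = !![1, (n : ℤ); 0, 1] := by
  have := ModularGroup.coe_T_zpow n
  rwa [zpow_natCast, ← transGen_eq_T] at this

/-- The stabilizer of `∞` consists of the upper triangular matrices. -/
lemma mem_closure_of_upper {t : SL(2, ℤ)} (h : t 1 0 = 0) :
    t ∈ Subgroup.closure {transGen, (-1 : SL(2, ℤ))} := by
  have hT : ∀ n : ℤ, transGen ^ n ∈ Subgroup.closure {transGen, (-1 : SL(2, ℤ))} :=
    fun n => zpow_mem (Subgroup.subset_closure (by simp)) n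
  have hZ : (-1 : SL(2, ℤ)) ∈ Subgroup.closure {transGen, (-1 : SL(2, ℤ))} :=
    Subgroup.subset_closure (by simp)
  rcases Int.mul_eq_one_iff_eq_one_or_neg_one.1 (upper_diag t h) with ⟨h0, h1⟩ | ⟨h0, h1⟩
  · have : t = transGen ^ (t 0 1) := by
      apply Subtype.ext
      rw [transGen_eq_T, ModularGroup.coe_T_zpow]
      ext i j
      fin_cases i <;> fin_cases j <;> simp [h, h0, h1]
    rw [this]
    exact hT _
  · have : t = -1 * transGen ^ (-t 0 1) := by
      rw [neg_one_mul]
      apply Subtype.ext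
      rw [Matrix.SpecialLinearGroup.coe_neg, transGen_eq_T, ModularGroup.coe_T_zpow]
      ext i j
      fin_cases i <;> fin_cases j <;> simp [h, h0, h1]
    rw [this]
    exact mul_mem hZ (hT _)

/-- A parabolic matrix has a primitive integral eigenvector, so it is conjugate to an upper
triangular one. -/
lemma exists_conj_upper_of_isParabolic {π : SL(2, ℤ)} (h : π.val.IsParabolic) :
    ∃ g : SL(2, ℤ), (g⁻¹ * π * g) 1 0 = 0 := by
  have hd : (π 0 0 + π 1 1) ^ 2 = 4 := by
    have h1 := h.2
    rw [Matrix.discr_fin_two, Matrix.trace_fin_two, π.det_coe] at h1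
    linarith
  obtain ⟨e, he, htr⟩ : ∃ e : ℤ, e * e = 1 ∧ π 0 0 + π 1 1 = 2 * e := by
    have : (π 0 0 + π 1 1 - 2) * (π 0 0 + π 1 1 + 2) = 0 := by linear_combination hd
    rcases mul_eq_zero.1 this with h1 | h1
    · exact ⟨1, by norm_num, by linarith⟩
    · exact ⟨-1, by norm_num, by linarith⟩
  have hdet := det_eq π
  obtain ⟨x, y, hxy, hy⟩ : ∃ x y : ℤ, IsCoprime x y ∧
      (π 0 0 * x + π 0 1 * y = e * x ∧ π 1 0 * x + π 1 1 * y = e * y) := by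
    by_cases h0 : π 0 1 = 0 ∧ e - π 0 0 = 0
    · refine ⟨0, 1, isCoprime_zero_left.2 isUnit_one, ?_, ?_⟩
      · rw [h0.1]; ring
      · linarith [h0.2]
    · have hg : Int.gcd (π 0 1) (e - π 0 0) ≠ 0 := by
        rwa [Ne, Int.gcd_eq_zero_iff]
      obtain ⟨x, y, hxy, h1, h2⟩ : ∃ x y : ℤ, IsCoprime x y ∧
          π 0 1 = x * Int.gcd (π 0 1) (e - π 0 0) ∧
          e - π 0 0 = y * Int.gcd (π 0 1) (e - π 0 0) := by
        obtain ⟨x, y, h1, h2, h3⟩ := Int.exists_gcd_one (Nat.pos_of_ne_zero hg)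
        exact ⟨x, y, Int.isCoprime_iff_gcd_eq_one.2 h1, h2, h3⟩
      have hg' : (Int.gcd (π 0 1) (e - π 0 0) : ℤ) ≠ 0 := Int.natCast_ne_zero.2 hg
      generalize (Int.gcd (π 0 1) (e - π 0 0) : ℤ) = d at h1 h2 hg'
      refine ⟨x, y, hxy, mul_right_cancel₀ hg' ?_, mul_right_cancel₀ hg' ?_⟩
      · linear_combination (- π 0 0 + e) * h1 - π 0 1 * h2
      · have h3 : (e - π 0 0) * (e - π 1 1) = π 0 1 * π 1 0 := by
          linear_combination hdet - e * htr - he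
        linear_combination (-π 1 0) * h1 + (e - π 1 1) * h2 - h3
  obtain ⟨g, hg0, hg1⟩ := hxy.exists_SL2_col 0
  refine ⟨g, ?_⟩
  simp only [Matrix.SpecialLinearGroup.coe_mul, Matrix.SpecialLinearGroup.coe_inv,
    Matrix.adjugate_fin_two, Matrix.mul_apply, Fin.sum_univ_two]
  simp only [Matrix.of_apply, Matrix.cons_val', Matrix.cons_val_zero, Matrix.cons_val_one, hg0, hg1]
  simp
  linear_combination (-y) * hy.1 + x * hy.2

variable {N : ℕ} {V : Type} [AddCommGroup V] [Module ℂ V] {ρ : Representation ℂ SL(2, ℤ) V}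
  {u : CongruenceSubgroup.Gamma N → V} {H : SL(2, ℤ) → V}

/-- A cocycle that extends to a function invariant under the stabilizer of `∞` is parabolic. -/
lemma IsExt.mem_parabolicCocycles (h : IsExt N ρ u H) (hT : leftSL ρ transGen H = H)
    (hZ : leftSL ρ (-1) H = H) : u ∈ parabolicCocycles N ρ := by
  refine (ParabolicCohomology.mem_parabolicCocycles N ρ u).2 ⟨h.cocycle, fun π hπ => ?_⟩
  obtain ⟨g, hg⟩ := exists_conj_upper_of_isParabolic hπ
  have hfix := leftSL_fixed_iff.1 (leftSL_fixed_of_mem_closure (ρ := ρ) (H := H)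
    (s := {transGen, -1}) (by rintro _ (rfl | rfl) <;> assumption) (mem_closure_of_upper hg)) g⁻¹
  have h1 := h g⁻¹ π
  have e : g⁻¹ * π * g * g⁻¹ = g⁻¹ * π := mul_inv_cancel_right _ _
  rw [e, h1] at hfix
  refine ⟨ρ g (H g⁻¹), ?_⟩
  have h2 := congrArg (ρ g) hfix
  simp only [map_add, ← Module.End.mul_apply, ← map_mul] at h2
  have e2 : g * (g⁻¹ * π * g) = π * g := by group
  rw [e2, mul_inv_cancel, map_one, Module.End.one_apply, map_mul, Module.End.mul_apply] at h2
  rw [← h2, add_sub_cancel_left]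

/-- A parabolic cocycle extends to a function invariant under the stabilizer of `∞`: the
conjugates of `transGen ^ N` give the invariance under `transGen ^ N`, and the rest is obtained
by averaging. -/
lemma exists_isExt_of_mem_parabolicCocycles [NeZero N] (hu : u ∈ parabolicCocycles N ρ) :
    ∃ H, IsExt N ρ u H ∧ leftSL ρ transGen H = H ∧ leftSL ρ (-1) H = H := by
  rw [mem_parabolicCocycles] at hu
  obtain ⟨H, hH⟩ := exists_isExt hu.1
  have hN : reduction N (transGen ^ N) = 1 := by
    ext i j
    change (((transGen ^ N).val i j : ℤ) : ZMod N) = _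
    rw [transGen_pow_val]
    fin_cases i <;> fin_cases j <;> simp
  have hpar : (transGen ^ N).val.IsParabolic := by
    rw [transGen_pow_val, Matrix.isParabolic_iff_of_upperTriangular (by simp)]
    simpa using NeZero.ne N
  obtain ⟨D, hD⟩ := (hH.left (transGen ^ N)).sub_eq_comp hH
  have key : ∀ x, ∃ y, D x = ρ (transGen ^ N) y - y := by
    intro x
    obtain ⟨g, rfl⟩ := reduction_surjective N x
    let ν : CongruenceSubgroup.Gamma N := conjGamma N g ⟨transGen ^ N, hN⟩
    have hν : (ν : SL(2, ℤ)) = g⁻¹ * transGen ^ N * g := rfl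
    obtain ⟨v, hv⟩ := hu.2 ν (isParabolic_conjGamma N g ⟨transGen ^ N, hN⟩ hpar)
    have h1 := congrFun hD g
    have h2 := hH g ν⁻¹
    have h3 : u ν⁻¹ = -ρ (ν : SL(2, ℤ))⁻¹ (u ν) := by
      have h4 := hu.1 ν⁻¹ ν
      have h5 : u 1 = 0 := by simpa using hu.1 1 1
      rw [inv_mul_cancel, h5] at h4
      rw [eq_comm, add_comm] at h4
      exact eq_neg_of_add_eq_zero_left h4
    have e1 : g * ((ν⁻¹ : CongruenceSubgroup.Gamma N) : SL(2, ℤ)) = (transGen ^ N)⁻¹ * g := by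
      rw [Subgroup.coe_inv, hν]
      group
    have e2 : transGen ^ N * g * (ν : SL(2, ℤ))⁻¹ = g := by
      rw [hν]
      group
    refine ⟨H g - ρ g v, ?_⟩
    rw [Function.comp_apply, Pi.sub_apply, leftRep_apply, MonoidHom.id_apply, ← e1, h2, h3,
      ← hv] at h1
    rw [← h1]
    simp only [map_add, map_neg, map_sub, ← Module.End.mul_apply, ← map_mul]
    rw [inv_mul_cancel, mul_one, ← mul_assoc, e2]
    abel
  choose F hF using key
  obtain ⟨H₁, h₁, hT₁, -⟩ := (hH.sub_comp F).exists_fixed transGen N (NeZero.ne N) (by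
    rw [map_sub, leftRep_comp]
    have h1 : leftRep (reduction N) ρ (transGen ^ N) F = F + D := by
      funext x
      rw [leftRep_apply, hN, inv_one, one_mul, Pi.add_apply, hF]
      abel
    rw [h1, eq_add_of_sub_eq hD]
    funext g
    simp only [Pi.sub_apply, Pi.add_apply, Function.comp_apply]
    abel)
  obtain ⟨H₂, h₂, hZ₂, hc⟩ := h₁.exists_fixed (-1) 2 two_ne_zero (by simp)
  exact ⟨H₂, h₂, hc _ ((Commute.one_right _).neg_right) hT₁, hZ₂⟩

end Parabolic

/-! ### Parabolic cohomology as a subquotient of the functions on edges -/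

section Comparison

variable (N : ℕ) {V : Type} [AddCommGroup V] [Module ℂ V] (ρ : Representation ℂ SL(2, ℤ) V)

/-- A parabolic cocycle together with two extensions to `SL(2, ℤ)`, invariant under the stabilizers
of `i` and of `ρ`. -/
def extTriples : Submodule ℂ (parabolicCocycles N ρ × (SL(2, ℤ) → V) × (SL(2, ℤ) → V)) where
  carrier := {t | (IsExt N ρ t.1.1 t.2.1 ∧ leftSL ρ iGen t.2.1 = t.2.1) ∧
    IsExt N ρ t.1.1 t.2.2 ∧ leftSL ρ rhoGen t.2.2 = t.2.2}
  add_mem' := by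
    rintro t t' ⟨⟨ha, hi⟩, hb, hr⟩ ⟨⟨ha', hi'⟩, hb', hr'⟩
    exact ⟨⟨ha.add ha', (map_add _ _ _).trans (congrArg₂ _ hi hi')⟩, hb.add hb',
      (map_add _ _ _).trans (congrArg₂ _ hr hr')⟩
  zero_mem' := by
    refine ⟨⟨fun g ν => ?_, map_zero _⟩, fun g ν => ?_, map_zero _⟩ <;>
    simp
  smul_mem' := by
    rintro c t ⟨⟨ha, hi⟩, hb, hr⟩
    exact ⟨⟨ha.smul c, (map_smul _ _ _).trans (congrArg _ hi)⟩, hb.smul c,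
      (map_smul _ _ _).trans (congrArg _ hr)⟩

variable {N ρ}

lemma mem_extTriples {u : parabolicCocycles N ρ} {a b : SL(2, ℤ) → V} :
    (u, a, b) ∈ extTriples N ρ ↔ (IsExt N ρ u.1 a ∧ leftSL ρ iGen a = a) ∧
      IsExt N ρ u.1 b ∧ leftSL ρ rhoGen b = b := Iff.rfl

lemma exists_extTriples [NeZero N] (u : parabolicCocycles N ρ) :
    ∃ a b, (u, a, b) ∈ extTriples N ρ := by
  obtain ⟨H, hH⟩ := exists_isExt ((mem_parabolicCocycles N ρ u.1).1 u.2).1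
  obtain ⟨a, ha, hi, -⟩ := hH.exists_fixed iGen 4 four_ne_zero (by
    rw [← orderOf_iGen, pow_orderOf_eq_one, map_one, Module.End.one_apply])
  obtain ⟨b, hb, hr, -⟩ := hH.exists_fixed rhoGen 6 (by norm_num) (by
    rw [← orderOf_rhoGen, pow_orderOf_eq_one, map_one, Module.End.one_apply])
  exact ⟨a, b, ⟨ha, hi⟩, hb, hr⟩

/-- The `SL(2, ℤ)`-translate of a triple. It lies over the translate of the cocycle. -/
lemma extTriples_translate (g : SL(2, ℤ)) {u : parabolicCocycles N ρ} {a b : SL(2, ℤ) → V}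
    (h : (u, a, b) ∈ extTriples N ρ) :
    (cocycleRep N ρ g u, rightRep _ V g a, rightRep _ V g b) ∈ extTriples N ρ := by
  have key : ∀ H, IsExt N ρ u.1 H → IsExt N ρ (cocycleRep N ρ g u).1 (rightRep _ V g H) := by
    intro H hH x ν
    change H (x * ν * g) = H (x * g) + ρ x (ρ g (u.1 (conjGamma N g ν)))
    have e : x * ν * g = x * g * (conjGamma N g ν) := by
      simp only [conjGamma]
      group
    rw [e, hH, map_mul, Module.End.mul_apply]
  rw [mem_extTriples] at h ⊢
  refine ⟨⟨key a h.1.1, ?_⟩, key b h.2.1, ?_⟩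
  · rw [leftRep_rightRep, h.1.2]
  · rw [leftRep_rightRep, h.2.2]

variable (N ρ) in
/-- The class in parabolic cohomology of a triple. -/
def tripleClass : extTriples N ρ →ₗ[ℂ] ParabolicH1 N ρ :=
  (parabolicCoboundaries N ρ).mkQ ∘ₗ LinearMap.fst ℂ _ _ ∘ₗ (extTriples N ρ).subtype

lemma tripleClass_surjective [NeZero N] : Function.Surjective (tripleClass N ρ) := by
  intro x
  obtain ⟨u, rfl⟩ := Submodule.Quotient.mk_surjective _ x
  obtain ⟨a, b, h⟩ := exists_extTriples u
  exact ⟨⟨_, h⟩, rfl⟩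

variable (N ρ) in
/-- The difference of the two extensions of a triple, as a function on `SL(2, ℤ/Nℤ)`. -/
def tripleDiff [NeZero N] : extTriples N ρ →ₗ[ℂ] (SL(2, ZMod N) → V) :=
  LinearMap.funLeft ℂ V (Function.surjInv (reduction_surjective N)) ∘ₗ
    (LinearMap.fst ℂ _ _ - LinearMap.snd ℂ _ _) ∘ₗ LinearMap.snd ℂ _ _ ∘ₗ (extTriples N ρ).subtype

lemma tripleDiff_comp [NeZero N] (t : extTriples N ρ) :
    tripleDiff N ρ t ∘ reduction N = t.1.2.1 - t.1.2.2 := by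
  obtain ⟨F, hF⟩ := t.2.1.1.sub_eq_comp t.2.2.1
  have h1 : tripleDiff N ρ t = F := by
    funext x
    change (t.1.2.1 - t.1.2.2) _ = _
    rw [hF, Function.comp_apply, Function.surjInv_eq (reduction_surjective N)]
  rw [h1, hF]

lemma comp_reduction_injective {V : Type} [NeZero N] {F F' : SL(2, ZMod N) → V}
    (h : F ∘ reduction N = F' ∘ reduction N) : F = F' :=
  (reduction_surjective N).injective_comp_right h

lemma fixed_iff_comp [NeZero N] (γ : SL(2, ℤ)) (F : SL(2, ZMod N) → V) :
    leftRep (reduction N) ρ γ F = F ↔ leftSL ρ γ (F ∘ reduction N) = F ∘ reduction N := by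
  rw [leftRep_comp]
  exact ⟨fun h => by rw [h], comp_reduction_injective⟩

lemma fixed_neg_one_of_iGen {H : SL(2, ℤ) → V} (h : leftSL ρ iGen H = H) :
    leftSL ρ (-1) H = H := by
  have : (-1 : SL(2, ℤ)) = iGen * iGen := by decide
  rw [this, map_mul, Module.End.mul_apply, h, h]

lemma fixed_neg_one_of_rhoGen {H : SL(2, ℤ) → V} (h : leftSL ρ rhoGen H = H) :
    leftSL ρ (-1) H = H := by
  have : (-1 : SL(2, ℤ)) = rhoGen * (rhoGen * rhoGen) := by decide
  rw [this, map_mul, map_mul, Module.End.mul_apply, Module.End.mul_apply, h, h, h]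

lemma fixed_inv {γ : SL(2, ℤ)} {H : SL(2, ℤ) → V} (h : leftSL ρ γ H = H) :
    leftSL ρ γ⁻¹ H = H :=
  leftSL_fixed_of_mem_closure (s := {γ}) (by rintro _ rfl; exact h)
    (inv_mem (Subgroup.subset_closure rfl))

/-- With `w = a - b` for `b` fixed by `rhoGen` and `a` fixed by `iGen`, the identity
`transGen = iGen⁻¹ * rhoGen` turns `(iGen⁻¹ - 1) w` into `(1 - transGen) b`. -/
lemma leftSL_transGen_sub {a b w : SL(2, ℤ) → V} (ha : leftSL ρ iGen a = a)
    (hb : leftSL ρ rhoGen b = b) (hw : a - b = w) :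
    leftSL ρ transGen b - b = -(leftSL ρ iGen⁻¹ w - w) := by
  rw [transGen_eq, map_mul, Module.End.mul_apply, hb, ← hw, map_sub, fixed_inv ha]
  abel

lemma tripleDiff_mem [NeZero N] (t : extTriples N ρ) :
    tripleDiff N ρ t ∈ (parabolicSub (reduction N) ρ).toSubmodule := by
  obtain ⟨⟨u, a, b⟩, ⟨ha, hi⟩, hb, hr⟩ := t
  obtain ⟨c, hc, hT, hZ⟩ := exists_isExt_of_mem_parabolicCocycles u.2
  obtain ⟨y, hy⟩ := hc.sub_eq_comp hb
  have hdiff := tripleDiff_comp (⟨⟨u, a, b⟩, ⟨ha, hi⟩, hb, hr⟩ : extTriples N ρ)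
  rw [mem_parabolicSub]
  refine ⟨?_, y, ?_, comp_reduction_injective ?_⟩
  · rw [fixed_iff_comp, hdiff, map_sub]
    simp only [fixed_neg_one_of_iGen hi, fixed_neg_one_of_rhoGen hr]
  · rw [fixed_iff_comp, ← hy, map_sub, hZ, fixed_neg_one_of_rhoGen hr]
  · change leftRep _ ρ transGen y ∘ _ - y ∘ _ = leftRep _ ρ _ _ ∘ _ - _ ∘ _
    rw [← leftRep_comp, ← leftRep_comp, ← hy, hdiff, map_sub, hT]
    have h1 := leftSL_transGen_sub hi hr rfl
    rw [← neg_eq_iff_eq_neg] at h1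
    rw [← h1]
    abel

lemma exists_tripleDiff_eq [NeZero N] {F : SL(2, ZMod N) → V}
    (hF : F ∈ (parabolicSub (reduction N) ρ).toSubmodule) : ∃ t, tripleDiff N ρ t = F := by
  obtain ⟨hF, y, hyZ, hy⟩ := (mem_parabolicSub _ _).1 hF
  obtain ⟨a, b, hi, hr, hab⟩ := exists_equivariant_potential (ρ := ρ) (F ∘ reduction N)
    ((fixed_iff_comp _ _).1 hF)
  obtain ⟨u, ha, hb⟩ := exists_isExt_of_sub_eq_comp hi hr hab
  have hu : u ∈ parabolicCocycles N ρ := by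
    refine (hb.add_comp y).mem_parabolicCocycles ?_ ?_
    · rw [← sub_eq_zero, map_add, add_sub_add_comm, leftSL_transGen_sub hi hr hab, leftRep_comp,
        leftRep_comp]
      have := congrArg (fun f : SL(2, ZMod N) → V => f ∘ reduction N) hy
      change leftRep _ ρ transGen y ∘ _ - y ∘ _ = leftRep _ ρ _ F ∘ _ - F ∘ _ at this
      rw [this, neg_add_cancel]
    · rw [map_add, fixed_neg_one_of_rhoGen hr, (fixed_iff_comp _ _).1 hyZ]
  refine ⟨⟨(⟨u, hu⟩, a, b), ⟨ha, hi⟩, hb, hr⟩, comp_reduction_injective ?_⟩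
  rw [tripleDiff_comp, ← hab]

/-- The class of a triple vanishes if and only if the difference of its two extensions is
a difference of two functions on `SL(2, ℤ/Nℤ)` with the same invariance. -/
lemma tripleClass_eq_zero_iff [NeZero N] (t : extTriples N ρ) :
    tripleClass N ρ t = 0 ↔ tripleDiff N ρ t ∈
      (fixSub (reduction N) ρ iGen ⊔ fixSub (reduction N) ρ rhoGen).toSubmodule := by
  obtain ⟨⟨u, a, b⟩, ⟨ha, hi⟩, hb, hr⟩ := t
  have hdiff := tripleDiff_comp (⟨⟨u, a, b⟩, ⟨ha, hi⟩, hb, hr⟩ : extTriples N ρ)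
  set w := tripleDiff N ρ ⟨⟨u, a, b⟩, ⟨ha, hi⟩, hb, hr⟩
  change (Submodule.Quotient.mk u : ParabolicH1 N ρ) = 0 ↔ _
  rw [Submodule.Quotient.mk_eq_zero, mem_parabolicCoboundaries, Subrepresentation.toSubmodule_sup,
    Submodule.mem_sup]
  constructor
  · rintro ⟨v, hv⟩
    -- The coboundary of `v` extends to the invariant function `g ↦ g v`.
    have hc : IsExt N ρ u.1 fun g => ρ g v := by
      intro g ν
      rw [← hv, map_sub, ← Module.End.mul_apply, ← map_mul, add_sub_cancel]
    have hfix : ∀ γ, leftSL ρ γ (fun g => ρ g v) = fun g => ρ g v := by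
      intro γ
      rw [leftSL_fixed_iff]
      intro g
      rw [map_mul, Module.End.mul_apply]
    obtain ⟨F, hF⟩ := ha.sub_eq_comp hc
    obtain ⟨F', hF'⟩ := hc.sub_eq_comp hb
    refine ⟨F, ?_, F', ?_, comp_reduction_injective ?_⟩
    · rw [mem_fixSub, fixed_iff_comp, ← hF, map_sub, hfix, hi]
    · rw [mem_fixSub, fixed_iff_comp, ← hF', map_sub, hfix, hr]
    · rw [hdiff]
      change F ∘ reduction N + F' ∘ reduction N = _
      rw [← hF, ← hF']
      exact sub_add_sub_cancel _ _ _
  · rintro ⟨F, hF, F', hF', hsum⟩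
    rw [mem_fixSub, fixed_iff_comp] at hF hF'
    have heq : a - F ∘ reduction N = b + F' ∘ reduction N := by
      have h1 : F ∘ reduction N + F' ∘ reduction N = a - b := by
        rw [← hdiff, ← hsum]
        rfl
      rw [sub_eq_iff_eq_add, add_assoc, add_comm (F' ∘ _), h1, add_sub_cancel]
    have h1 : leftSL ρ iGen (a - F ∘ reduction N) = a - F ∘ reduction N := by
      rw [map_sub, hF, hi]
    have h2 : leftSL ρ rhoGen (a - F ∘ reduction N) = a - F ∘ reduction N := by
      rw [heq, map_add, hF', hr]
    have h3 := eq_apply_one_of_fixed h1 h2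
    have h4 := ha.sub_comp F
    generalize a - F ∘ reduction N = c at h3 h4
    refine ⟨c 1, fun γ => ?_⟩
    have h5 := h4 1 γ
    rw [one_mul, map_one, Module.End.one_apply, h3] at h5
    rw [h5, add_sub_cancel_left]

lemma tripleDiff_translate [NeZero N] (g : SL(2, ℤ)) (t : extTriples N ρ) :
    tripleDiff N ρ ⟨_, extTriples_translate g t.2⟩ =
      rightRep _ V (reduction N g) (tripleDiff N ρ t) := by
  apply comp_reduction_injective
  rw [tripleDiff_comp]
  funext x
  have h := congrFun (tripleDiff_comp t) (x * g)
  simp only [Function.comp_apply, rightRep_apply, Pi.sub_apply, map_mul] at h ⊢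
  exact h.symm

variable (N ρ) in
/-- The map `tripleDiff`, with its image as codomain. -/
def tripleDiff' [NeZero N] : extTriples N ρ →ₗ[ℂ] (parabolicSub (reduction N) ρ).toSubmodule :=
  (tripleDiff N ρ).codRestrict _ tripleDiff_mem

lemma tripleDiff'_surjective [NeZero N] : Function.Surjective (tripleDiff' N ρ) := by
  rintro ⟨F, hF⟩
  obtain ⟨t, rfl⟩ := exists_tripleDiff_eq hF
  exact ⟨t, rfl⟩

lemma fixSub_sup_le_parabolicSub [NeZero N] :
    (fixSub (reduction N) ρ iGen ⊔ fixSub (reduction N) ρ rhoGen).toSubmodule ≤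
      (parabolicSub (reduction N) ρ).toSubmodule := by
  refine sup_le (fun F hF => ?_) fun F hF => ?_ <;> rw [mem_fixSub, fixed_iff_comp] at hF
  · refine (mem_parabolicSub _ _).2 ⟨?_, 0, map_zero _, ?_⟩
    · rw [fixed_iff_comp, fixed_neg_one_of_iGen hF]
    · have := (fixed_iff_comp _ _).2 (fixed_inv hF)
      rw [this, sub_self, map_zero, sub_zero]
  · refine (mem_parabolicSub _ _).2 ⟨?_, F, ?_, ?_⟩
    · rw [fixed_iff_comp, fixed_neg_one_of_rhoGen hF]
    · rw [fixed_iff_comp, fixed_neg_one_of_rhoGen hF]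
    · rw [transGen_eq, map_mul, Module.End.mul_apply, (fixed_iff_comp _ _).2 hF]

/-- The map from admissible functions on edges to parabolic cohomology induced by the triples. -/
lemma exists_edgeToCohomology [NeZero N] :
    ∃ k : (parabolicSub (reduction N) ρ).toSubmodule →ₗ[ℂ] ParabolicH1 N ρ,
      ∀ t, k (tripleDiff' N ρ t) = tripleClass N ρ t := by
  refine exists_factor_of_ker_le (M := extTriples N ρ)
    (X := (parabolicSub (reduction N) ρ).toSubmodule) (tripleDiff' N ρ) (tripleClass N ρ)
    (tripleDiff'_surjective (N := N) (ρ := ρ))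
    fun t ht => ?_
  rw [LinearMap.mem_ker, tripleClass_eq_zero_iff]
  have : tripleDiff N ρ t = 0 := congrArg Subtype.val (LinearMap.mem_ker.1 ht)
  rw [this]
  exact zero_mem _

/-- The parabolic cohomology is the space of admissible functions on edges modulo the sums of
functions coming from the two kinds of vertices. -/
theorem subClass_parabolicSub [NeZero N] [Module.Finite ℂ V] :
    subClass (parabolicSub (reduction N) ρ) =
      subClass (fixSub (reduction N) ρ iGen ⊔ fixSub (reduction N) ρ rhoGen) +
        repClass (h1Rep N ρ) := by
  obtain ⟨k, hk⟩ := exists_edgeToCohomology (N := N) (ρ := ρ)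
  refine repClass_eq_add_of_exact
    (fixSub (reduction N) ρ iGen ⊔ fixSub (reduction N) ρ rhoGen).toRepresentation
    (parabolicSub (reduction N) ρ).toRepresentation (h1Rep N ρ)
    (Submodule.inclusion fixSub_sup_le_parabolicSub) k (fun a x => rfl) ?_
    (Submodule.inclusion_injective _) ?_ ?_
  · intro a x
    obtain ⟨g, rfl⟩ := reduction_surjective N a
    obtain ⟨t, rfl⟩ := tripleDiff'_surjective x
    have h1 : (parabolicSub (reduction N) ρ).toRepresentation (reduction N g)
        (tripleDiff' N ρ t) = tripleDiff' N ρ ⟨_, extTriples_translate g t.2⟩ :=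
      Subtype.ext (tripleDiff_translate g t).symm
    rw [h1, hk, hk, h1Rep_reduction]
    rfl
  · intro x
    obtain ⟨t, rfl⟩ := tripleDiff'_surjective x
    rw [hk, tripleClass_eq_zero_iff]
    constructor
    · intro h
      exact ⟨⟨_, h⟩, rfl⟩
    · rintro ⟨y, hy⟩
      have := congrArg Subtype.val hy
      change y.1 = tripleDiff N ρ t at this
      rw [← this]
      exact y.2
  · intro x
    obtain ⟨t, rfl⟩ := tripleClass_surjective x
    exact ⟨tripleDiff' N ρ t, hk t⟩

end Comparison

/-! ### The class of parabolic cohomology in terms of fixed functions -/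

section Formula

variable (N : ℕ) {V : Type} [AddCommGroup V] [Module ℂ V]
  (ρ : Representation ℂ SL(2, ℤ) V)

/-- The sum of the images of `iGen⁻¹ - 1` and `transGen - 1` on the functions fixed by `-1`. The
quotient by it is the space of coinvariants. -/
def augSub : Subrepresentation (rightRep SL(2, ZMod N) V) :=
  mapSub (leftRep (reduction N) ρ iGen⁻¹ - 1) (leftRep_sub_one_rightRep _ ρ _)
    (fixSub (reduction N) ρ (-1)) ⊔ cuspSub (reduction N) ρ

lemma leftRep_fixed_of_fixed {Q : Type} [Group Q] {φ : SL(2, ℤ) →* Q} {F : Q → V}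
    (hi : leftRep φ ρ iGen F = F) (hr : leftRep φ ρ rhoGen F = F) (γ : SL(2, ℤ)) :
    leftRep φ ρ γ F = F := by
  have hγ : γ ∈ Subgroup.closure {iGen, rhoGen} := closure_iGen_rhoGen ▸ Subgroup.mem_top γ
  induction hγ using Subgroup.closure_induction with
  | mem x hx => rcases hx with rfl | rfl <;> assumption
  | one => simp
  | mul x y _ _ hx hy => rw [map_mul, Module.End.mul_apply, hy, hx]
  | inv x _ hx =>
    conv_lhs => rw [← hx]
    rw [← Module.End.mul_apply, ← map_mul, inv_mul_cancel, map_one, Module.End.one_apply]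

lemma augSub_le : (augSub N ρ).toSubmodule ≤ (fixSub (reduction N) ρ (-1)).toSubmodule := by
  have key : ∀ γ F, F ∈ (fixSub (reduction N) ρ (-1)).toSubmodule →
      (leftRep (reduction N) ρ γ - 1) F ∈ (fixSub (reduction N) ρ (-1)).toSubmodule := by
    intro γ F hF
    rw [mem_fixSub] at hF ⊢
    have h : leftRep (reduction N) ρ (-1) (leftRep (reduction N) ρ γ F) =
        leftRep (reduction N) ρ γ F := by
      rw [← Module.End.mul_apply, ← map_mul, neg_one_mul, ← mul_neg_one, map_mul,
        Module.End.mul_apply, hF]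
    rw [LinearMap.sub_apply, map_sub, h, Module.End.one_apply, hF]
  refine sup_le ?_ ?_
  · rintro _ ⟨F, hF, rfl⟩
    exact key _ F hF
  · rintro _ ⟨F, hF, rfl⟩
    exact key _ F hF

open Classical in
lemma leftRep_single (γ : SL(2, ℤ)) (x : SL(2, ZMod N)) (v : V) :
    leftRep (reduction N) ρ γ (Pi.single x v) = Pi.single (reduction N γ * x) (ρ γ v) := by
  funext y
  rw [leftRep_apply]
  by_cases h : y = reduction N γ * x
  · rw [h, inv_mul_cancel_left, Pi.single_eq_same, Pi.single_eq_same]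
  · rw [Pi.single_eq_of_ne h, Pi.single_eq_of_ne, map_zero]
    rwa [Ne, inv_mul_eq_iff_eq_mul]

variable [NeZero N]

open Classical in
/-- A functional on the functions fixed by `-1` that vanishes on `augSub` comes from a family of
functionals on `V`, indexed by `SL(2, ℤ/Nℤ)` and compatible with the action of `SL(2, ℤ)`. -/
lemma exists_invariant_functional {θ : Module.Dual ℂ (SL(2, ZMod N) → V)}
    (hθ : ∀ F ∈ (augSub N ρ).toSubmodule, θ F = 0) :
    ∃ l : SL(2, ZMod N) → Module.Dual ℂ V,
      (∀ γ x v, l (reduction N γ * x) (ρ γ v) = l x v) ∧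
      ∀ F ∈ (fixSub (reduction N) ρ (-1)).toSubmodule, 2 * θ F = ∑ x, l x (F x) := by
  let θ' : Module.Dual ℂ (SL(2, ZMod N) → V) := θ ∘ₗ (1 + leftRep (reduction N) ρ (-1))
  have hmem : ∀ F, (1 + leftRep (reduction N) ρ (-1)) F ∈
      (fixSub (reduction N) ρ (-1)).toSubmodule := by
    intro F
    rw [mem_fixSub, LinearMap.add_apply, Module.End.one_apply, map_add, ← Module.End.mul_apply,
      ← map_mul, neg_one_mul_self, map_one, add_comm, Module.End.one_apply]
  have hcomm : ∀ γ F, (1 + leftRep (reduction N) ρ (-1)) (leftRep (reduction N) ρ γ F) =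
      leftRep (reduction N) ρ γ ((1 + leftRep (reduction N) ρ (-1)) F) := by
    intro γ F
    simp only [LinearMap.add_apply, map_add, Module.End.one_apply]
    rw [← Module.End.mul_apply, ← Module.End.mul_apply, ← map_mul, ← map_mul, neg_one_mul,
      mul_neg_one]
  have hgen : ∀ γ, (∀ F ∈ (fixSub (reduction N) ρ (-1)).toSubmodule,
      (leftRep (reduction N) ρ γ - 1) F ∈ (augSub N ρ).toSubmodule) →
      ∀ F, θ' (leftRep (reduction N) ρ γ F) = θ' F := by
    intro γ h F
    have := hθ _ (h _ (hmem F))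
    rw [LinearMap.sub_apply, map_sub, sub_eq_zero, Module.End.one_apply] at this
    simp only [θ', LinearMap.comp_apply, hcomm, this]
  have hi : ∀ F, θ' (leftRep (reduction N) ρ iGen⁻¹ F) = θ' F :=
    hgen _ fun F hF => Submodule.mem_sup_left ⟨F, hF, rfl⟩
  have hT : ∀ F, θ' (leftRep (reduction N) ρ transGen F) = θ' F :=
    hgen _ fun F hF => Submodule.mem_sup_right ⟨F, hF, rfl⟩
  have hi' : ∀ F, θ' (leftRep (reduction N) ρ iGen F) = θ' F := by
    intro F
    rw [← hi, ← Module.End.mul_apply, ← map_mul, inv_mul_cancel, map_one, Module.End.one_apply]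
  have hall : ∀ γ F, θ' (leftRep (reduction N) ρ γ F) = θ' F := by
    intro γ
    have hγ : γ ∈ Subgroup.closure {iGen, rhoGen} := closure_iGen_rhoGen ▸ Subgroup.mem_top γ
    induction hγ using Subgroup.closure_induction with
    | mem x hx =>
      rcases hx with rfl | rfl
      · exact hi'
      · intro F
        have : rhoGen = iGen * transGen := by decide
        rw [this, map_mul, Module.End.mul_apply, hi', hT]
    | one => simp
    | mul x y _ _ hx hy =>
      intro F
      rw [map_mul, Module.End.mul_apply, hx, hy]
    | inv x _ hx =>
      intro F
      rw [← hx, ← Module.End.mul_apply, ← map_mul, mul_inv_cancel, map_one, Module.End.one_apply]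
  refine ⟨fun x => θ' ∘ₗ LinearMap.single ℂ (fun _ => V) x, fun γ x v => ?_, fun F hF => ?_⟩
  · simp only [LinearMap.comp_apply, LinearMap.coe_single]
    rw [← leftRep_single, hall]
  · simp only [LinearMap.comp_apply, LinearMap.coe_single]
    rw [← map_sum, Finset.univ_sum_single]
    rw [mem_fixSub] at hF
    simp only [θ', LinearMap.comp_apply, LinearMap.add_apply, hF, Module.End.one_apply, map_add,
      two_mul]

lemma subrep_eq {G X : Type} [Group G] [AddCommGroup X] [Module ℂ X] {σ : Representation ℂ G X}
    {P Q : Subrepresentation σ} (h : ∀ x, x ∈ P.toSubmodule ↔ x ∈ Q.toSubmodule) : P = Q :=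
  Subrepresentation.ext (Submodule.ext h)

variable [Module.Finite ℂ V]

lemma repClass_h1Rep_eq :
    repClass (h1Rep N ρ) =
      2 • subClass (fixSub (reduction N) ρ (-1)) - subClass (augSub N ρ)
        - subClass (fixSub (reduction N) ρ rhoGen) - subClass (fixSub (reduction N) ρ iGen)
        - subClass (fixSub (reduction N) ρ (-1) ⊓ fixSub (reduction N) ρ transGen)
        + subClass (fixSub (reduction N) ρ iGen ⊓ fixSub (reduction N) ρ rhoGen) := by
  have h1 := subClass_parabolicSub (N := N) (ρ := ρ)
  have h2 : subClass _ + subClass _ = subClass (parabolicSub (reduction N) ρ) +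
      subClass (augSub N ρ) := subClass_add_subClass (leftRep (reduction N) ρ iGen⁻¹ - 1)
    (leftRep_sub_one_rightRep _ ρ _) (fixSub (reduction N) ρ (-1)) (cuspSub (reduction N) ρ)
  have h3 : _ = subClass (fixSub (reduction N) ρ (-1) ⊓ fixSub (reduction N) ρ transGen) +
      subClass (cuspSub (reduction N) ρ) :=
    subClass_eq_ker_add_map (leftRep (reduction N) ρ transGen - 1)
      (leftRep_sub_one_rightRep _ ρ _) (fixSub (reduction N) ρ (-1))
  have h4 := subClass_sup_add_inf (fixSub (reduction N) ρ iGen) (fixSub (reduction N) ρ rhoGen)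
  rw [eq_sub_of_add_eq' h1.symm, eq_sub_of_add_eq h2.symm, eq_sub_of_add_eq' h4.symm,
    eq_sub_of_add_eq' h3.symm, two_nsmul]
  abel

lemma mem_augSub_of_forall {F : SL(2, ZMod N) → V}
    (h : ∀ θ : Module.Dual ℂ (SL(2, ZMod N) → V),
      (∀ F ∈ (augSub N ρ).toSubmodule, θ F = 0) → θ F = 0) : F ∈ (augSub N ρ).toSubmodule := by
  by_contra hF
  obtain ⟨θ, h1, h2⟩ := Submodule.exists_dual_map_eq_bot_of_notMem hF inferInstance
  refine h1 (h θ fun F' hF' => ?_)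
  have : θ F' ∈ (augSub N ρ).toSubmodule.map θ := ⟨F', hF', rfl⟩
  rwa [h2, Submodule.mem_bot] at this

/-- If `V` has no functionals invariant under `Γ(N)`, then there are no coinvariants. -/
lemma augSub_eq_of_dual_invariants
    (h : ∀ l : Module.Dual ℂ V, (∀ γ : CongruenceSubgroup.Gamma N, ∀ v, l (ρ γ v) = l v) → l = 0) :
    augSub N ρ = fixSub (reduction N) ρ (-1) := by
  refine subrep_eq fun F => ⟨fun hF => augSub_le N ρ hF, fun hF => ?_⟩
  refine mem_augSub_of_forall N ρ fun θ hθ => ?_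
  obtain ⟨l, hl, hsum⟩ := exists_invariant_functional N ρ hθ
  have h0 : ∀ x, l x = 0 := by
    intro x
    refine h _ fun γ v => ?_
    have := hl γ x v
    rwa [show reduction N γ = 1 from γ.2, one_mul] at this
  have := hsum F hF
  simpa [h0] using this

/-- If `V` has no vectors invariant under `Γ(N)`, then there are no functions fixed by
`SL(2, ℤ)`. -/
lemma subClass_inf_of_invariants
    (h : ∀ v : V, (∀ γ : CongruenceSubgroup.Gamma N, ρ γ v = v) → v = 0) :
    subClass (fixSub (reduction N) ρ iGen ⊓ fixSub (reduction N) ρ rhoGen) = 0 := by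
  refine subClass_eq_zero _ ((Submodule.eq_bot_iff _).2 fun F hF => funext fun x => ?_)
  rw [Subrepresentation.toSubmodule_inf, Submodule.mem_inf, mem_fixSub, mem_fixSub] at hF
  refine h _ fun γ => ?_
  have := (leftRep_eq_self_iff _ _ _ _).1 (leftRep_fixed_of_fixed ρ hF.1 hF.2 γ) x
  rwa [show reduction N γ = 1 from γ.2, one_mul, eq_comm] at this

/-- For the trivial one-dimensional representation the fixed functions are the constants. -/
lemma subClass_inf_of_trivial (hρ : ∀ γ v, ρ γ v = v) (e : V ≃ₗ[ℂ] ℂ) :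
    subClass (fixSub (reduction N) ρ iGen ⊓ fixSub (reduction N) ρ rhoGen) = charClass 1 := by
  let f : ℂ →ₗ[ℂ] (fixSub (reduction N) ρ iGen ⊓ fixSub (reduction N) ρ rhoGen).toSubmodule :=
    LinearMap.codRestrict _ (LinearMap.pi fun _ => e.symm.toLinearMap) (by
      intro c
      rw [Subrepresentation.toSubmodule_inf, Submodule.mem_inf, mem_fixSub, mem_fixSub,
        leftRep_eq_self_iff, leftRep_eq_self_iff]
      exact ⟨fun x => (hρ _ _).symm, fun x => (hρ _ _).symm⟩)
  refine (repClass_congr _ _ (LinearEquiv.ofBijective f ⟨fun c d h => ?_, ?_⟩) ?_).symm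
  · exact e.symm.injective (congrFun (congrArg Subtype.val h) 1)
  · rintro ⟨F, hF⟩
    refine ⟨e (F 1), Subtype.ext (funext fun x => ?_)⟩
    rw [Subrepresentation.toSubmodule_inf, Submodule.mem_inf, mem_fixSub, mem_fixSub] at hF
    obtain ⟨γ, rfl⟩ := reduction_surjective N x
    have := (leftRep_eq_self_iff _ _ _ _).1 (leftRep_fixed_of_fixed ρ hF.1 hF.2 γ) 1
    rw [mul_one, hρ] at this
    exact (e.symm_apply_apply _).trans this.symm
  · intro a c
    apply Subtype.ext
    funext x
    change e.symm (((1 : _ →* ℂˣ) a : ℂ) • c) = e.symm c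
    simp

/-- For the trivial one-dimensional representation the coinvariants are given by summation. -/
lemma subClass_fixSub_of_trivial (hρ : ∀ γ v, ρ γ v = v) (e : V ≃ₗ[ℂ] ℂ) :
    subClass (fixSub (reduction N) ρ (-1)) = subClass (augSub N ρ) + charClass 1 := by
  classical
  let s : (SL(2, ZMod N) → V) →ₗ[ℂ] ℂ := ∑ x, e.toLinearMap ∘ₗ LinearMap.proj x
  have hs : ∀ F, s F = e (∑ x, F x) := fun F => by simp [s]
  have hleft : ∀ γ F, s (leftRep (reduction N) ρ γ F) = s F := by
    intro γ F
    simp only [hs, leftRep_apply, hρ]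
    exact congrArg e (Equiv.sum_comp (Equiv.mulLeft (reduction N γ)⁻¹) F)
  refine repClass_eq_add_of_exact _ _ (charRep 1) (Submodule.inclusion (augSub_le N ρ))
    (s.domRestrict _) (fun a x => rfl) ?_ (Submodule.inclusion_injective _) ?_ ?_
  · intro a F
    change s (rightRep _ V a F.1) = ((1 : _ →* ℂˣ) a : ℂ) • s F.1
    simp only [MonoidHom.one_apply, Units.val_one, one_smul, hs, rightRep_apply]
    exact congrArg e (Equiv.sum_comp (Equiv.mulRight a) F.1)
  · rintro ⟨F, hF⟩
    constructor
    · intro h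
      refine ⟨⟨F, mem_augSub_of_forall N ρ fun θ hθ => ?_⟩, rfl⟩
      obtain ⟨l, hl, hsum⟩ := exists_invariant_functional N ρ hθ
      have h0 : ∀ x, l x = l 1 := by
        intro x
        obtain ⟨γ, rfl⟩ := reduction_surjective N x
        refine LinearMap.ext fun v => ?_
        have := hl γ 1 v
        rwa [mul_one, hρ] at this
      have h1 := hsum F hF
      have h2 : ∑ x, F x = 0 := by
        have h3 : s F = 0 := h
        rwa [hs, LinearEquiv.map_eq_zero_iff] at h3
      simp only [h0] at h1
      rw [← map_sum, h2, map_zero] at h1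
      simpa using h1
    · rintro ⟨⟨F', hF'⟩, h⟩
      have h' : F' = F := congrArg Subtype.val h
      subst h'
      change s F' = 0
      have hle : (augSub N ρ).toSubmodule ≤ s.ker := by
        refine sup_le ?_ ?_ <;>
        · rintro _ ⟨F, hF, rfl⟩
          rw [LinearMap.mem_ker, LinearMap.sub_apply, map_sub, hleft, Module.End.one_apply,
            sub_self]
      exact hle hF'
  · intro c
    refine ⟨⟨fun _ => e.symm ((Fintype.card SL(2, ZMod N) : ℂ)⁻¹ * c), ?_⟩, ?_⟩
    · rw [mem_fixSub, leftRep_eq_self_iff]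
      exact fun x => (hρ _ _).symm
    · change s (fun _ => e.symm ((Fintype.card SL(2, ZMod N) : ℂ)⁻¹ * c)) = c
      have : (Fintype.card SL(2, ZMod N) : ℂ) ≠ 0 := Nat.cast_ne_zero.2 Fintype.card_ne_zero
      rw [hs]
      simp only [Finset.sum_const, Finset.card_univ, map_nsmul, LinearEquiv.apply_symm_apply,
        nsmul_eq_mul]
      field_simp

end Formula

/-! ### Induced characters as eigenspaces of left translations -/

section Eigen

variable {G : Type} [Group G]

/-- Left translation `F ↦ F(c ·)` on functions on `G`. -/
def leftTrans (c : G) : Module.End ℂ (G → ℂ) := LinearMap.funLeft ℂ ℂ (c * ·)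

lemma leftTrans_apply (c : G) (F : G → ℂ) (x : G) : leftTrans c F x = F (c * x) := rfl

lemma leftTrans_pow (c : G) (m : ℕ) : leftTrans c ^ m = leftTrans (c ^ m) := by
  induction m with
  | zero => ext; simp [leftTrans_apply]
  | succ m ih =>
    rw [pow_succ', ih]
    refine LinearMap.ext fun F => funext fun x => ?_
    rw [Module.End.mul_apply, leftTrans_apply, leftTrans_apply, leftTrans_apply, ← mul_assoc,
      pow_succ]

/-- The kernel of a polynomial in the left translation by `c`. -/
def polySub (c : G) (p : Polynomial ℂ) : Subrepresentation (rightRep G ℂ) :=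
  kerSub (ρY := rightRep G ℂ) (Polynomial.aeval (leftTrans c) p) (by
    intro a F
    have h : Commute (leftTrans c) (rightRep G ℂ a) :=
      LinearMap.ext fun F => funext fun x => congrArg F (mul_assoc _ _ _)
    have h2 : Commute (Polynomial.aeval (leftTrans c) p) (rightRep G ℂ a) := by
      induction p using Polynomial.induction_on' with
      | add p q hp hq => rw [map_add]; exact hp.add_left hq
      | monomial n b =>
        rw [Polynomial.aeval_monomial]
        exact (Algebra.commute_algebraMap_left b _).mul_left (h.pow_left n)
    exact LinearMap.congr_fun h2 F)

/-- The functions with `F(c x) = ζ F(x)`. -/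
def eigSub (c : G) (ζ : ℂ) : Subrepresentation (rightRep G ℂ) where
  toSubmodule :=
    { carrier := {F | ∀ x, F (c * x) = ζ * F x}
      add_mem' := fun hF hF' x => by simp only [Pi.add_apply, hF x, hF' x, mul_add]
      zero_mem' := fun x => by simp
      smul_mem' := fun b F hF x => by
        simp only [Pi.smul_apply, hF x, smul_eq_mul]
        ring }
  apply_mem_toSubmodule g F hF x := by
    simp only [rightRep_apply, mul_assoc]
    exact hF _

lemma mem_eigSub {c : G} {ζ : ℂ} {F : G → ℂ} :
    F ∈ (eigSub c ζ).toSubmodule ↔ ∀ x, F (c * x) = ζ * F x := Iff.rfl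

lemma polySub_X_pow_sub_C (c : G) (m : ℕ) (ζ : ℂ) :
    polySub c (Polynomial.X ^ m - Polynomial.C ζ) = eigSub (c ^ m) ζ := by
  refine subrep_eq fun F => ?_
  change Polynomial.aeval (leftTrans c) (Polynomial.X ^ m - Polynomial.C ζ) F = 0 ↔ _
  rw [map_sub, map_pow, Polynomial.aeval_X, Polynomial.aeval_C, leftTrans_pow,
    LinearMap.sub_apply, sub_eq_zero, mem_eigSub, funext_iff]
  rfl

lemma polySub_X_sub_C (c : G) (ζ : ℂ) :
    polySub c (Polynomial.X - Polynomial.C ζ) = eigSub c ζ := by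
  simpa using polySub_X_pow_sub_C c 1 ζ

variable [Finite G]

lemma subClass_polySub_mul (c : G) {p q : Polynomial ℂ} (h : IsCoprime p q) :
    subClass (polySub c (p * q)) = subClass (polySub c p) + subClass (polySub c q) := by
  have h1 : polySub c (p * q) = polySub c p ⊔ polySub c q :=
    Subrepresentation.ext (Polynomial.sup_ker_aeval_eq_ker_aeval_mul_of_coprime _ h).symm
  rw [h1, subClass_sup_add_inf, subClass_eq_zero (polySub c p ⊓ polySub c q), zero_add]
  exact (Polynomial.disjoint_ker_aeval_of_isCoprime (leftTrans c) h).eq_bot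

lemma subClass_polySub_prod (c : G) {ι : Type} (s : Finset ι) (a : ι → ℂ)
    (ha : Set.InjOn a s) :
    subClass (polySub c (∏ i ∈ s, (Polynomial.X - Polynomial.C (a i)))) =
      ∑ i ∈ s, subClass (eigSub c (a i)) := by
  classical
  induction s using Finset.induction_on with
  | empty =>
    refine subClass_eq_zero _ ((Submodule.eq_bot_iff _).2 fun F hF => ?_)
    have : Polynomial.aeval (leftTrans c) (1 : Polynomial ℂ) F = 0 := hF
    simpa using this
  | insert i s hi ih =>
    rw [Finset.prod_insert hi, Finset.sum_insert hi, subClass_polySub_mul, polySub_X_sub_C,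
      ih (ha.mono (by simp))]
    refine IsCoprime.prod_right fun j hj => ?_
    refine Polynomial.isCoprime_X_sub_C_of_isUnit_sub (IsUnit.mk0 _ (sub_ne_zero.2 fun h => ?_))
    have := ha (by simp) (by simp [hj]) h
    exact hi (this ▸ hj)

/-- Induction in stages from `⟨c ^ m⟩` to `⟨c⟩`, for characters. -/
lemma subClass_eigSub_pow (c : G) {m : ℕ} (hm : 0 < m) {ω : ℂ} (hω : IsPrimitiveRoot ω m) {a : ℂ}
    (ha : a ≠ 0) :
    subClass (eigSub (c ^ m) (a ^ m)) = ∑ i ∈ Finset.range m, subClass (eigSub c (ω ^ i * a)) := by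
  rw [← polySub_X_pow_sub_C, X_pow_sub_C_eq_prod hω hm rfl, subClass_polySub_prod]
  intro i hi j hj h
  exact hω.injOn_pow (by simpa using hi) (by simpa using hj) (mul_right_cancel₀ ha h)

/-- The representation induced by a character, on functions on the group. -/
lemma repClass_indRep_charRep (H : Subgroup G) (χ : H →* ℂˣ) (P : Subrepresentation (rightRep G ℂ))
    (s : Set H) (hs : Subgroup.closure s = ⊤)
    (hP : ∀ F, F ∈ P.toSubmodule ↔ ∀ h ∈ s, ∀ x, F (h * x) = χ h * F x) :
    ind H (charClass χ) = subClass P := by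
  have hmem : ∀ F, F ∈ P.toSubmodule ↔ F ∈ Representation.coindV H.subtype (charRep χ) := by
    intro F
    rw [hP]
    constructor
    · intro hF h
      have hh : h ∈ Subgroup.closure s := hs ▸ Subgroup.mem_top h
      change ∀ x, F (h * x) = χ h * F x
      induction hh using Subgroup.closure_induction with
      | mem h hh => exact hF h hh
      | one => simp
      | mul g h _ _ hg hh =>
        intro x
        rw [Subgroup.coe_mul, mul_assoc, hg, hh, map_mul, Units.val_mul, mul_assoc]
      | inv h _ hh =>
        intro x
        have := hh ((h : G)⁻¹ * x)
        rw [mul_inv_cancel_left] at this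
        rw [this, map_inv, Subgroup.coe_inv, Units.inv_mul_cancel_left]
    · intro hF h _ x
      exact hF h x
  have h1 : ind H (charClass χ) = repClass (indRep H (charRep χ)) := by
    change FreeAbelianGroup.lift _ (FreeAbelianGroup.of _) = _
    rw [FreeAbelianGroup.lift_apply_of]
    rfl
  rw [h1]
  refine (repClass_congr P.toRepresentation _
    (LinearEquiv.ofEq _ _ (Submodule.ext hmem)) fun a x => rfl).symm

end Eigen

section EigenBasis

variable {Q : Type} [Group Q] [Finite Q] (φ : SL(2, ℤ) →* Q) {V : Type} [AddCommGroup V]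
  [Module ℂ V] [Module.Finite ℂ V] (ρ : Representation ℂ SL(2, ℤ) V)

/-- If `γ` is diagonalizable on `V`, the functions fixed by `γ` decompose accordingly. -/
lemma subClass_fixSub_eq_sum {m : ℕ} (b : Module.Basis (Fin m) ℂ V) (γ : SL(2, ℤ)) (ζ : Fin m → ℂ)
    (hb : ∀ j, ρ γ (b j) = ζ j • b j) :
    subClass (fixSub φ ρ γ) = ∑ j, subClass (eigSub (φ γ) (ζ j)) := by
  have hrepr : ∀ v j, b.repr (ρ γ v) j = ζ j * b.repr v j := by
    intro v j
    conv_lhs => rw [← b.sum_repr v]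
    simp only [map_sum, map_smul, hb, Finsupp.coe_finsetSum, Finset.sum_apply, Finsupp.smul_apply,
      Module.Basis.repr_self, smul_eq_mul, Finsupp.single_apply]
    simp [mul_comm]
  have hmem : ∀ F, F ∈ (fixSub φ ρ γ).toSubmodule ↔
      ∀ j, (fun x => b.repr (F x) j) ∈ (eigSub (φ γ) (ζ j)).toSubmodule := by
    intro F
    rw [mem_fixSub, leftRep_eq_self_iff]
    simp only [mem_eigSub, ← hrepr]
    constructor
    · intro h j x
      rw [h]
    · intro h x
      exact b.ext_elem fun j => h j x
  refine Eq.trans ?_ (repClass_piRep fun j => (eigSub (φ γ) (ζ j)).toRepresentation)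
  let e : (fixSub φ ρ γ).toSubmodule →ₗ[ℂ] ∀ j, (eigSub (φ γ) (ζ j)).toSubmodule :=
    { toFun := fun F j => ⟨fun x => b.repr (F.1 x) j, (hmem F.1).1 F.2 j⟩
      map_add' := fun F F' => by
        funext j
        apply Subtype.ext
        funext x
        simp
      map_smul' := fun c F => by
        funext j
        apply Subtype.ext
        funext x
        simp }
  refine repClass_congr (fixSub φ ρ γ).toRepresentation _ (LinearEquiv.ofBijective e ⟨?_, ?_⟩)
    fun a F => rfl
  · intro F F' h
    refine Subtype.ext (funext fun x => b.ext_elem fun j => ?_)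
    exact congrFun (congrArg Subtype.val (congrFun h j)) x
  · intro f
    have h : ∀ x j, b.repr (∑ i, (f i).1 x • b i) j = (f j).1 x := fun x j => by
      rw [b.repr_sum_self]
    refine ⟨⟨fun x => ∑ j, (f j).1 x • b j, (hmem _).2 fun j => ?_⟩, ?_⟩
    · simp only [h]
      exact (f j).2
    · funext j
      apply Subtype.ext
      funext x
      exact h x j

end EigenBasis

/-! ### The symmetric powers of the tautological representation -/

section SymmetricPower

open MvPolynomial (X C)

/-- The substitution `X_j ↦ ∑ i, M i j X_i` for a complex matrix `M`. -/
def linSubst (M : Matrix (Fin 2) (Fin 2) ℂ) : MvPolynomial (Fin 2) ℂ →ₐ[ℂ] MvPolynomial (Fin 2) ℂ :=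
  MvPolynomial.aeval fun j => ∑ i, C (M i j) * X i

lemma linSubst_X (M : Matrix (Fin 2) (Fin 2) ℂ) (j : Fin 2) :
    linSubst M (X j) = C (M 0 j) * X 0 + C (M 1 j) * X 1 := by
  simp [linSubst, Fin.sum_univ_two]

lemma linSubst_mul (M M' : Matrix (Fin 2) (Fin 2) ℂ) :
    linSubst (M * M') = (linSubst M).comp (linSubst M') := by
  refine MvPolynomial.algHom_ext fun j => ?_
  simp only [linSubst_X, AlgHom.comp_apply, map_add, map_mul, MvPolynomial.algHom_C,
    Matrix.mul_apply, Fin.sum_univ_two, MvPolynomial.algebraMap_eq]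
  ring

lemma linSubst_one : linSubst 1 = AlgHom.id ℂ _ := by
  refine MvPolynomial.algHom_ext fun j => ?_
  fin_cases j <;> simp [linSubst_X]

lemma linSubst_isHomogeneous (M : Matrix (Fin 2) (Fin 2) ℂ) {n : ℕ} {p : MvPolynomial (Fin 2) ℂ}
    (hp : p.IsHomogeneous n) : (linSubst M p).IsHomogeneous n := by
  have h : ∀ j, (∑ i, C (M i j) * X i : MvPolynomial (Fin 2) ℂ).IsHomogeneous 1 := fun j =>
    MvPolynomial.IsHomogeneous.sum _ _ _ fun i _ => MvPolynomial.isHomogeneous_C_mul_X _ i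
  have h2 := hp.aeval _ h
  rwa [one_mul] at h2

/-- The action of a complex matrix on a symmetric power. -/
def symMap (n : ℕ) (M : Matrix (Fin 2) (Fin 2) ℂ) : SymPow n →ₗ[ℂ] SymPow n :=
  (linSubst M).toLinearMap.restrict fun _ hp => linSubst_isHomogeneous M hp

lemma symMap_coe (n : ℕ) (M : Matrix (Fin 2) (Fin 2) ℂ) (p : SymPow n) :
    (symMap n M p : MvPolynomial (Fin 2) ℂ) = linSubst M p.1 := rfl

lemma symMap_mul_apply (n : ℕ) (M M' : Matrix (Fin 2) (Fin 2) ℂ) (p : SymPow n) :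
    symMap n (M * M') p = symMap n M (symMap n M' p) :=
  Subtype.ext (by rw [symMap_coe, linSubst_mul]; rfl)

lemma symMap_one_apply (n : ℕ) (p : SymPow n) : symMap n 1 p = p :=
  Subtype.ext (by rw [symMap_coe, linSubst_one]; rfl)

lemma symRep_eq_symMap (n : ℕ) (g : SL(2, ℤ)) :
    symRep n g = symMap n (g.val.map (Int.cast : ℤ → ℂ)) := rfl

/-- The monomial `X_0 ^ j X_1 ^ (n - j)`. -/
def symMono (n : ℕ) (j : Fin (n + 1)) : SymPow n :=
  ⟨X 0 ^ (j : ℕ) * X 1 ^ (n - j : ℕ), by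
    have h := ((MvPolynomial.isHomogeneous_X ℂ (0 : Fin 2)).pow j).mul
      ((MvPolynomial.isHomogeneous_X ℂ (1 : Fin 2)).pow (n - j))
    have e : 1 * (j : ℕ) + 1 * (n - j) = n := by omega
    rwa [e] at h⟩

lemma symMono_coe (n : ℕ) (j : Fin (n + 1)) :
    (symMono n j : MvPolynomial (Fin 2) ℂ) = X 0 ^ (j : ℕ) * X 1 ^ (n - j : ℕ) := rfl

lemma symMono_coe_eq_monomial (n : ℕ) (j : Fin (n + 1)) :
    (symMono n j : MvPolynomial (Fin 2) ℂ) =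
      MvPolynomial.monomial (Finsupp.single 0 (j : ℕ) + Finsupp.single 1 (n - j : ℕ)) 1 := by
  rw [symMono_coe, MvPolynomial.X_pow_eq_monomial, MvPolynomial.X_pow_eq_monomial,
    MvPolynomial.monomial_mul, one_mul]

lemma linearIndependent_symMono (n : ℕ) : LinearIndependent ℂ (symMono n) := by
  refine LinearIndependent.of_comp (Submodule.subtype _) ?_
  have h := (MvPolynomial.basisMonomials (Fin 2) ℂ).linearIndependent.comp
    (fun j : Fin (n + 1) => Finsupp.single 0 (j : ℕ) + Finsupp.single 1 (n - j : ℕ)) (by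
      intro i j hij
      have := DFunLike.congr_fun hij 0
      simpa [Fin.ext_iff] using this)
  have e : (Submodule.subtype _ ∘ symMono n : Fin (n + 1) → MvPolynomial (Fin 2) ℂ) = _ ∘ _ :=
    funext fun j => (symMono_coe_eq_monomial n j).trans
      (congrFun (MvPolynomial.coe_basisMonomials (Fin 2) ℂ) _).symm
  rw [← e] at h
  exact h

lemma span_symMono (n : ℕ) : ⊤ ≤ Submodule.span ℂ (Set.range (symMono n)) := by
  rintro ⟨p, hp⟩ -
  have hmem : p ∈ (Submodule.span ℂ (Set.range (symMono n))).map
      (MvPolynomial.homogeneousSubmodule (Fin 2) ℂ n).subtype := by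
    rw [p.as_sum]
    refine Submodule.sum_mem _ fun d hd => ?_
    have hdeg : d 0 + d 1 = n := by
      have : d.degree = n := by
        rw [Finsupp.degree_eq_weight_one]
        exact hp (MvPolynomial.mem_support_iff.1 hd)
      rwa [Finsupp.degree_eq_sum, Fin.sum_univ_two] at this
    refine ⟨MvPolynomial.coeff d p • symMono n ⟨d 0, by omega⟩,
      Submodule.smul_mem _ _ (Submodule.subset_span ⟨_, rfl⟩), ?_⟩
    rw [map_smul, Submodule.subtype_apply, symMono_coe_eq_monomial, MvPolynomial.smul_monomial,
      smul_eq_mul, mul_one]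
    have hd' : Finsupp.single 0 (d 0) + Finsupp.single 1 (n - d 0) = d := by
      ext i
      fin_cases i
      · simp
      · simp
        omega
    exact congrArg (fun d' => MvPolynomial.monomial d' (MvPolynomial.coeff d p)) hd'
  obtain ⟨q, hq, hqp⟩ := hmem
  rwa [show (⟨p, hp⟩ : SymPow n) = q from Subtype.ext hqp.symm]

/-- The basis of monomials. -/
def monoBasis (n : ℕ) : Module.Basis (Fin (n + 1)) ℂ (SymPow n) :=
  Module.Basis.mk (linearIndependent_symMono n) (span_symMono n)

lemma monoBasis_apply (n : ℕ) (j : Fin (n + 1)) : monoBasis n j = symMono n j :=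
  Module.Basis.mk_apply _ _ _

lemma symMap_diagonal_symMono (n : ℕ) (a b : ℂ) (j : Fin (n + 1)) :
    symMap n !![a, 0; 0, b] (symMono n j) = (a ^ (j : ℕ) * b ^ (n - j : ℕ)) • symMono n j := by
  apply Subtype.ext
  rw [symMap_coe, symMono_coe, map_mul, map_pow, map_pow, linSubst_X, linSubst_X]
  rw [Submodule.coe_smul, symMono_coe, MvPolynomial.smul_eq_C_mul]
  simp only [Matrix.of_apply, Matrix.cons_val', Matrix.cons_val_zero, Matrix.cons_val_one,
    Matrix.cons_val_fin_one, map_zero, zero_mul, add_zero, zero_add, mul_pow, map_mul, map_pow]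
  ring

/-- A diagonalization of `g` on `ℂ²` diagonalizes `g` on the symmetric powers. -/
lemma exists_eigenbasis (n : ℕ) (g : SL(2, ℤ)) (M : Matrix (Fin 2) (Fin 2) ℂ) (hM : IsUnit M.det)
    (a b : ℂ) (h : g.val.map (Int.cast : ℤ → ℂ) * M = M * !![a, 0; 0, b]) :
    ∃ B : Module.Basis (Fin (n + 1)) ℂ (SymPow n),
      ∀ j, symRep n g (B j) = (a ^ (j : ℕ) * b ^ (n - j : ℕ)) • B j := by
  let e : SymPow n ≃ₗ[ℂ] SymPow n := LinearEquiv.ofLinearMap (symMap n M) (symMap n M⁻¹)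
    (LinearMap.ext fun p => by
      rw [LinearMap.comp_apply, ← symMap_mul_apply, Matrix.mul_nonsing_inv M hM, symMap_one_apply]
      rfl)
    (LinearMap.ext fun p => by
      rw [LinearMap.comp_apply, ← symMap_mul_apply, Matrix.nonsing_inv_mul M hM, symMap_one_apply]
      rfl)
  refine ⟨(monoBasis n).map e, fun j => ?_⟩
  rw [Module.Basis.map_apply, monoBasis_apply]
  change symRep n g (symMap n M _) = _ • symMap n M _
  rw [symRep_eq_symMap, ← symMap_mul_apply, h, symMap_mul_apply, symMap_diagonal_symMono, map_smul]

lemma symRep_neg_one (n : ℕ) (p : SymPow n) : symRep n (-1) p = (-1 : ℂ) ^ n • p := by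
  have h : ((-1 : SL(2, ℤ)).val.map (Int.cast : ℤ → ℂ)) = !![-1, 0; 0, -1] := by
    ext i j
    fin_cases i <;> fin_cases j <;> simp
  have key : symRep n (-1) = (-1 : ℂ) ^ n • LinearMap.id := by
    refine (monoBasis n).ext fun j => ?_
    rw [monoBasis_apply, symRep_eq_symMap, h, symMap_diagonal_symMono, ← pow_add]
    have : (j : ℕ) + (n - j) = n := by omega
    rw [this]
    rfl
  rw [key]
  rfl

lemma symRep_zero_apply (g : SL(2, ℤ)) (p : SymPow 0) : symRep 0 g p = p := by
  have key : symRep 0 g = LinearMap.id := by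
    refine (monoBasis 0).ext fun j => ?_
    rw [monoBasis_apply, symRep_eq_symMap]
    apply Subtype.ext
    rw [symMap_coe, symMono_coe]
    simp [symMono_coe]
  rw [key]
  rfl

/-- The zeroth symmetric power is one-dimensional. -/
def symPowZeroEquiv : SymPow 0 ≃ₗ[ℂ] ℂ :=
  (monoBasis 0).equivFun ≪≫ₗ LinearEquiv.funUnique (Fin 1) ℂ ℂ

/-- Setting `X_0 = 1`. -/
def dehomogenize : MvPolynomial (Fin 2) ℂ →ₐ[ℂ] Polynomial ℂ :=
  MvPolynomial.aeval ![1, Polynomial.X]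

lemma dehomogenize_symMono (n : ℕ) (j : Fin (n + 1)) :
    dehomogenize (symMono n j).1 = Polynomial.X ^ (n - j : ℕ) := by
  simp [dehomogenize, symMono_coe]

lemma coeff_dehomogenize (n : ℕ) (p : SymPow n) (j : Fin (n + 1)) :
    (dehomogenize p.1).coeff (n - j) = (monoBasis n).repr p j := by
  conv_lhs => rw [← (monoBasis n).sum_repr p]
  simp only [monoBasis_apply, Submodule.coe_sum, Submodule.coe_smul, map_sum, map_smul,
    dehomogenize_symMono, Polynomial.finsetSum_coeff, Polynomial.coeff_smul, Polynomial.coeff_X_pow]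
  rw [Finset.sum_eq_single j]
  · simp
  · intro i _ hij
    rw [if_neg, smul_zero]
    have := Fin.val_ne_of_ne hij
    omega
  · simp

lemma transGen_pow_map (m : ℕ) :
    (transGen ^ m).val.map (Int.cast : ℤ → ℂ) = !![1, (m : ℂ); 0, 1] := by
  rw [transGen_pow_val]
  ext i j
  fin_cases i <;> fin_cases j <;> simp

lemma dehomogenize_symRep_transGen_pow (n m : ℕ) (p : SymPow n) :
    dehomogenize (symRep n (transGen ^ m) p).1 =
      (dehomogenize p.1).comp (Polynomial.X + Polynomial.C (m : ℂ)) := by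
  rw [symRep_eq_symMap, symMap_coe, transGen_pow_map]
  have : dehomogenize.comp (linSubst !![1, (m : ℂ); 0, 1]) =
      (Polynomial.aeval (Polynomial.X + Polynomial.C (m : ℂ))).comp dehomogenize := by
    refine MvPolynomial.algHom_ext fun j => ?_
    rw [AlgHom.comp_apply, linSubst_X]
    fin_cases j <;> simp [dehomogenize, add_comm, MvPolynomial.aeval_def]
  exact DFunLike.congr_fun this p.1

/-- The vectors fixed by a nontrivial translation are the multiples of `X_0 ^ n`: after setting
`X_0 = 1` they are periodic polynomials. -/
lemma eq_smul_of_transGen_pow_fixed {n m : ℕ} (hm : m ≠ 0) {p : SymPow n}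
    (hp : symRep n (transGen ^ m) p = p) : ∃ c : ℂ, p = c • symMono n (Fin.last n) := by
  set q := dehomogenize p.1 with hq
  have hper : q.comp (Polynomial.X + Polynomial.C (m : ℂ)) = q := by
    rw [hq, ← dehomogenize_symRep_transGen_pow, hp]
  have heval : ∀ k : ℕ, q.eval ((m : ℂ) * k) = q.eval 0 := by
    intro k
    induction k with
    | zero => simp
    | succ k ih =>
      rw [← ih]
      conv_rhs => rw [← hper]
      simp [mul_add]
  have hconst : q = Polynomial.C (q.eval 0) := by
    refine Polynomial.eq_of_infinite_eval_eq _ _ (Set.infinite_of_injective_forall_mem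
      (f := fun k : ℕ => (m : ℂ) * k) ?_ ?_)
    · intro i j hij
      have := mul_left_cancel₀ (Nat.cast_ne_zero.2 hm) hij
      exact_mod_cast this
    · intro k
      simp [heval k]
  refine ⟨(monoBasis n).repr p (Fin.last n), (monoBasis n).ext_elem fun j => ?_⟩
  rw [map_smul, ← monoBasis_apply, Module.Basis.repr_self]
  by_cases h : j = Fin.last n
  · simp [h]
  · rw [← coeff_dehomogenize, ← hq, hconst, Polynomial.coeff_C_of_ne_zero]
    · simp [Ne.symm h]
    · have := Fin.val_lt_last h
      omega

lemma symRep_transGen_last (n m : ℕ) :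
    symRep n (transGen ^ m) (symMono n (Fin.last n)) = symMono n (Fin.last n) := by
  apply Subtype.ext
  rw [symRep_eq_symMap, symMap_coe, transGen_pow_map, symMono_coe]
  simp [linSubst_X]

lemma symRep_iGen_last (n : ℕ) :
    symRep n iGen (symMono n (Fin.last n)) = symMono n 0 := by
  apply Subtype.ext
  rw [symRep_eq_symMap, symMap_coe, symMono_coe, symMono_coe]
  simp [linSubst_X, iGen]

variable {N : ℕ}

lemma transGen_pow_mem : transGen ^ N ∈ CongruenceSubgroup.Gamma N := by
  change reduction N (transGen ^ N) = 1
  ext i j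
  change (((transGen ^ N).val i j : ℤ) : ZMod N) = _
  rw [transGen_pow_val]
  fin_cases i <;> fin_cases j <;> simp

variable [NeZero N]

lemma symRep_invariants {n : ℕ} (hn : n ≠ 0) (v : SymPow n)
    (hv : ∀ γ : CongruenceSubgroup.Gamma N, symRep n γ v = v) : v = 0 := by
  obtain ⟨c, hc⟩ := eq_smul_of_transGen_pow_fixed (NeZero.ne N) (hv ⟨_, transGen_pow_mem⟩)
  -- The vector `iGen⁻¹ v` is fixed as well, so `v` is also a multiple of `X_1 ^ n`.
  have h2 : symRep n (transGen ^ N) (symRep n iGen⁻¹ v) = symRep n iGen⁻¹ v := by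
    have := hv (conjGamma N iGen⁻¹ ⟨_, transGen_pow_mem⟩)
    have h3 := rho_conj N (symRep n) iGen⁻¹ ⟨_, transGen_pow_mem⟩ v
    rw [this] at h3
    exact h3.symm
  obtain ⟨d, hd⟩ := eq_smul_of_transGen_pow_fixed (NeZero.ne N) h2
  have h4 : v = d • symMono n 0 := by
    rw [← symRep_iGen_last, ← map_smul, ← hd, ← Module.End.mul_apply, ← map_mul, mul_inv_cancel,
      map_one, Module.End.one_apply]
  have h5 := congrArg (fun w => (monoBasis n).repr w 0) (hc.symm.trans h4)
  simp only [← monoBasis_apply, map_smul, Module.Basis.repr_self, Finsupp.smul_single] at h5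
  have h6 : Fin.last n ≠ 0 := by
    rw [Ne, Fin.ext_iff]
    simpa using hn
  rw [Finsupp.single_eq_of_ne h6.symm, Finsupp.single_eq_same] at h5
  rw [h4, ← mul_one d, ← smul_eq_mul, ← h5, zero_smul]

/-- The value at `(0, 1)`, which is the coefficient of `X_1 ^ n`. -/
def evalZeroOne (n : ℕ) : Module.Dual ℂ (SymPow n) :=
  (MvPolynomial.aeval (![0, 1] : Fin 2 → ℂ)).toLinearMap ∘ₗ Submodule.subtype _

lemma evalZeroOne_symMono (n : ℕ) (j : Fin (n + 1)) :
    evalZeroOne n (symMono n j) = if j = 0 then 1 else 0 := by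
  simp [evalZeroOne, symMono_coe, zero_pow_eq]

lemma evalZeroOne_transGen_pow (n m : ℕ) (p : SymPow n) :
    evalZeroOne n (symRep n (transGen ^ m) p) = evalZeroOne n p := by
  have : (MvPolynomial.aeval (![0, 1] : Fin 2 → ℂ)).comp (linSubst !![1, (m : ℂ); 0, 1]) =
      MvPolynomial.aeval (![0, 1] : Fin 2 → ℂ) := by
    refine MvPolynomial.algHom_ext fun j => ?_
    rw [AlgHom.comp_apply, linSubst_X]
    fin_cases j <;> simp [MvPolynomial.aeval_def]
  rw [symRep_eq_symMap, transGen_pow_map]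
  exact DFunLike.congr_fun this p.1

/-- By a dimension count, a nontrivial translation minus the identity maps onto the polynomials
without the monomial `X_1 ^ n`. -/
lemma range_transGen_pow_sub_one {m : ℕ} (hm : m ≠ 0) (n : ℕ) :
    LinearMap.range (symRep n (transGen ^ m) - 1) = LinearMap.ker (evalZeroOne n) := by
  have hdim : Module.finrank ℂ (SymPow n) = n + 1 := by
    rw [Module.finrank_eq_card_basis (monoBasis n), Fintype.card_fin]
  refine Submodule.eq_of_le_of_finrank_le ?_ ?_
  · rintro _ ⟨p, rfl⟩
    rw [LinearMap.mem_ker, LinearMap.sub_apply, map_sub, evalZeroOne_transGen_pow,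
      Module.End.one_apply, sub_self]
  · have h1 := LinearMap.finrank_range_add_finrank_ker (symRep n (transGen ^ m) - 1)
    have h2 := LinearMap.finrank_range_add_finrank_ker (evalZeroOne n)
    have h3 : LinearMap.ker (symRep n (transGen ^ m) - 1) ≤
        Submodule.span ℂ {symMono n (Fin.last n)} := by
      intro p hp
      rw [LinearMap.mem_ker, LinearMap.sub_apply, Module.End.one_apply, sub_eq_zero] at hp
      obtain ⟨c, rfl⟩ := eq_smul_of_transGen_pow_fixed hm hp
      exact Submodule.smul_mem _ _ (Submodule.mem_span_singleton_self _)
    have h4 := (Submodule.finrank_mono h3).trans (finrank_span_le_card _)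
    have h5 : LinearMap.range (evalZeroOne n) = ⊤ := by
      rw [LinearMap.range_eq_top]
      intro c
      exact ⟨c • symMono n 0, by rw [map_smul, evalZeroOne_symMono, if_pos rfl, smul_eq_mul, mul_one]⟩
    rw [Set.toFinset_singleton, Finset.card_singleton] at h4
    rw [h5, finrank_top, Module.finrank_self] at h2
    omega

lemma symRep_dual_invariants {n : ℕ} (hn : n ≠ 0) (l : Module.Dual ℂ (SymPow n))
    (hl : ∀ γ : CongruenceSubgroup.Gamma N, ∀ v, l (symRep n γ v) = l v) : l = 0 := by
  have key : ∀ l : Module.Dual ℂ (SymPow n),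
      (∀ γ : CongruenceSubgroup.Gamma N, ∀ v, l (symRep n γ v) = l v) →
      ∀ v, evalZeroOne n v = 0 → l v = 0 := by
    intro l hl v hv
    rw [← LinearMap.mem_ker, ← range_transGen_pow_sub_one (NeZero.ne N)] at hv
    obtain ⟨w, rfl⟩ := hv
    rw [LinearMap.sub_apply, map_sub, Module.End.one_apply, sub_eq_zero]
    exact hl ⟨_, transGen_pow_mem⟩ w
  refine (monoBasis n).ext fun j => ?_
  rw [monoBasis_apply, LinearMap.zero_apply]
  by_cases hj : j = 0
  · have h6 : Fin.last n ≠ 0 := by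
      rw [Ne, Fin.ext_iff]
      simpa using hn
    -- The functional `l ∘ iGen` is invariant too, and `iGen X_0 ^ n = X_1 ^ n`.
    have := key (l ∘ₗ symRep n iGen) (by
      intro γ v
      obtain ⟨δ, rfl⟩ : ∃ δ, γ = conjGamma N iGen δ := by
        refine ⟨conjGamma N iGen⁻¹ γ, Subtype.ext ?_⟩
        simp only [conjGamma]
        group
      rw [LinearMap.comp_apply, rho_conj, hl, LinearMap.comp_apply]) (symMono n (Fin.last n))
      (by rw [evalZeroOne_symMono, if_neg h6])
    rw [LinearMap.comp_apply, symRep_iGen_last] at this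
    rw [hj, this]
  · exact key l hl _ (by rw [evalZeroOne_symMono, if_neg hj])

end SymmetricPower

/-! ### Induced characters of the stabilizers -/

section Stabilizers

variable {N : ℕ}

lemma closure_image_eq_top {H : Subgroup SL(2, ℤ)} {s : Set SL(2, ℤ)}
    (hs : Subgroup.closure s = H) :
    Subgroup.closure {h : image N H | ∃ γ ∈ s, reduction N γ = h} = ⊤ := by
  subst hs
  rw [eq_top_iff]
  rintro ⟨_, γ, hγ, rfl⟩ -
  induction hγ using Subgroup.closure_induction with
  | mem x hx => exact Subgroup.subset_closure ⟨x, hx, rfl⟩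
  | one =>
    have h : (⟨_, 1, one_mem _, rfl⟩ : image N (Subgroup.closure s)) = 1 :=
      Subtype.ext (map_one (reduction N))
    rw [h]
    exact one_mem _
  | mul x y hx hy ihx ihy =>
    have h : (⟨_, x * y, mul_mem hx hy, rfl⟩ : image N (Subgroup.closure s)) =
        ⟨_, x, hx, rfl⟩ * ⟨_, y, hy, rfl⟩ := Subtype.ext (map_mul (reduction N) x y)
    rw [h]
    exact mul_mem ihx ihy
  | inv x hx ihx =>
    have h : (⟨_, x⁻¹, inv_mem hx, rfl⟩ : image N (Subgroup.closure s)) = ⟨_, x, hx, rfl⟩⁻¹ :=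
      Subtype.ext (map_inv (reduction N) x)
    rw [h]
    exact inv_mem ihx

variable [NeZero N]

/-- A character of the image of `H` in `SL(2, ℤ/Nℤ)` induces the space of functions with the
transformation law prescribed for generators of `H`. -/
lemma ind_charClass_eq_subClass {H : Subgroup SL(2, ℤ)} {s : Set SL(2, ℤ)}
    (hs : Subgroup.closure s = H) (χ : image N H →* ℂˣ)
    (P : Subrepresentation (rightRep SL(2, ZMod N) ℂ)) (ζ : SL(2, ℤ) → ℂ)
    (hζ : ∀ γ ∈ s, ∀ h : reduction N γ ∈ image N H, (χ ⟨_, h⟩ : ℂ) = ζ γ)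
    (hP : ∀ F, F ∈ P.toSubmodule ↔ ∀ γ ∈ s, ∀ x, F (reduction N γ * x) = ζ γ * F x) :
    ind (image N H) (charClass χ) = subClass P := by
  refine repClass_indRep_charRep _ χ P _ (closure_image_eq_top hs) fun F => ?_
  rw [hP]
  constructor
  · rintro h ⟨_, hx⟩ ⟨γ, hγ, rfl⟩ x
    rw [hζ γ hγ]
    exact h γ hγ x
  · intro h γ hγ x
    have hmem : reduction N γ ∈ image N H :=
      Subgroup.mem_map_of_mem _ (hs ▸ Subgroup.subset_closure hγ)
    rw [← hζ γ hγ hmem]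
    exact h ⟨_, hmem⟩ ⟨γ, hγ, rfl⟩ x

lemma ind_charClass_eq_eigSub {H : Subgroup SL(2, ℤ)} {g : SL(2, ℤ)}
    (hg : Subgroup.closure {g} = H) (χ : image N H →* ℂˣ) {ζ : ℂ}
    (hζ : ∀ h : reduction N g ∈ image N H, (χ ⟨_, h⟩ : ℂ) = ζ) :
    ind (image N H) (charClass χ) = subClass (eigSub (reduction N g) ζ) :=
  ind_charClass_eq_subClass hg χ _ (fun _ => ζ) (by rintro _ rfl; exact hζ)
    fun F => by simp [mem_eigSub]

lemma closure_neg_one : Subgroup.closure {(-1 : SL(2, ℤ))} = Zcenter := by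
  refine le_antisymm ?_ fun γ hγ => ?_
  · rw [Subgroup.closure_le]
    rintro _ rfl
    exact Subgroup.mem_center_iff.2 fun g => by rw [mul_neg_one, neg_one_mul]
  · have h0 := Zcenter_upper γ hγ
    have hc := Subgroup.mem_center_iff.1 hγ iGen
    have h1 : γ 0 1 = 0 := by
      have h := congrArg (fun A : SL(2, ℤ) => A 1 1) hc
      change (iGen * γ) 1 1 = (γ * iGen) 1 1 at h
      rw [(iGen_mul_apply γ 1).2] at h
      simp only [Matrix.SpecialLinearGroup.coe_mul, Matrix.mul_apply, Fin.sum_univ_two] at h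
      simpa [iGen, h0] using h
    rcases Int.mul_eq_one_iff_eq_one_or_neg_one.1 (upper_diag γ h0) with ⟨h2, h3⟩ | ⟨h2, h3⟩
    · have : γ = 1 := by
        ext i j
        fin_cases i <;> fin_cases j <;> simp [h0, h1, h2, h3]
      rw [this]
      exact one_mem _
    · have : γ = -1 := by
        ext i j
        fin_cases i <;> fin_cases j <;> simp [h0, h1, h2, h3]
      rw [this]
      exact Subgroup.subset_closure rfl

lemma closure_transGen_neg_one : Subgroup.closure {transGen, (-1 : SL(2, ℤ))} = GammaInf := by
  have h1 : transGen ∈ GammaInf := Subgroup.subset_closure (by simp)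
  have h2 : -transGen ∈ GammaInf := Subgroup.subset_closure (by simp)
  refine le_antisymm ?_ fun γ hγ => mem_closure_of_upper (GammaInf_upper γ hγ)
  rw [Subgroup.closure_le]
  rintro _ (rfl | rfl)
  · exact h1
  · have : (-1 : SL(2, ℤ)) = -transGen * transGen⁻¹ := by
      rw [neg_mul, mul_inv_cancel]
    rw [this]
    exact mul_mem h2 (inv_mem h1)

end Stabilizers

section Characters

variable (N : ℕ) [Fact (2 < N)]

lemma sgnZBar_neg_one (h : reduction N (-1) ∈ image N Zcenter) :
    (sgnZBar N ⟨_, h⟩ : ℂ) = -1 := by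
  have hm : (-1 : SL(2, ℤ)) ∈ Zcenter := closure_neg_one ▸ Subgroup.subset_closure rfl
  have := descend_apply N Zcenter sgnZ (sgnChar_descends N Zcenter Zcenter_upper) ⟨-1, hm⟩
  rw [sgnZBar, this]
  change (((-1 : SL(2, ℤ)) 0 0 : ℤ) : ℂ) = -1
  simp

lemma sgnInfBar_apply {γ : SL(2, ℤ)} (hγ : γ ∈ GammaInf) (h : reduction N γ ∈ image N GammaInf) :
    (sgnInfBar N ⟨_, h⟩ : ℂ) = (γ 0 0 : ℤ) := by
  have := descend_apply N GammaInf sgnInf (sgnChar_descends N GammaInf GammaInf_upper) ⟨γ, hγ⟩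
  rw [sgnInfBar, this]
  rfl

lemma chiRhoBar_gen (h : reduction N rhoGen ∈ image N GammaRho) :
    (chiRhoBar N ⟨_, h⟩ : ℂ) = Complex.exp (2 * Real.pi * Complex.I / 6) := by
  rw [← chiRho_gen]
  exact congrArg Units.val (descend_apply N GammaRho chiRho (chiRho_descends N)
    ⟨rhoGen, Subgroup.mem_zpowers rhoGen⟩)

lemma chiIBar_gen (h : reduction N iGen ∈ image N GammaI) :
    (chiIBar N ⟨_, h⟩ : ℂ) = -Complex.I := by
  have h1 := congrArg Units.val (descend_apply N GammaI chiI (chiI_descends N)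
    ⟨iGen, Subgroup.mem_zpowers iGen⟩)
  refine h1.trans ?_
  have h2 : (⟨iGen, Subgroup.mem_zpowers iGen⟩ : GammaI) =
      (⟨iGen⁻¹, inv_mem (Subgroup.mem_zpowers iGen)⟩ : GammaI)⁻¹ := Subtype.ext (inv_inv _).symm
  rw [h2, map_inv, chiI, monoidHomOfForallMemZpowers_apply_gen]
  simp

/-- The class induced by a power of `sgn` on the center. -/
lemma ind_sgnZBar_pow (k : ℕ) : ind (image N Zcenter) (charClass (sgnZBar N ^ k)) =
    subClass (eigSub (reduction N (-1)) ((-1 : ℂ) ^ k)) :=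
  ind_charClass_eq_eigSub closure_neg_one _ fun h => by
    rw [MonoidHom.pow_apply, Units.val_pow_eq_pow_val, sgnZBar_neg_one]

lemma ind_chiRhoBar_pow (k : ℕ) : ind (image N GammaRho) (charClass (chiRhoBar N ^ k)) =
    subClass (eigSub (reduction N rhoGen) (Complex.exp (2 * Real.pi * Complex.I / 6) ^ k)) :=
  ind_charClass_eq_eigSub (Subgroup.zpowers_eq_closure _).symm _ fun h => by
    rw [MonoidHom.pow_apply, Units.val_pow_eq_pow_val, chiRhoBar_gen]

lemma ind_chiIBar_pow (k : ℕ) : ind (image N GammaI) (charClass (chiIBar N ^ k)) =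
    subClass (eigSub (reduction N iGen) ((-Complex.I) ^ k)) :=
  ind_charClass_eq_eigSub (Subgroup.zpowers_eq_closure _).symm _ fun h => by
    rw [MonoidHom.pow_apply, Units.val_pow_eq_pow_val, chiIBar_gen]

lemma ind_sgnInfBar_pow (k : ℕ) : ind (image N GammaInf) (charClass (sgnInfBar N ^ k)) =
    subClass (eigSub (reduction N (-1)) ((-1 : ℂ) ^ k) ⊓ eigSub (reduction N transGen) 1) := by
  have hm : ∀ γ ∈ ({transGen, -1} : Set SL(2, ℤ)), γ ∈ GammaInf := fun γ hγ =>
    closure_transGen_neg_one ▸ Subgroup.subset_closure hγ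
  refine ind_charClass_eq_subClass closure_transGen_neg_one _ _ (fun γ => ((γ 0 0 : ℤ) : ℂ) ^ k)
    (fun γ hγ h => ?_) fun F => ?_
  · rw [MonoidHom.pow_apply, Units.val_pow_eq_pow_val, sgnInfBar_apply N (hm γ hγ)]
  · rw [Subrepresentation.toSubmodule_inf, Submodule.mem_inf, mem_eigSub, mem_eigSub, and_comm]
    have h1 : transGen 0 0 = 1 := rfl
    have h2 : (-1 : SL(2, ℤ)) 0 0 = -1 := rfl
    constructor
    · rintro ⟨hT, hZ⟩ γ (rfl | rfl) x
      · rw [hT, h1, Int.cast_one, one_pow]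
      · rw [hZ, h2, Int.cast_neg, Int.cast_one]
    · intro h
      refine ⟨fun x => ?_, fun x => ?_⟩
      · rw [h transGen (by simp), h1, Int.cast_one, one_pow]
      · rw [h (-1) (by simp), h2, Int.cast_neg, Int.cast_one]

end Characters

/-! ### The classes of the functions fixed by the stabilizers -/

section FixedClasses

variable (N : ℕ) [NeZero N] (n : ℕ)

lemma subClass_fixSub_neg_one : subClass (fixSub (reduction N) (symRep n) (-1)) =
    (n + 1) • subClass (eigSub (reduction N (-1)) ((-1 : ℂ) ^ n)) := by
  rw [subClass_fixSub_eq_sum (reduction N) (symRep n) (monoBasis n) (-1) (fun _ => (-1) ^ n)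
    fun j => symRep_neg_one n _]
  simp

/-- The contribution of an elliptic point: if `g` has eigenvalues `ζ` and `ζ⁻¹` on `ℂ²`, then on
the symmetric power it has eigenvalues `ζ ^ (2 j - n)`. -/
lemma subClass_fixSub_eq_sum_range (g : SL(2, ℤ)) {ζ : ℂ} (hζ : ζ ≠ 0)
    (M : Matrix (Fin 2) (Fin 2) ℂ) (hM : IsUnit M.det)
    (h : g.val.map (Int.cast : ℤ → ℂ) * M = M * !![ζ, 0; 0, ζ⁻¹]) :
    subClass (fixSub (reduction N) (symRep n) g) =
      ∑ j ∈ Finset.range (n + 1), subClass (eigSub (reduction N g) ((ζ ^ 2) ^ j * ζ⁻¹ ^ n)) := by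
  obtain ⟨B, hB⟩ := exists_eigenbasis n g M hM ζ ζ⁻¹ h
  rw [subClass_fixSub_eq_sum (reduction N) (symRep n) B g _ hB, Finset.sum_range]
  refine Finset.sum_congr rfl fun j _ => ?_
  congr 2
  obtain ⟨i, hi⟩ : ∃ i, n - j = i := ⟨_, rfl⟩
  have hn : n = j + i := by omega
  rw [hi]
  generalize (j : ℕ) = l at hn
  rw [hn, pow_add, ← pow_mul, two_mul, pow_add]
  simp only [inv_pow]
  field_simp

omit [NeZero N] in
lemma sum_range_periodic {A : Type*} [AddCommGroup A] {m : ℕ} (e : ℕ → A)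
    (he : ∀ j, e (m + j) = e j) (q r : ℕ) :
    ∑ j ∈ Finset.range (m * q + r), e j =
      q • ∑ j ∈ Finset.range m, e j + ∑ j ∈ Finset.range r, e j := by
  induction q with
  | zero => simp
  | succ q ih =>
    rw [show m * (q + 1) + r = m + (m * q + r) by ring, Finset.sum_range_add]
    simp only [he]
    rw [ih, succ_nsmul']
    abel

/-- The functions fixed by the stabilizer of the cusp take values in the line spanned by
`X_0 ^ n`. -/
lemma subClass_fixSub_cusp :
    subClass (fixSub (reduction N) (symRep n) (-1) ⊓ fixSub (reduction N) (symRep n) transGen) =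
      subClass (eigSub (reduction N (-1)) ((-1 : ℂ) ^ n) ⊓ eigSub (reduction N transGen) 1) := by
  set v := symMono n (Fin.last n) with hv
  have hT : symRep n transGen v = v := by simpa using symRep_transGen_last n 1
  have hv0 : v ≠ 0 := by
    rw [hv, ← monoBasis_apply]
    exact (monoBasis n).ne_zero _
  let f : (eigSub (reduction N (-1)) ((-1 : ℂ) ^ n) ⊓ eigSub (reduction N transGen) 1).toSubmodule
      →ₗ[ℂ] (fixSub (reduction N) (symRep n) (-1) ⊓
        fixSub (reduction N) (symRep n) transGen).toSubmodule :=
    { toFun := fun F => ⟨fun x => F.1 x • v, by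
        obtain ⟨F, hF⟩ := F
        rw [Subrepresentation.toSubmodule_inf, Submodule.mem_inf, mem_eigSub, mem_eigSub] at hF
        rw [Subrepresentation.toSubmodule_inf, Submodule.mem_inf, mem_fixSub, mem_fixSub,
          leftRep_eq_self_iff, leftRep_eq_self_iff]
        refine ⟨fun x => ?_, fun x => ?_⟩
        · simp only [hF.1, symRep_neg_one, smul_smul]
        · simp only [hF.2, map_smul, hT, one_mul]⟩
      map_add' := fun F F' => Subtype.ext (funext fun x => add_smul _ _ _)
      map_smul' := fun c F => Subtype.ext (funext fun x => mul_smul _ _ _) }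
  refine (repClass_congr _ _ (LinearEquiv.ofBijective f ⟨fun F F' h => ?_, ?_⟩) fun a F => rfl).symm
  · refine Subtype.ext (funext fun x => smul_left_injective ℂ hv0 ?_)
    exact congrFun (congrArg Subtype.val h) x
  · rintro ⟨F, hF⟩
    rw [Subrepresentation.toSubmodule_inf, Submodule.mem_inf, mem_fixSub, mem_fixSub] at hF
    have hN : leftRep (reduction N) (symRep n) (transGen ^ N) F = F := by
      have : ∀ m : ℕ, leftRep (reduction N) (symRep n) (transGen ^ m) F = F := by
        intro m
        induction m with
        | zero => simp
        | succ m ih => rw [pow_succ, map_mul, Module.End.mul_apply, hF.2, ih]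
      exact this N
    rw [leftRep_eq_self_iff] at hN
    have hred : reduction N (transGen ^ N) = 1 := transGen_pow_mem
    choose c hc using fun x => eq_smul_of_transGen_pow_fixed (NeZero.ne N)
      (p := F x) (by rw [← hN x, hred, one_mul])
    refine ⟨⟨c, ?_⟩, Subtype.ext (funext fun x => (hc x).symm)⟩
    rw [leftRep_eq_self_iff, leftRep_eq_self_iff] at hF
    rw [Subrepresentation.toSubmodule_inf, Submodule.mem_inf, mem_eigSub, mem_eigSub]
    refine ⟨fun x => smul_left_injective ℂ hv0 ?_, fun x => smul_left_injective ℂ hv0 ?_⟩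
    · have := hF.1 x
      rw [symRep_neg_one, hc, hc x, smul_smul] at this
      exact this
    · have := hF.2 x
      rw [hc, hc x, map_smul] at this
      simpa only [one_mul, ← hv, hT] using this

end FixedClasses

/-! ### The elliptic contributions -/

section Elliptic

/-- The eigenvalue `e^{2πi/6}` of `rhoGen`. -/
def zetaSix : ℂ := Complex.exp (2 * Real.pi * Complex.I / 6)

lemma isPrimitiveRoot_zetaSix : IsPrimitiveRoot zetaSix 6 := by
  simpa [zetaSix] using Complex.isPrimitiveRoot_exp 6 (by norm_num)

lemma zetaSix_ne_zero : zetaSix ≠ 0 := Complex.exp_ne_zero _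

lemma zetaSix_pow_three : zetaSix ^ 3 = -1 :=
  (isPrimitiveRoot_zetaSix.pow (n := 6) (by norm_num)
    (show 6 = 3 * 2 by norm_num)).eq_neg_one_of_two_right

lemma isPrimitiveRoot_zetaSix_sq : IsPrimitiveRoot (zetaSix ^ 2) 3 :=
  isPrimitiveRoot_zetaSix.pow (by norm_num) (by norm_num)

lemma zetaSix_sq : zetaSix ^ 2 = zetaSix - 1 := by
  have h1 : zetaSix ≠ -1 := by
    intro h
    have := isPrimitiveRoot_zetaSix.pow_ne_one_of_pos_of_lt (l := 2) (by norm_num) (by norm_num)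
    rw [h] at this
    norm_num at this
  have h2 : (zetaSix + 1) * (zetaSix ^ 2 - zetaSix + 1) = 0 := by
    linear_combination zetaSix_pow_three
  have h3 := (mul_eq_zero.1 h2).resolve_left fun h => h1 (eq_neg_of_add_eq_zero_left h)
  linear_combination h3

lemma zetaSix_inv : zetaSix⁻¹ = 1 - zetaSix := by
  rw [inv_eq_iff_eq_inv, eq_comm, inv_eq_iff_eq_inv, eq_comm]
  refine inv_eq_of_mul_eq_one_right ?_
  linear_combination -zetaSix_sq

lemma isPrimitiveRoot_neg_I : IsPrimitiveRoot (-Complex.I) 4 := by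
  refine IsPrimitiveRoot.mk_of_lt _ (by norm_num) (by rw [neg_pow, Complex.I_pow_four]; norm_num)
    fun l h0 h4 => ?_
  interval_cases l <;> norm_num [Complex.ext_iff, pow_succ]

variable (N : ℕ) [NeZero N] (n : ℕ)

lemma subClass_fixSub_rhoGen_eq_sum : subClass (fixSub (reduction N) (symRep n) rhoGen) =
    ∑ j ∈ Finset.range (n + 1),
      subClass (eigSub (reduction N rhoGen) ((zetaSix ^ 2) ^ j * zetaSix⁻¹ ^ n)) := by
  refine subClass_fixSub_eq_sum_range N n rhoGen zetaSix_ne_zero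
    !![1, 1; -zetaSix, -zetaSix⁻¹] ?_ ?_
  · rw [Matrix.det_fin_two_of, zetaSix_inv, isUnit_iff_ne_zero]
    intro h
    -- The determinant squares to `-3`.
    have h1 : (1 * -(1 - zetaSix) - 1 * -zetaSix) ^ 2 = -3 := by
      linear_combination 4 * zetaSix_sq
    rw [h] at h1
    norm_num at h1
  · have hs := zetaSix_sq
    rw [zetaSix_inv]
    ext i j
    fin_cases i <;> fin_cases j <;> simp [rhoGen, Matrix.mul_apply, Fin.sum_univ_two] <;>
      linear_combination hs

lemma subClass_fixSub_iGen_eq_sum : subClass (fixSub (reduction N) (symRep n) iGen) =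
    ∑ j ∈ Finset.range (n + 1),
      subClass (eigSub (reduction N iGen) (((-Complex.I) ^ 2) ^ j * (-Complex.I)⁻¹ ^ n)) := by
  have hI := Complex.I_mul_I
  have hinv : (-Complex.I)⁻¹ = Complex.I := by rw [inv_neg, Complex.inv_I, neg_neg]
  refine subClass_fixSub_eq_sum_range N n iGen (neg_ne_zero.2 Complex.I_ne_zero)
    !![1, 1; Complex.I, -Complex.I] ?_ ?_
  · rw [Matrix.det_fin_two_of, isUnit_iff_ne_zero]
    simp [Complex.ext_iff]
    norm_num
  · rw [hinv]
    ext i j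
    fin_cases i <;> fin_cases j <;> simp [iGen, Matrix.mul_apply, Fin.sum_univ_two]

lemma sum_eigSub_rhoGen :
    ∑ j ∈ Finset.range 3,
      subClass (eigSub (reduction N rhoGen) ((zetaSix ^ 2) ^ j * zetaSix⁻¹ ^ n)) =
    subClass (eigSub (reduction N (-1)) ((-1 : ℂ) ^ n)) := by
  rw [← subClass_eigSub_pow _ (by norm_num) isPrimitiveRoot_zetaSix_sq
    (pow_ne_zero _ (inv_ne_zero zetaSix_ne_zero)), ← map_pow, ← pow_mul, mul_comm n, pow_mul,
    inv_pow, zetaSix_pow_three]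
  have h : rhoGen ^ 3 = -1 := by decide
  rw [h]
  norm_num

lemma sum_eigSub_iGen :
    ∑ j ∈ Finset.range 2,
      subClass (eigSub (reduction N iGen) (((-Complex.I) ^ 2) ^ j * (-Complex.I)⁻¹ ^ n)) =
    subClass (eigSub (reduction N (-1)) ((-1 : ℂ) ^ n)) := by
  rw [← subClass_eigSub_pow _ (by norm_num) (isPrimitiveRoot_neg_I.pow (by norm_num) (by norm_num))
    (pow_ne_zero _ (inv_ne_zero (neg_ne_zero.2 Complex.I_ne_zero))), ← map_pow, ← pow_mul,
    mul_comm n, pow_mul]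
  have h : iGen ^ 2 = -1 := by decide
  rw [h]
  norm_num

end Elliptic

section Epsilon

variable (N : ℕ) [Fact (2 < N)]

/-- The fixed functions of the stabilizer of `ρ` in terms of `ε_ρ`: the eigenvalues of `rhoGen` on
the symmetric power run through the cosets of the cube roots of unity, and `ε_ρ` accounts for the
incomplete last round. -/
lemma subClass_fixSub_rhoGen (n : ℕ) : subClass (fixSub (reduction N) (symRep n) rhoGen) =
    ((n + 2) / 3) • subClass (eigSub (reduction N (-1)) ((-1 : ℂ) ^ n)) +
      ind (image N GammaRho) (epsRho N (n + 2)) := by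
  rw [subClass_fixSub_rhoGen_eq_sum]
  set e : ℕ → GrothendieckGroup SL(2, ZMod N) := fun j =>
    subClass (eigSub (reduction N rhoGen) ((zetaSix ^ 2) ^ j * zetaSix⁻¹ ^ n)) with he
  set z := subClass (eigSub (reduction N (-1)) ((-1 : ℂ) ^ n)) with hz
  have hsum : ∑ j ∈ Finset.range 3, e j = z := sum_eigSub_rhoGen N n
  have hper : ∀ j, e (3 + j) = e j := fun j => by
    simp only [he, pow_add, isPrimitiveRoot_zetaSix_sq.pow_eq_one, one_mul]
  have hsix : ∀ q, zetaSix⁻¹ ^ (6 * q) = 1 := fun q => by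
    rw [pow_mul, inv_pow, isPrimitiveRoot_zetaSix.pow_eq_one, inv_one, one_pow]
  have hinv : zetaSix * zetaSix⁻¹ = 1 := mul_inv_cancel₀ zetaSix_ne_zero
  have hinv3 : zetaSix⁻¹ ^ 3 = zetaSix ^ 3 := by
    rw [inv_pow, zetaSix_pow_three]
    norm_num
  have h1 : ind (image N GammaRho) (charClass 1) = subClass (eigSub (reduction N rhoGen) 1) := by
    have h := ind_chiRhoBar_pow N 0
    rwa [show chiRhoBar N ^ 0 = 1 from pow_zero _, pow_zero] at h
  have h3 : ind (image N GammaRho) (charClass (chiRhoBar N ^ 3)) =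
      subClass (eigSub (reduction N rhoGen) (zetaSix ^ 3)) := ind_chiRhoBar_pow N 3
  obtain ⟨q, r, hr, rfl⟩ : ∃ q r, r < 6 ∧ n = 6 * q + r :=
    ⟨n / 6, n % 6, Nat.mod_lt _ (by norm_num), (Nat.div_add_mod n 6).symm⟩
  have hmod : (6 * q + r + 2) % 6 = (r + 2) % 6 := by omega
  rw [epsRho, hmod]
  have hdiv : ∀ s t, r + 1 = 3 * s + t → ∑ j ∈ Finset.range (6 * q + r + 1), e j =
      (2 * q + s) • z + ∑ j ∈ Finset.range t, e j := fun s t h => by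
    rw [show 6 * q + r + 1 = 3 * (2 * q + s) + t by omega, sum_range_periodic e hper, hsum]
  have he' : ∀ j, e j = subClass (eigSub (reduction N rhoGen) ((zetaSix ^ 2) ^ j * zetaSix⁻¹ ^ r)) := by
    intro j
    simp only [he, pow_add, hsix, one_mul]
  have hz' : e 0 + e 1 = z - e 2 := by
    rw [← hsum, Finset.sum_range_succ, Finset.sum_range_succ, Finset.sum_range_one]
    abel
  interval_cases r
  · rw [hdiv 0 1 rfl, show (6 * q + 0 + 2) / 3 = 2 * q + 0 by omega, Finset.sum_range_one]
    change _ = _ + ind (image N GammaRho) (charClass 1)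
    rw [h1, he' 0]
    simp
  · rw [hdiv 0 2 rfl, show (6 * q + 1 + 2) / 3 = 2 * q + 0 + 1 by omega, Finset.sum_range_succ,
      Finset.sum_range_one, hz', succ_nsmul z (2 * q + 0), he' 2]
    change _ = _ + ind (image N GammaRho) (-charClass (chiRhoBar N ^ 3))
    rw [map_neg, h3, show (zetaSix ^ 2) ^ 2 * zetaSix⁻¹ ^ 1 = zetaSix ^ 3 by
      linear_combination zetaSix ^ 3 * hinv]
    abel
  · rw [hdiv 1 0 rfl, show (6 * q + 2 + 2) / 3 = 2 * q + 1 by omega, Finset.sum_range_zero]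
    change _ = _ + ind (image N GammaRho) 0
    rw [map_zero]
  · rw [hdiv 1 1 rfl, show (6 * q + 3 + 2) / 3 = 2 * q + 1 by omega, Finset.sum_range_one, he' 0]
    change _ = _ + ind (image N GammaRho) (charClass (chiRhoBar N ^ 3))
    rw [h3, hinv3, pow_zero, one_mul]
  · rw [hdiv 1 2 rfl, show (6 * q + 4 + 2) / 3 = 2 * q + 1 + 1 by omega, Finset.sum_range_succ,
      Finset.sum_range_one, hz', succ_nsmul z (2 * q + 1), he' 2]
    change _ = _ + ind (image N GammaRho) (-charClass 1)
    rw [map_neg, h1, show (zetaSix ^ 2) ^ 2 * zetaSix⁻¹ ^ 4 = 1 by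
      rw [← pow_mul, ← mul_pow, hinv, one_pow]]
    abel
  · rw [hdiv 2 0 rfl, show (6 * q + 5 + 2) / 3 = 2 * q + 2 by omega, Finset.sum_range_zero]
    change _ = _ + ind (image N GammaRho) 0
    rw [map_zero]

/-- The fixed functions of the stabilizer of `i` in terms of `ε_i`. -/
lemma subClass_fixSub_iGen (n : ℕ) : subClass (fixSub (reduction N) (symRep n) iGen) =
    ((n + 2) / 2) • subClass (eigSub (reduction N (-1)) ((-1 : ℂ) ^ n)) +
      ind (image N GammaI) (epsI N (n + 2)) := by
  rw [subClass_fixSub_iGen_eq_sum]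
  set e : ℕ → GrothendieckGroup SL(2, ZMod N) := fun j =>
    subClass (eigSub (reduction N iGen) (((-Complex.I) ^ 2) ^ j * (-Complex.I)⁻¹ ^ n)) with he
  set z := subClass (eigSub (reduction N (-1)) ((-1 : ℂ) ^ n)) with hz
  have hsum : ∑ j ∈ Finset.range 2, e j = z := sum_eigSub_iGen N n
  have hper : ∀ j, e (2 + j) = e j := fun j => by
    simp [he, pow_add]
  have hfour : ∀ q, (-Complex.I)⁻¹ ^ (4 * q) = 1 := fun q => by
    rw [pow_mul, inv_pow, isPrimitiveRoot_neg_I.pow_eq_one, inv_one, one_pow]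
  have h1 : ind (image N GammaI) (charClass 1) = subClass (eigSub (reduction N iGen) 1) := by
    have h := ind_chiIBar_pow N 0
    rwa [show chiIBar N ^ 0 = 1 from pow_zero _, pow_zero] at h
  have h2 : ind (image N GammaI) (charClass (chiIBar N ^ 2)) =
      subClass (eigSub (reduction N iGen) (-1)) := by
    simpa using ind_chiIBar_pow N 2
  obtain ⟨q, r, hr, rfl⟩ : ∃ q r, r < 4 ∧ n = 4 * q + r :=
    ⟨n / 4, n % 4, Nat.mod_lt _ (by norm_num), (Nat.div_add_mod n 4).symm⟩
  have hmod : (4 * q + r + 2) % 4 = (r + 2) % 4 := by omega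
  rw [epsI, hmod]
  have hdiv : ∀ s t, r + 1 = 2 * s + t → ∑ j ∈ Finset.range (4 * q + r + 1), e j =
      (2 * q + s) • z + ∑ j ∈ Finset.range t, e j := fun s t h => by
    rw [show 4 * q + r + 1 = 2 * (2 * q + s) + t by omega, sum_range_periodic e hper, hsum]
  have he' : ∀ j, e j =
      subClass (eigSub (reduction N iGen) (((-Complex.I) ^ 2) ^ j * (-Complex.I)⁻¹ ^ r)) := by
    intro j
    simp only [he, pow_add, hfour, one_mul]
  have hz' : e 0 = z - e 1 := by
    rw [← hsum, Finset.sum_range_succ, Finset.sum_range_one]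
    abel
  interval_cases r
  · rw [hdiv 0 1 rfl, show (4 * q + 0 + 2) / 2 = 2 * q + 0 + 1 by omega, Finset.sum_range_one, hz',
      succ_nsmul z (2 * q + 0), he' 1]
    change _ = _ + ind (image N GammaI) (-charClass (chiIBar N ^ 2))
    rw [map_neg, h2, show ((-Complex.I) ^ 2) ^ 1 * (-Complex.I)⁻¹ ^ 0 = -1 by simp]
    abel
  · rw [hdiv 1 0 rfl, show (4 * q + 1 + 2) / 2 = 2 * q + 1 by omega, Finset.sum_range_zero]
    change _ = _ + ind (image N GammaI) 0
    rw [map_zero]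
  · rw [hdiv 1 1 rfl, show (4 * q + 2 + 2) / 2 = 2 * q + 1 + 1 by omega, Finset.sum_range_one, hz',
      succ_nsmul z (2 * q + 1), he' 1]
    change _ = _ + ind (image N GammaI) (-charClass 1)
    rw [map_neg, h1, show ((-Complex.I) ^ 2) ^ 1 * (-Complex.I)⁻¹ ^ 2 = 1 by simp]
    abel
  · rw [hdiv 2 0 rfl, show (4 * q + 3 + 2) / 2 = 2 * q + 2 by omega, Finset.sum_range_zero]
    change _ = _ + ind (image N GammaI) 0
    rw [map_zero]

end Epsilon

end ParabolicCohomology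

end

open ParabolicCohomology in
theorem mainTheorem3 (N : ℕ) [Fact (2 < N)] :
    (h1Class N 2 - 2 • charClass 1 =
      ind (image N Zcenter) (charClass 1)
        - ind (image N GammaRho) (charClass 1)
        - ind (image N GammaI) (charClass 1)
        - ind (image N GammaInf) (charClass 1)) ∧
    (∀ k : ℕ, 2 < k →
      h1Class N k =
        weightCoeff k • ind (image N Zcenter) (charClass (sgnZBar N ^ k))
          - ind (image N GammaRho) (epsRho N k)
          - ind (image N GammaI) (epsI N k)
          - ind (image N GammaInf) (charClass (sgnInfBar N ^ k))) := by
  constructor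
  · have h := repClass_h1Rep_eq N (symRep 0)
    have hA := subClass_fixSub_of_trivial N (symRep 0) symRep_zero_apply symPowZeroEquiv
    have hZ : ind (image N Zcenter) (charClass 1) =
        subClass (fixSub (reduction N) (symRep 0) (-1)) := by
      rw [← show sgnZBar N ^ 0 = 1 from pow_zero _, ind_sgnZBar_pow, subClass_fixSub_neg_one]
      simp
    have hR : ind (image N GammaRho) (charClass 1) =
        subClass (fixSub (reduction N) (symRep 0) rhoGen) := by
      rw [← show chiRhoBar N ^ 0 = 1 from pow_zero _, ind_chiRhoBar_pow, subClass_fixSub_rhoGen_eq_sum]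
      simp
    have hI : ind (image N GammaI) (charClass 1) =
        subClass (fixSub (reduction N) (symRep 0) iGen) := by
      rw [← show chiIBar N ^ 0 = 1 from pow_zero _, ind_chiIBar_pow, subClass_fixSub_iGen_eq_sum]
      simp
    have hT : ind (image N GammaInf) (charClass 1) =
        subClass (fixSub (reduction N) (symRep 0) (-1) ⊓
          fixSub (reduction N) (symRep 0) transGen) := by
      rw [← show sgnInfBar N ^ 0 = 1 from pow_zero _, ind_sgnInfBar_pow, subClass_fixSub_cusp]
    rw [subClass_inf_of_trivial N (symRep 0) symRep_zero_apply symPowZeroEquiv] at h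
    rw [hZ, hR, hI, hT]
    change repClass (h1Rep N (symRep 0)) - _ = _
    rw [h, two_nsmul, two_nsmul, hA]
    abel
  · intro k hk
    obtain ⟨n, rfl⟩ : ∃ n, k = n + 2 := ⟨k - 2, by omega⟩
    have hn : n ≠ 0 := by omega
    have h := repClass_h1Rep_eq N (symRep n)
    have hpow : (-1 : ℂ) ^ (n + 2) = (-1) ^ n := by rw [pow_add]; norm_num
    rw [augSub_eq_of_dual_invariants N (symRep n) (symRep_dual_invariants hn),
      subClass_inf_of_invariants N (symRep n) (symRep_invariants hn), subClass_fixSub_neg_one,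
      subClass_fixSub_rhoGen, subClass_fixSub_iGen, subClass_fixSub_cusp] at h
    rw [ind_sgnZBar_pow, ind_sgnInfBar_pow, hpow]
    change repClass (h1Rep N (symRep n)) = _
    rw [h, weightCoeff]
    simp only [← natCast_zsmul]
    generalize subClass (eigSub (reduction N (-1)) ((-1 : ℂ) ^ n)) = z
    push_cast
    module
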